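/- Let $d\ge 0$ and $n$ be integers with $d<n-1$, let $\alpha>0$, and write points of $\mathbb R^n$ as $z=(x,t)$ with $x\in\mathbb R^d$, $t\in\mathbb R^{n-d}$; identify $\mathbb R^d$ with $\{t=0\}$. For a Lipschitz function $F:\mathbb R^d\to\mathbb R^{n-d}$ with graph $\Gamma$, set $$D(X)=\Big\{\int_\Gamma |X-y|^{-d-\alpha}\,d\mathcal H^d(y)\Big\}^{-1/\alpha},\qquad A(X)=D(X)^{d+1-n}I,\qquad X\in\Omega=\mathbb R^n\setminus\Gamma .$$ A measure $\mu$ on $\mathbb R^n\setminus\mathbb R^d$ is a Carleson measure with constant $C$ if $\mu(B(x,r))\le C r^d$ for all $x\in\mathbb R^d$ and $r>0$. A matrix field $B$ on the complement of a set $E$ is elliptic relative to $E$ with constant $C$ if $\mathrm{dist}(X,E)^{n-d-1}B(X)\xi\cdot\zeta\le C|\xi||\zeta|$ and $\mathrm{dist}(X,E)^{n-d-1}B(X)\xi\cdot\xi\ge C^{-1}|\xi|^2$ for all $X\notin E$ and $\xi,\zeta\in\mathbb R^n$. There are constants $\varepsilon>0$ and $C\ge 1$, depending only on $n,d,\alpha$,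 such that if the Lipschitz constant of $F$ is at most $\varepsilon$, then there is a bijection $\rho:\mathbb R^n\to\mathbb R^n$, of class $C^1$ on $\mathbb R^n\setminus\mathbb R^d$, with $C^{-1}|z-w|\le|\rho(z)-\rho(w)|\le C|z-w|$ for all $z,w$ and $\rho(\mathbb R^d)=\Gamma$, such that $$\Big|\frac{D(\rho(x,t))}{|t|}-1\Big|^2\frac{dx\,dt}{|t|^{n-d}}$$ is a Carleson measure with constant $C$. Moreover, conjugating $L=\mathrm{div}\,A\nabla$ by $\rho$ gives $\widetilde L=\mathrm{div}\,\widetilde A\nabla$ on $\mathbb R^n\setminus\mathbb R^d$, where, $J$ being the Jacobian matrix of $\rho$, $$\widetilde A=|\det J|\,J^{-1}(A\circ\rho)\,J^{-T},$$ that is, $\int_\Omega A\nabla u\cdot\nabla\varphi=\int_{\mathbb R^n\setminus\mathbb R^d}\widetilde A\,\nabla(u\circ\rho)\cdot\nabla(\varphi\circ\rho)$ for $u\in C^1(\Omega)$ and $\varphi\in C^1_c(\Omega)$; and $\widetilde A=\widetilde A_1+\widetilde A_2$ on $\mathbb R^n\setminus\mathbb R^d$ with $\widetilde A_1,\widetilde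 A_2$ measurable, where 1. $\widetilde A$ and $\widetilde A_1$ are elliptic relative to $\mathbb R^d$ with constant $C$; 2. $\widetilde A_1=\begin{pmatrix}A_1'&0\\0&a_1''I\end{pmatrix}$ with $A_1'$ a $d\times d$ matrix and $a_1''$ a scalar function of class $C^1$ on $\mathbb R^n\setminus\mathbb R^d$ such that $\big||t|\,\nabla\big(|t|^{n-d-1}a_1''\big)\big|^2\frac{dx\,dt}{|t|^{n-d}}$ is a Carleson measure with constant $C$; 3. $\big||t|^{n-d-1}\widetilde A_2(x,t)\big|^2\frac{dx\,dt}{|t|^{n-d}}$ is a Carleson measure with constant $C$ (Hilbert–Schmidt norm). -/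

import Mathlib

open MeasureTheory Matrix
open scoped ENNReal NNReal MeasureTheory

noncomputable section

namespace HighCodim

/-- The ambient space `ℝⁿ = ℝ^d × ℝ^m`, with its Euclidean norm; `m = n - d` is the codimension. -/
abbrev Amb (d m : ℕ) : Type := EuclideanSpace ℝ (Fin d ⊕ Fin m)

/-- Real square matrices of size `n = d + m`. -/
abbrev Mat (d m : ℕ) : Type := Matrix (Fin d ⊕ Fin m) (Fin d ⊕ Fin m) ℝ

variable {d m : ℕ}

/-- The point `(x, t)` of `ℝⁿ`. -/
def pt (x : EuclideanSpace ℝ (Fin d)) (t : EuclideanSpace ℝ (Fin m)) : Amb d m :=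
  WithLp.toLp 2 (Sum.elim x.ofLp t.ofLp)

/-- The transversal component `t` of the point `z = (x, t)`. -/
def transv (z : Amb d m) : EuclideanSpace ℝ (Fin m) :=
  WithLp.toLp 2 (fun j => z (Sum.inr j))

/-- The plane `ℝ^d = {(x, 0)}` inside `ℝⁿ`. -/
def plane (d m : ℕ) : Set (Amb d m) :=
  Set.range fun x : EuclideanSpace ℝ (Fin d) => pt x (0 : EuclideanSpace ℝ (Fin m))

/-- The graph `Γ = {(x, F x)}` of `F : ℝ^d → ℝ^m`. -/
def graphOf (F : EuclideanSpace ℝ (Fin d) → EuclideanSpace ℝ (Fin m)) : Set (Amb d m) :=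
  Set.range fun x => pt x (F x)

/-- The smooth distance
`D(X) = (∫_Γ |X - y|^(-d-α) dH^d(y))^(-1/α)` associated with a `d`-dimensional set `Γ`. -/
def smoothDist (α : ℝ) (Γ : Set (Amb d m)) (X : Amb d m) : ℝ :=
  (∫ y in Γ, ‖X - y‖ ^ (-(d : ℝ) - α) ∂(Measure.hausdorffMeasure (d : ℝ))) ^ (-1 / α)

/-- The coefficients `A(X) = D(X)^(d+1-n) I`; recall `n - d = m`. -/
def coeff (α : ℝ) (Γ : Set (Amb d m)) (X : Amb d m) : Mat d m :=
  smoothDist α Γ X ^ (1 - (m : ℤ)) • (1 : Mat d m)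

/-- Degenerate ellipticity relative to a set `Γ` of dimension `d`, with constant `C`:
`dist(X, Γ)^(n-d-1) A(X) ξ · ζ ≤ C |ξ| |ζ|` and `dist(X, Γ)^(n-d-1) A(X) ξ · ξ ≥ C⁻¹ |ξ|²`
for all `X` outside `Γ` and all vectors `ξ, ζ`. -/
def IsDegElliptic (C : ℝ) (Γ : Set (Amb d m)) (A : Amb d m → Mat d m) : Prop :=
  ∀ X ∉ Γ,
    (∀ ξ ζ : Amb d m,
      Metric.infDist X Γ ^ ((m : ℤ) - 1) * ((A X *ᵥ ξ.ofLp) ⬝ᵥ ζ.ofLp) ≤ C * ‖ξ‖ * ‖ζ‖) ∧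
    (∀ ξ : Amb d m,
      C⁻¹ * ‖ξ‖ ^ 2 ≤ Metric.infDist X Γ ^ ((m : ℤ) - 1) * ((A X *ᵥ ξ.ofLp) ⬝ᵥ ξ.ofLp))

/-- The Jacobian matrix `(∂_j ρ_i)` of `ρ : ℝⁿ → ℝⁿ`. -/
def jac (ρ : Amb d m → Amb d m) (z : Amb d m) : Mat d m :=
  Matrix.of fun i j => (fderiv ℝ ρ z (EuclideanSpace.single j 1)) i

/-- The matrix `|det J| J⁻¹ A(ρ(z)) J⁻ᵀ`, `J` the Jacobian matrix of `ρ`, of the conjugate by `ρ`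
of the operator `div A ∇`. -/
def conjMatrix (ρ : Amb d m → Amb d m) (A : Amb d m → Mat d m) (z : Amb d m) : Mat d m :=
  |(jac ρ z).det| • ((jac ρ z)⁻¹ * A (ρ z) * ((jac ρ z)⁻¹)ᵀ)

/-- The weak form `∫_Ω A ∇u · ∇φ` of the operator `div A ∇` on `Ω`. -/
def weakForm (Ω : Set (Amb d m)) (A : Amb d m → Mat d m) (u φ : Amb d m → ℝ) : ℝ :=
  ∫ X in Ω, (A X *ᵥ (gradient u X).ofLp) ⬝ᵥ (gradient φ X).ofLp

/-- The measure `|f(x, t)|² dx dt / |t|^(n-d)` on `ℝⁿ` minus `ℝ^d` (the plane is a null set). -/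
def sqMeasure (f : Amb d m → ℝ) : Measure (Amb d m) :=
  volume.withDensity fun z => ENNReal.ofReal (|f z| ^ 2 / ‖transv z‖ ^ m)

/-- `μ` is a Carleson measure relative to `ℝ^d`, with constant `C`: `μ(B) ≤ C r^d` for
every ball `B` of radius `r` centred on `ℝ^d`. -/
def IsCarleson (C : ℝ) (μ : Measure (Amb d m)) : Prop :=
  ∀ (x : EuclideanSpace ℝ (Fin d)) (r : ℝ), 0 < r →
    μ (Metric.ball (pt x 0) r) ≤ ENNReal.ofReal (C * r ^ d)

/-- The Euclidean (Hilbert-Schmidt) norm of a matrix. -/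
def matNorm (M : Mat d m) : ℝ := Real.sqrt (∑ i, ∑ j, M i j ^ 2)

end HighCodim

end

open HighCodim

open HighCodim

open MeasureTheory Matrix
open scoped ENNReal NNReal MeasureTheory

noncomputable section

namespace HighCodim

set_option linter.unusedSectionVars false

variable {d m : ℕ}

/-! ### The measure dr/r and Carleson densities on the half space. -/

open Set Metric

/-! Write r = |t|. The change of variables is ρ(x,t) = (x, F_r(x)) + B(p(x,r)) t. Here F_r is the
mollification of F at scale r, and p(x,r) is the mollification at (x,r) of the field (DF, J), where
J is the density with respect to dx of the projection to the plane of the Hausdorff measure of Γ.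
For a slope G and a density λ, the linear map B(G,λ) sends the transversal space conformally, with
ratio h(G,λ), onto the orthogonal complement of the graph of G. The ratio is chosen so that the
Riesz-type integral over that graph, with constant density λ and seen from height h, equals exactly
1 (`exists_isFrame`). If Γ were flat with constant density, D(ρ(x,t)) would therefore be |t|. The
area formula is not needed: c ≤ J ≤ c(1+K)^d suffices (`exists_graph_density`), so a small Lipschitz
constant keeps the whole field in a small ball around (0,c), where h and B are of class C¹.

All errors are measured by `osc`, the size of the averages of the field at (x,r) against finitely
many profiles of mean zero. Plancherel's theorem gives an L² square function bound for such
averages, and localisation makes osc² dx dr/r a Carleson measure for bounded fields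
(`halfCarleson_osc`). Derivatives of mollifications are O(osc/r) (`hasFDerivAt_avg_bump`).

The distance D is not local. After rescaling by r its integrand at x+ru decays like (1+|u|)^(-d-α),
and replacing the graph near x+ru by its flat model at x costs the integral of `osc` along a path of
hyperbolic length about 1 + log(1+|u|). Hence |D(ρ(x,t))/|t| - 1| is bounded by `distOsc`, a
weighted average of displaced and rescaled copies of `osc` (`exists_riesz_estimate`,
`IsFrame.exists_smoothDist_estimate`). Carleson densities survive a displacement of size |u| with a
logarithmic loss (`HalfCarleson.comp_shift`), and the decay coming from α > 0 absorbs all the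
logarithms (`halfCarleson_distOsc`).

The Jacobian of ρ is, up to O(osc), the frame with columns (v, Gv) and B t, where G is the averaged
slope (`IsFrame.hasFDerivAt_flattening`). Orthogonality and conformality make the Gram matrix of the
frame block diagonal with a scalar transversal block (`IsFrame.gram_frameMap`), so conjugation by
the frame alone produces the principal part. The remainder is O(osc + distOsc). The scalar
coefficient, made homogeneous of degree zero, is a C¹ function of p(x,r), so |t| times its gradient
is O(osc).

Finally the derivative of ρ off the plane is uniformly close to one fixed linear isomorphism. Since
the plane has codimension at least two, any two points can be pushed slightly into a common half
space that misses it, so ρ is a Lipschitz-small perturbation of that isomorphism, hence a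
bilipschitz bijection (`IsFrame.exists_bilipschitz`). -/

/-- The measure `dr / r` on the half line `(0, ∞)`. -/
def logMeasure : Measure ℝ :=
  (volume.restrict (Ioi 0)).withDensity fun r => ENNReal.ofReal r⁻¹

instance : SFinite logMeasure := by unfold logMeasure; infer_instance

lemma lintegral_logMeasure {g : ℝ → ℝ≥0∞} (hg : Measurable g) :
    ∫⁻ r, g r ∂logMeasure = ∫⁻ r in Ioi (0 : ℝ), ENNReal.ofReal r⁻¹ * g r := by
  rw [logMeasure, lintegral_withDensity_eq_lintegral_mul _ (by fun_prop) hg]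
  rfl

/-- The measure dr/r is Haar measure of the multiplicative group. This invariance makes the Fourier
bound below uniform in the frequency and lets scales be dilated in Carleson estimates. -/
lemma lintegral_logMeasure_comp_mul {a : ℝ} (ha : 0 < a) {g : ℝ → ℝ≥0∞} (hg : Measurable g) :
    ∫⁻ r, g (a * r) ∂logMeasure = ∫⁻ r, g r ∂logMeasure := by
  rw [lintegral_logMeasure hg, lintegral_logMeasure (by fun_prop)]
  rw [← lintegral_indicator measurableSet_Ioi, ← lintegral_indicator measurableSet_Ioi]
  set G : ℝ → ℝ≥0∞ := (Ioi (0 : ℝ)).indicator fun r => ENNReal.ofReal r⁻¹ * g r with hG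
  have hGm : Measurable G :=
    ((by fun_prop : Measurable fun r : ℝ => ENNReal.ofReal r⁻¹ * g r)).indicator measurableSet_Ioi
  have h1 : ∀ r, (Ioi (0 : ℝ)).indicator (fun r => ENNReal.ofReal r⁻¹ * g (a * r)) r
      = ENNReal.ofReal a * G (a * r) := by
    intro r
    by_cases hr : 0 < r
    · have : 0 < a * r := by positivity
      simp only [hG, indicator, mem_Ioi, hr, this, if_true]
      rw [← mul_assoc, ← ENNReal.ofReal_mul ha.le]
      congr 2
      field_simp
    · have : ¬ 0 < a * r := by
        push Not at hr ⊢
        exact mul_nonpos_of_nonneg_of_nonpos ha.le hr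
      simp [hG, hr, this]
  simp_rw [h1]
  rw [lintegral_const_mul _ (by fun_prop)]
  have h2 := Real.smul_map_volume_mul_left (a := a) ha.ne'
  conv_rhs => rw [← h2]
  rw [lintegral_smul_measure, lintegral_map hGm (by fun_prop), abs_of_pos ha, smul_eq_mul]

lemma logMeasure_Ico_le {a b : ℝ} (ha : 0 < a) (hab : a ≤ b) :
    logMeasure (Ico a b) ≤ ENNReal.ofReal (Real.log (b / a)) := by
  have hb : 0 < b := ha.trans_le hab
  rw [logMeasure, withDensity_apply _ measurableSet_Ico, Measure.restrict_restrict measurableSet_Ico]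
  refine (lintegral_mono_set (t := Icc a b) (fun x hx => ⟨hx.1.1, hx.1.2.le⟩)).trans ?_
  rw [← integral_inv_of_pos ha hb, intervalIntegral.integral_of_le hab,
    ← integral_Icc_eq_integral_Ioc, ofReal_integral_eq_lintegral_ofReal]
  · apply ContinuousOn.integrableOn_Icc
    exact continuousOn_id.inv₀ fun x hx => (ha.trans_le hx.1).ne'
  · filter_upwards [ae_restrict_mem measurableSet_Icc] with x hx
    exact inv_nonneg.2 (ha.le.trans hx.1)

variable {E : Type*} [NormedAddCommGroup E] [InnerProductSpace ℝ E] [FiniteDimensional ℝ E]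
  [MeasurableSpace E] [BorelSpace E]

/-- `q(x, r) dx dr / r` is a Carleson measure on the half space `E × (0, ∞)`. -/
def HalfCarleson (C : ℝ≥0∞) (q : E → ℝ → ℝ≥0∞) : Prop :=
  ∀ (x₀ : E) (R : ℝ), 0 < R →
    ∫⁻ r in Ioo 0 R, (∫⁻ x in ball x₀ R, q x r) ∂logMeasure
      ≤ C * ENNReal.ofReal R ^ Module.finrank ℝ E

lemma volume_ball_eq (x₀ : E) {R : ℝ} (hR : 0 < R) :
    (volume : Measure E) (ball x₀ R)
      = ENNReal.ofReal R ^ Module.finrank ℝ E * volume (ball (0 : E) 1) := by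
  rw [Measure.addHaar_ball_of_pos _ _ hR, ENNReal.ofReal_pow hR.le]

lemma ae_logMeasure_pos : ∀ᵐ r ∂logMeasure, 0 < r := by
  unfold logMeasure
  refine (withDensity_absolutelyContinuous _ _).ae_le ?_
  exact ae_restrict_mem measurableSet_Ioi

lemma HalfCarleson.mono {C C' : ℝ≥0∞} {q q' : E → ℝ → ℝ≥0∞} (h : HalfCarleson C q)
    (hC : C ≤ C') (hq : ∀ x r, 0 < r → q' x r ≤ q x r) : HalfCarleson C' q' := by
  intro x₀ R hR
  refine le_trans ?_ ((h x₀ R hR).trans (by gcongr))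
  refine lintegral_mono_ae ?_
  filter_upwards [ae_restrict_of_ae ae_logMeasure_pos] with r hr
  exact lintegral_mono fun x => hq x r hr

lemma HalfCarleson.const_mul {C : ℝ≥0∞} {q : E → ℝ → ℝ≥0∞} (h : HalfCarleson C q)
    (hq : Measurable (Function.uncurry q)) (c : ℝ≥0∞) :
    HalfCarleson (c * C) fun x r => c * q x r := by
  intro x₀ R hR
  have h1 : ∀ r, ∫⁻ x in ball x₀ R, c * q x r = c * ∫⁻ x in ball x₀ R, q x r := fun r =>
    lintegral_const_mul _ (hq.comp (by fun_prop : Measurable fun x : E => (x, r)))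
  simp_rw [h1]
  rw [lintegral_const_mul, mul_assoc]
  · gcongr; exact h x₀ R hR
  · exact (hq.comp measurable_swap).lintegral_prod_right'

lemma HalfCarleson.add {C C' : ℝ≥0∞} {q q' : E → ℝ → ℝ≥0∞} (h : HalfCarleson C q)
    (h' : HalfCarleson C' q') (hq : Measurable (Function.uncurry q)) :
    HalfCarleson (C + C') fun x r => q x r + q' x r := by
  intro x₀ R hR
  have h1 : ∀ r, ∫⁻ x in ball x₀ R, (q x r + q' x r)
      = (∫⁻ x in ball x₀ R, q x r) + ∫⁻ x in ball x₀ R, q' x r := fun r =>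
    lintegral_add_left (hq.comp (by fun_prop : Measurable fun x : E => (x, r))) _
  simp_rw [h1]
  rw [lintegral_add_left, add_mul]
  · gcongr
    · exact h x₀ R hR
    · exact h' x₀ R hR
  · exact (hq.comp measurable_swap).lintegral_prod_right'

lemma HalfCarleson.sum {ι : Type*} (s : Finset ι) {C : ι → ℝ≥0∞} {q : ι → E → ℝ → ℝ≥0∞}
    (h : ∀ i ∈ s, HalfCarleson (C i) (q i)) (hq : ∀ i ∈ s, Measurable (Function.uncurry (q i))) :
    HalfCarleson (∑ i ∈ s, C i) fun x r => ∑ i ∈ s, q i x r := by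
  classical
  induction s using Finset.induction_on with
  | empty => intro x₀ R hR; simp
  | insert a s ha ih =>
    simp only [Finset.sum_insert ha]
    exact (h a (by simp)).add (ih (fun i hi => h i (by simp [hi])) fun i hi => hq i (by simp [hi]))
      (hq a (by simp))

/-- A family of Carleson densities is stable under integration in a parameter. -/
lemma HalfCarleson.lintegral {Ω : Type*} [MeasurableSpace Ω] {μ : Measure Ω} [SFinite μ]
    {C : Ω → ℝ≥0∞} {q : Ω → E → ℝ → ℝ≥0∞}
    (hq : Measurable fun z : Ω × E × ℝ => q z.1 z.2.1 z.2.2)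
    (h : ∀ ω, HalfCarleson (C ω) (q ω)) :
    HalfCarleson (∫⁻ ω, C ω ∂μ) fun x r => ∫⁻ ω, q ω x r ∂μ := by
  intro x₀ R hR
  have h1 : ∀ r, ∫⁻ x in ball x₀ R, (∫⁻ ω, q ω x r ∂μ)
      = ∫⁻ ω, (∫⁻ x in ball x₀ R, q ω x r) ∂μ := fun r =>
    lintegral_lintegral_swap (hq.comp
      (by fun_prop : Measurable fun z : E × Ω => (z.2, z.1, r))).aemeasurable
  simp_rw [h1]
  rw [lintegral_lintegral_swap]
  · have h2 := fun ω => h ω x₀ R hR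
    refine (lintegral_mono h2).trans ?_
    rw [lintegral_mul_const' _ _ (by finiteness)]
  · refine Measurable.aemeasurable ?_
    refine Measurable.lintegral_prod_right' (f := fun z : (ℝ × Ω) × E => q z.1.2 z.2 z.1.1) ?_
    exact hq.comp (by fun_prop : Measurable fun z : (ℝ × Ω) × E => (z.1.2, z.2, z.1.1))

/-- Affine displacements act on bounded Carleson densities with a logarithmic loss. -/
lemma HalfCarleson.comp_shift {C M : ℝ≥0∞} {q : E → ℝ → ℝ≥0∞} (h : HalfCarleson C q)
    (hq : Measurable (Function.uncurry q)) (hM : ∀ x r, 0 < r → q x r ≤ M)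
    {A σ : ℝ} {v : E} (hv : ‖v‖ ≤ A) (hσ : 0 < σ) (hσA : σ ≤ 1 + A) :
    HalfCarleson (2 ^ Module.finrank ℝ E * C
      + M * volume (ball (0 : E) 1) * ENNReal.ofReal (Real.log (1 + A)))
      fun x r => q (x + r • v) (σ * r) := by
  intro x₀ R hR
  have hA : 0 ≤ A := (norm_nonneg v).trans hv
  -- Below the threshold b the displaced ball stays in the ball of radius 2R and the new scale below
  -- 2R, so the Carleson bound applies there. Above it only the bound M is used, and the interval
  -- [b, R) has logarithmic length log(1 + A).
  set b : ℝ := R / (1 + A) with hb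
  have hb0 : 0 < b := by positivity
  have hbR : b ≤ R := div_le_self hR.le (by linarith)
  have hsub : Ioo 0 R ⊆ Ioo 0 b ∪ Ico b R := fun r hr => by
    rcases lt_or_ge r b with h | h
    · exact Or.inl ⟨hr.1, h⟩
    · exact Or.inr ⟨h, hr.2⟩
  refine (lintegral_mono_set hsub).trans ((lintegral_union_le _ _ _).trans ?_)
  rw [add_mul]
  refine add_le_add ?_ ?_
  · set g : ℝ → ℝ≥0∞ := fun r => (Ioo 0 (2 * R)).indicator
      (fun r => ∫⁻ x in ball x₀ (2 * R), q x r) r with hg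
    have hgm : Measurable g := by
      refine Measurable.indicator ?_ measurableSet_Ioo
      exact (hq.comp measurable_swap).lintegral_prod_right'
    have h1 : ∫⁻ r in Ioo 0 b, (∫⁻ x in ball x₀ R, q (x + r • v) (σ * r)) ∂logMeasure
        ≤ ∫⁻ r, g (σ * r) ∂logMeasure := by
      rw [← lintegral_indicator measurableSet_Ioo]
      refine lintegral_mono fun r => ?_
      by_cases hr : r ∈ Ioo 0 b
      · have hr1 : r * (1 + A) < R := by
          have := hr.2; rwa [hb, lt_div_iff₀ (by positivity)] at this
        have hr0 := hr.1
        have h2 : σ * r ∈ Ioo 0 (2 * R) := ⟨by positivity, by nlinarith⟩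
        simp only [hg, indicator_of_mem hr, indicator_of_mem h2]
        have h3 : ∫⁻ x in ball x₀ R, q (x + r • v) (σ * r)
            = ∫⁻ x in ball (x₀ + r • v) R, q x (σ * r) := by
          rw [← lintegral_indicator measurableSet_ball, ← lintegral_indicator measurableSet_ball,
            ← lintegral_add_right_eq_self ((ball (x₀ + r • v) R).indicator _) (r • v)]
          congr 1
          ext x
          simp [indicator, mem_ball]
        rw [h3]
        refine lintegral_mono_set (ball_subset_ball' ?_)
        have : dist (x₀ + r • v) x₀ ≤ R := by
          rw [dist_eq_norm, add_sub_cancel_left, norm_smul, Real.norm_of_nonneg hr0.le]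
          nlinarith
        linarith
      · simp [indicator_of_notMem hr]
    refine h1.trans ?_
    rw [lintegral_logMeasure_comp_mul hσ hgm, hg, lintegral_indicator measurableSet_Ioo]
    refine (h x₀ (2 * R) (by positivity)).trans (le_of_eq ?_)
    rw [ENNReal.ofReal_mul (by norm_num), mul_pow]
    norm_num
    ring
  · calc ∫⁻ r in Ico b R, (∫⁻ x in ball x₀ R, q (x + r • v) (σ * r)) ∂logMeasure
        ≤ ∫⁻ r in Ico b R, M * volume (ball x₀ R) ∂logMeasure := by
          refine lintegral_mono_ae ?_
          filter_upwards [ae_restrict_of_ae ae_logMeasure_pos] with r hr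
          refine (lintegral_mono fun x => hM _ _ (by positivity)).trans ?_
          simp
      _ = M * volume (ball x₀ R) * logMeasure (Ico b R) := by simp
      _ ≤ M * volume (ball x₀ R) * ENNReal.ofReal (Real.log (R / b)) := by
          gcongr; exact logMeasure_Ico_le hb0 hbR
      _ = _ := by
          rw [volume_ball_eq x₀ hR]
          have : R / b = 1 + A := by rw [hb]; field_simp
          rw [this]; ring

/-- Cauchy–Schwarz with the weight shared equally between the two factors. -/
lemma lintegral_mul_sq_le {Ω : Type*} [MeasurableSpace Ω] {μ : Measure Ω} {w g : Ω → ℝ≥0∞}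
    (hw : Measurable w) (hg : Measurable g) :
    (∫⁻ ω, w ω * g ω ∂μ) ^ 2 ≤ (∫⁻ ω, w ω ∂μ) * ∫⁻ ω, w ω * g ω ^ 2 ∂μ := by
  have h := ENNReal.lintegral_mul_le_Lp_mul_Lq μ (p := 2) (q := 2) (by
    rw [Real.holderConjugate_iff]; norm_num) (f := fun ω => w ω ^ (1 / 2 : ℝ))
    (g := fun ω => w ω ^ (1 / 2 : ℝ) * g ω) (by fun_prop) (by fun_prop)
  have h1 : ∀ ω, (w ω ^ (1 / 2 : ℝ)) * (w ω ^ (1 / 2 : ℝ) * g ω) = w ω * g ω := fun ω => by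
    rw [← mul_assoc, ← ENNReal.rpow_add_of_nonneg _ _ (by norm_num) (by norm_num)]
    norm_num
  have h2 : ∀ ω, (w ω ^ (1 / 2 : ℝ)) ^ (2 : ℝ) = w ω := fun ω => by
    rw [← ENNReal.rpow_mul]; norm_num
  simp only [Pi.mul_apply, h1, ENNReal.mul_rpow_of_nonneg _ _ (by norm_num : (0 : ℝ) ≤ 2), h2] at h
  calc _ ≤ ((∫⁻ ω, w ω ∂μ) ^ (1 / 2 : ℝ) * (∫⁻ ω, w ω * g ω ^ (2 : ℝ) ∂μ) ^ (1 / 2 : ℝ)) ^ 2 := by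
        gcongr
    _ = _ := by
        rw [mul_pow, ← ENNReal.rpow_natCast, ← ENNReal.rpow_natCast, ← ENNReal.rpow_mul,
          ← ENNReal.rpow_mul]
        norm_num

/-- Squares of weighted averages of displaced copies of `Q` are Carleson densities. -/
lemma HalfCarleson.sq_average {C M : ℝ≥0∞} {Q : E → ℝ → ℝ≥0∞}
    (h : HalfCarleson C fun x r => Q x r ^ 2)
    (hQ : Measurable (Function.uncurry Q)) (hM : ∀ x r, 0 < r → Q x r ≤ M)
    {Ω : Type*} [MeasurableSpace Ω] {μ : Measure Ω} [SFinite μ] {w : Ω → ℝ≥0∞}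
    {A σ : Ω → ℝ} {v : Ω → E} (hw : Measurable w) (hσm : Measurable σ) (hvm : Measurable v)
    (hv : ∀ ω, ‖v ω‖ ≤ A ω) (hσ : ∀ᵐ ω ∂μ, 0 < σ ω)
    (hσA : ∀ ω, σ ω ≤ 1 + A ω) :
    HalfCarleson ((∫⁻ ω, w ω ∂μ) * ∫⁻ ω, w ω * (2 ^ Module.finrank ℝ E * C
      + M ^ 2 * volume (ball (0 : E) 1) * ENNReal.ofReal (Real.log (1 + A ω))) ∂μ)
      fun x r => (∫⁻ ω, w ω * Q (x + r • v ω) (σ ω * r) ∂μ) ^ 2 := by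
  -- Integration in the parameter requires a Carleson bound for every ω, whereas the scales are
  -- positive only almost everywhere; the exceptional scales are reset to 1, which does not change
  -- the integral.
  set σ' : Ω → ℝ := fun ω => if 0 < σ ω then σ ω else 1 with hσ'
  have hσ'm : Measurable σ' := Measurable.ite (measurableSet_lt measurable_const hσm) hσm
    measurable_const
  have hmeas : Measurable fun z : Ω × E × ℝ => Q (z.2.1 + z.2.2 • v z.1) (σ' z.1 * z.2.2) :=
    hQ.comp (by fun_prop :
      Measurable fun z : Ω × E × ℝ => (z.2.1 + z.2.2 • v z.1, σ' z.1 * z.2.2))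
  have key : HalfCarleson (∫⁻ ω, w ω * (2 ^ Module.finrank ℝ E * C
      + M ^ 2 * volume (ball (0 : E) 1) * ENNReal.ofReal (Real.log (1 + A ω))) ∂μ)
      fun x r => ∫⁻ ω, w ω * Q (x + r • v ω) (σ' ω * r) ^ 2 ∂μ := by
    refine HalfCarleson.lintegral (q := fun ω x r => w ω * Q (x + r • v ω) (σ' ω * r) ^ 2) ?_ ?_
    · exact (hw.comp measurable_fst).mul (hmeas.pow_const 2)
    · intro ω
      have hA : 0 ≤ A ω := (norm_nonneg _).trans (hv ω)
      refine HalfCarleson.const_mul (h.comp_shift (hQ.pow_const 2)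
        (fun x r hr => pow_le_pow_left' (hM x r hr) 2) (hv ω) ?_ ?_) ?_ _
      · simp only [hσ']; split_ifs with h0 <;> linarith
      · simp only [hσ']; split_ifs with h0
        · exact hσA ω
        · linarith
      · exact (hQ.comp (by fun_prop : Measurable fun z : E × ℝ =>
          (z.1 + z.2 • v ω, σ' ω * z.2))).pow_const 2
  refine HalfCarleson.mono (key.const_mul ?_ (∫⁻ ω, w ω ∂μ)) le_rfl ?_
  · refine Measurable.lintegral_prod_left' (f := fun z : Ω × E × ℝ =>
      w z.1 * Q (z.2.1 + z.2.2 • v z.1) (σ' z.1 * z.2.2) ^ 2) ?_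
    exact (hw.comp measurable_fst).mul (hmeas.pow_const 2)
  · intro x r hr
    have h1 : ∫⁻ ω, w ω * Q (x + r • v ω) (σ ω * r) ∂μ
        = ∫⁻ ω, w ω * Q (x + r • v ω) (σ' ω * r) ∂μ := by
      refine lintegral_congr_ae ?_
      filter_upwards [hσ] with ω hω
      simp [hσ', hω]
    rw [h1]
    exact lintegral_mul_sq_le hw (hmeas.comp (by fun_prop : Measurable fun ω : Ω => (ω, x, r)))

/-- Integration in polar coordinates against `dt / |t|^m`. -/
lemma lintegral_norm_div_pow {E' : Type*} [NormedAddCommGroup E'] [InnerProductSpace ℝ E']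
    [FiniteDimensional ℝ E'] [MeasurableSpace E'] [BorelSpace E'] [Nontrivial E']
    {g : ℝ → ℝ≥0∞} (hg : Measurable g) :
    ∫⁻ t : E', ENNReal.ofReal ((‖t‖ ^ Module.finrank ℝ E')⁻¹) * g ‖t‖
      = (volume : Measure E').toSphere univ * ∫⁻ r, g r ∂logMeasure := by
  set n := Module.finrank ℝ E' with hn
  set G : ℝ → ℝ≥0∞ := fun r => ENNReal.ofReal ((r ^ n)⁻¹) * g r with hG
  have hGm : Measurable G := by fun_prop
  have hn1 : 1 ≤ n := Module.finrank_pos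
  calc ∫⁻ t : E', G ‖t‖ = ∫⁻ t in ({0}ᶜ : Set E'), G ‖t‖ := by
        rw [restrict_compl_singleton]
    _ = ∫⁻ t : ({0}ᶜ : Set E'), G ‖t.1‖ ∂((volume : Measure E').comap (↑)) := by
        rw [lintegral_subtype_comap (measurableSet_singleton _).compl fun x => G ‖x‖]
    _ = ∫⁻ x, G x.2 ∂(volume : Measure E').toSphere.prod (.volumeIoiPow (n - 1)) := by
        have := (volume : Measure E').measurePreserving_homeomorphUnitSphereProd.lintegral_comp
          (f := fun x => G x.2) (by fun_prop)
        rw [← this]; simp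
    _ = (volume : Measure E').toSphere univ
          * ∫⁻ x : Ioi (0 : ℝ), G x ∂.volumeIoiPow (n - 1) := by
        rw [lintegral_prod _ (by fun_prop)]
        simp [mul_comm]
    _ = _ := by
        congr 1
        rw [lintegral_logMeasure hg, Measure.volumeIoiPow,
          lintegral_withDensity_eq_lintegral_mul _ (by fun_prop) (by fun_prop)]
        refine (lintegral_subtype_comap measurableSet_Ioi
          (fun r : ℝ => ENNReal.ofReal (r ^ (n - 1)) * G r)).trans ?_
        refine setLIntegral_congr_fun measurableSet_Ioi fun r (hr : 0 < r) => ?_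
        simp only [hG]
        rw [← mul_assoc, ← ENNReal.ofReal_mul (by positivity)]
        congr 2
        -- The radial density r^(n-1) against r^(-n) leaves exactly 1/r; positivity of the dimension
        -- keeps the truncated exponent n - 1 honest.
        obtain ⟨k, hk⟩ : ∃ k, n = k + 1 := ⟨n - 1, by omega⟩
        rw [hk]
        simp only [Nat.add_sub_cancel]
        field_simp
        ring

/-! ### Square function estimates for averages against mean zero profiles. -/

section SquareFunction

open Set Metric Filter Topology
open scoped ContDiff SchwartzMap FourierTransform Convolution

variable {E : Type*} [NormedAddCommGroup E] [InnerProductSpace ℝ E] [FiniteDimensional ℝ E]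
  [MeasurableSpace E] [BorelSpace E]
  {V : Type*} [NormedAddCommGroup V] [NormedSpace ℝ V]

/-- The average `∫ ψ(u) f(x - r u) du` of `f` at scale `r` against the profile `ψ`. -/
def avg (ψ : E → ℝ) (f : E → V) (x : E) (r : ℝ) : V := ∫ u, ψ u • f (x - r • u)

/-- The dilate `r⁻ᵈ ψ(x / r)` of a profile. -/
def dilate (ψ : E → ℝ) (r : ℝ) (x : E) : ℝ := (r ^ Module.finrank ℝ E)⁻¹ * ψ (r⁻¹ • x)

lemma avg_eq_integral_dilate (ψ : E → ℝ) (f : E → V) (x : E) {r : ℝ} (hr : 0 < r) :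
    avg ψ f x r = ∫ y, dilate ψ r (x - y) • f y := by
  have h1 := Measure.integral_comp_smul (volume : Measure E)
    (fun w => ψ (r⁻¹ • w) • f (x - w)) r
  have h2 := integral_sub_left_eq_self (fun w => ψ (r⁻¹ • w) • f (x - w)) (volume : Measure E) x
  simp only [sub_sub_cancel] at h2
  rw [← h2, abs_of_pos (by positivity), ← integral_smul] at h1
  simpa [avg, dilate, smul_smul, inv_mul_cancel_left₀ hr.ne', hr.ne'] using h1

lemma dilate_contDiff {ψ : E → ℝ} (hψ : ContDiff ℝ ∞ ψ) (r : ℝ) :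
    ContDiff ℝ ∞ (dilate ψ r) := by
  unfold dilate; fun_prop

lemma dilate_hasCompactSupport {ψ : E → ℝ} (hψ : HasCompactSupport ψ) {r : ℝ} (hr : 0 < r) :
    HasCompactSupport (dilate ψ r) := by
  have h1 := hψ.comp_homeomorph (Homeomorph.smulOfNeZero r⁻¹ (inv_ne_zero hr.ne'))
  exact h1.mul_left (f := fun _ => (r ^ Module.finrank ℝ E)⁻¹)

/-- A smooth compactly supported real profile as a complex valued Schwartz function. -/
def toSchwartz (ψ : E → ℝ) (hψ : ContDiff ℝ ∞ ψ) (hc : HasCompactSupport ψ) : 𝓢(E, ℂ) :=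
  HasCompactSupport.toSchwartzMap (f := fun x => (ψ x : ℂ))
    (hc.comp_left (g := Complex.ofReal) (by simp)) (Complex.ofRealCLM.contDiff.comp hψ)

lemma toSchwartz_apply (ψ : E → ℝ) (hψ : ContDiff ℝ ∞ ψ) (hc : HasCompactSupport ψ) (x : E) :
    toSchwartz ψ hψ hc x = (ψ x : ℂ) := rfl

lemma fourier_toSchwartz_dilate {ψ : E → ℝ} (hψ : ContDiff ℝ ∞ ψ) (hc : HasCompactSupport ψ)
    {r : ℝ} (hr : 0 < r) (ξ : E) :
    𝓕 (toSchwartz (dilate ψ r) (dilate_contDiff hψ r) (dilate_hasCompactSupport hc hr)) ξ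
      = 𝓕 (toSchwartz ψ hψ hc) (r • ξ) := by
  rw [SchwartzMap.fourier_coe, SchwartzMap.fourier_coe, Real.fourier_eq, Real.fourier_eq]
  have h1 := Measure.integral_comp_smul (volume : Measure E)
    (fun v => Real.fourierChar (-inner ℝ v ξ) •
      (ψ (r⁻¹ • v) : ℂ)) r
  rw [abs_of_pos (by positivity), ← integral_smul] at h1
  simp only [toSchwartz_apply, dilate]
  simp only [inv_smul_smul₀ hr.ne', inner_smul_left] at h1
  simp only [inner_smul_right]
  simp only [conj_trivial] at h1
  rw [h1]
  congr 1
  ext v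
  simp only [Circle.smul_def, Complex.real_smul, smul_eq_mul]
  push_cast
  ring

lemma lintegral_enorm_sq_schwartz (k : 𝓢(E, ℂ)) :
    ∫⁻ x, ‖k x‖ₑ ^ 2 = ENNReal.ofReal (∫ x, ‖k x‖ ^ 2) := by
  rw [ofReal_integral_eq_lintegral_ofReal]
  · congr 1; ext x
    rw [ENNReal.ofReal_pow (norm_nonneg _), ofReal_norm]
  · exact (k.memLp 2).integrable_norm_pow (by norm_num)
  · exact .of_forall fun x => by positivity

/-- Plancherel, together with the multiplicativity of the Fourier transform on convolutions. -/
lemma lintegral_sq_convolution (f g : 𝓢(E, ℂ)) :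
    ∫⁻ x, ‖∫ y, f (x - y) * g y‖ₑ ^ 2 = ∫⁻ ξ, ‖𝓕 f ξ‖ₑ ^ 2 * ‖𝓕 g ξ‖ₑ ^ 2 := by
  set h := SchwartzMap.convolution (ContinuousLinearMap.mul ℂ ℂ) g f with hh
  have h1 : ∀ x, h x = ∫ y, f (x - y) * g y := fun x => by
    rw [hh, SchwartzMap.convolution_apply]
    simp [convolution, mul_comm]
  have h2 : ∀ ξ, 𝓕 h ξ = 𝓕 f ξ * 𝓕 g ξ := fun ξ => by
    rw [hh, SchwartzMap.fourier_convolution]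
    simp [mul_comm]
  simp_rw [← h1]
  rw [lintegral_enorm_sq_schwartz h, ← SchwartzMap.integral_norm_sq_fourier,
    ← lintegral_enorm_sq_schwartz]
  simp_rw [h2, enorm_mul, mul_pow]

/-- Against dr/r the integrand is r near the origin and r^(-3) at infinity. -/
lemma lintegral_min_inv_sq_lt_top :
    ∫⁻ r, ENNReal.ofReal (min r r⁻¹) ^ 2 ∂logMeasure < ⊤ := by
  rw [lintegral_logMeasure (by fun_prop)]
  have hsub : Ioi (0 : ℝ) ⊆ Ioc 0 1 ∪ Ioi 1 := fun r hr => by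
    rcases le_or_gt r 1 with h | h
    · exact Or.inl ⟨hr, h⟩
    · exact Or.inr h
  refine ((lintegral_mono_set hsub).trans (lintegral_union_le _ _ _)).trans_lt ?_
  refine ENNReal.add_lt_top.2 ⟨?_, ?_⟩
  · calc _ ≤ ∫⁻ r in Ioc (0 : ℝ) 1, 1 := by
          refine setLIntegral_mono measurable_const fun r hr => ?_
          rw [← ENNReal.ofReal_pow (le_min hr.1.le (inv_nonneg.2 hr.1.le)),
            ← ENNReal.ofReal_mul (inv_nonneg.2 hr.1.le)]
          rw [← ENNReal.ofReal_one]
          refine ENNReal.ofReal_le_ofReal ?_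
          have h1 := hr.1
          calc r⁻¹ * min r r⁻¹ ^ 2 ≤ r⁻¹ * r ^ 2 := by
                gcongr
                exact min_le_left _ _
            _ = r := by field_simp
            _ ≤ 1 := hr.2
      _ < ⊤ := by simp
  · have h1 : IntegrableOn (fun r : ℝ => r ^ (-3 : ℝ)) (Ioi 1) :=
      integrableOn_Ioi_rpow_of_lt (by norm_num) (by norm_num)
    refine lt_of_le_of_lt ?_ h1.lintegral_lt_top
    refine setLIntegral_mono (by fun_prop) fun r hr => ?_
    have hr0 : (0 : ℝ) < r := lt_trans one_pos hr
    rw [← ENNReal.ofReal_pow (le_min hr0.le (inv_nonneg.2 hr0.le)),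
      ← ENNReal.ofReal_mul (inv_nonneg.2 hr0.le)]
    refine ENNReal.ofReal_le_ofReal ?_
    calc r⁻¹ * min r r⁻¹ ^ 2 ≤ r⁻¹ * r⁻¹ ^ 2 := by
          gcongr
          exact min_le_right _ _
      _ = r ^ (-3 : ℝ) := by
          rw [Real.rpow_neg hr0.le]; norm_cast; field_simp

/-- The radial square integral of a Schwartz function that vanishes at the origin. -/
lemma exists_lintegral_schwartz_le (φ : 𝓢(E, ℂ)) (h0 : φ 0 = 0) :
    ∃ C : ℝ≥0∞, C ≠ ⊤ ∧ ∀ ξ, ∫⁻ r, ‖φ (r • ξ)‖ₑ ^ 2 ∂logMeasure ≤ C := by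
  obtain ⟨C₁, hC₁⟩ := φ.decay 1 0
  obtain ⟨C₂, hC₂⟩ := φ.decay 0 1
  have h1 : ∀ ξ, ‖ξ‖ * ‖φ ξ‖ ≤ C₁ := fun ξ => by simpa using hC₁.2 ξ
  -- Vanishing at the origin gives linear smallness there by the mean value inequality; with the
  -- decay `h1`, φ(rξ) is at most K min(s, 1/s) for s = r|ξ|, and dilation invariance of dr/r
  -- removes ξ.
  have h2 : ∀ ξ, ‖φ ξ‖ ≤ C₂ * ‖ξ‖ := fun ξ => by
    have := (convex_univ (𝕜 := ℝ) (E := E)).norm_image_sub_le_of_norm_fderiv_le (f := φ)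
      (𝕜 := ℝ) (C := C₂) (x := 0) (y := ξ) (fun x _ => φ.differentiableAt)
      (fun x _ => by simpa [norm_iteratedFDeriv_one] using hC₂.2 x) (mem_univ _) (mem_univ _)
    simpa [h0] using this
  set K : ℝ := max C₁ C₂ with hK
  have hK0 : 0 ≤ K := hC₁.1.le.trans (le_max_left _ _)
  refine ⟨ENNReal.ofReal K ^ 2 * ∫⁻ r, ENNReal.ofReal (min r r⁻¹) ^ 2 ∂logMeasure,
    ENNReal.mul_ne_top (by finiteness) lintegral_min_inv_sq_lt_top.ne, fun ξ => ?_⟩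
  by_cases hξ : ξ = 0
  · simp [hξ, h0]
  have ha : 0 < ‖ξ‖ := norm_pos_iff.2 hξ
  rw [← lintegral_logMeasure_comp_mul ha (g := fun r => ENNReal.ofReal (min r r⁻¹) ^ 2)
    (by fun_prop), ← lintegral_const_mul _ (by fun_prop)]
  refine lintegral_mono_ae ?_
  filter_upwards [ae_logMeasure_pos] with r hr
  rw [← mul_pow, ← ENNReal.ofReal_mul hK0, ← ofReal_norm]
  gcongr
  have hn : ‖r • ξ‖ = ‖ξ‖ * r := by rw [norm_smul, Real.norm_of_nonneg hr.le, mul_comm]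
  have hs : 0 < ‖ξ‖ * r := by positivity
  rw [mul_min_of_nonneg _ _ hK0]
  refine le_min ?_ ?_
  · refine (h2 _).trans ?_
    rw [hn]; gcongr; exact le_max_right _ _
  · have := h1 (r • ξ)
    rw [hn] at this
    rw [← div_eq_mul_inv, le_div_iff₀ hs, mul_comm]
    exact this.trans (le_max_left _ _)

lemma measurable_uncurry_avg {ψ : E → ℝ} (hψ : Measurable ψ) {f : E → V}
    (hf : StronglyMeasurable f) :
    StronglyMeasurable (Function.uncurry (avg ψ f)) := by
  refine StronglyMeasurable.integral_prod_right
    (f := fun (z : E × ℝ) (u : E) => ψ u • f (z.1 - z.2 • u)) ?_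
  refine StronglyMeasurable.smul (hψ.comp measurable_snd).stronglyMeasurable ?_
  exact hf.comp_measurable (by fun_prop : Measurable fun z : (E × ℝ) × E => z.1.1 - z.1.2 • z.2)

/-- By Plancherel the double integral becomes the integral of |f̂(ξ)|² times that of |ψ̂(rξ)|² dr/r.
The inner factor is bounded uniformly in ξ because ψ̂(0) = ∫ψ = 0. -/
lemma square_function_schwartz {ψ : E → ℝ} (hψ : ContDiff ℝ ∞ ψ) (hc : HasCompactSupport ψ)
    (h0 : ∫ u, ψ u = 0) :
    ∃ C : ℝ≥0∞, C ≠ ⊤ ∧ ∀ f : 𝓢(E, ℂ),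
      ∫⁻ r, (∫⁻ x, ‖avg ψ f x r‖ₑ ^ 2) ∂logMeasure ≤ C * ∫⁻ x, ‖f x‖ₑ ^ 2 := by
  have hz : 𝓕 (toSchwartz ψ hψ hc) 0 = 0 := by
    rw [SchwartzMap.fourier_coe, Real.fourier_eq]
    simp only [inner_zero_right, neg_zero, AddChar.map_zero_eq_one, one_smul, toSchwartz_apply]
    rw [integral_complex_ofReal, h0, Complex.ofReal_zero]
  obtain ⟨C, hC, hle⟩ := exists_lintegral_schwartz_le _ hz
  refine ⟨C, hC, fun f => ?_⟩
  have h1 : ∀ᵐ r ∂logMeasure, ∫⁻ x, ‖avg ψ f x r‖ₑ ^ 2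
      = ∫⁻ ξ, ‖𝓕 (toSchwartz ψ hψ hc) (r • ξ)‖ₑ ^ 2 * ‖𝓕 f ξ‖ₑ ^ 2 := by
    filter_upwards [ae_logMeasure_pos] with r hr
    simp_rw [← fourier_toSchwartz_dilate hψ hc hr]
    rw [← lintegral_sq_convolution]
    congr 1; ext x
    rw [avg_eq_integral_dilate ψ f x hr]
    simp [toSchwartz_apply]
  rw [lintegral_congr_ae h1, lintegral_lintegral_swap]
  · calc _ = ∫⁻ ξ, (∫⁻ r, ‖𝓕 (toSchwartz ψ hψ hc) (r • ξ)‖ₑ ^ 2 ∂logMeasure) * ‖𝓕 f ξ‖ₑ ^ 2 := by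
          congr 1; ext ξ
          rw [lintegral_mul_const]
          have := (𝓕 (toSchwartz ψ hψ hc)).continuous.comp
            (by fun_prop : Continuous fun r : ℝ => r • ξ)
          exact this.enorm.measurable.pow_const 2
      _ ≤ ∫⁻ ξ, C * ‖𝓕 f ξ‖ₑ ^ 2 := by gcongr with ξ; exact hle ξ
      _ = C * ∫⁻ ξ, ‖𝓕 f ξ‖ₑ ^ 2 := by
          rw [lintegral_const_mul _ ((𝓕 f).continuous.enorm.measurable.pow_const 2)]
      _ = C * ∫⁻ ξ, ‖f ξ‖ₑ ^ 2 := by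
          rw [lintegral_enorm_sq_schwartz, lintegral_enorm_sq_schwartz,
             SchwartzMap.integral_norm_sq_fourier]
  · have h1 := (𝓕 (toSchwartz ψ hψ hc)).continuous.comp
      (by fun_prop : Continuous fun a : ℝ × E => a.1 • a.2)
    have h2 := (𝓕 f).continuous.comp (by fun_prop : Continuous fun a : ℝ × E => a.2)
    exact ((h1.enorm.measurable.pow_const 2).mul (h2.enorm.measurable.pow_const 2)).aemeasurable

lemma tendsto_avg_of_tendsto_eLpNorm {ψ : E → ℝ} (hψ : ContDiff ℝ ∞ ψ) (hc : HasCompactSupport ψ)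
    {f : E → ℂ} (hf : MemLp f 2 volume) {g : ℕ → E → ℂ} (hg : ∀ k, MemLp (g k) 2 volume)
    (h : Tendsto (fun k => eLpNorm (g k - f) 2 volume) atTop (𝓝 0)) (x : E) {r : ℝ} (hr : 0 < r) :
    Tendsto (fun k => avg ψ (g k) x r) atTop (𝓝 (avg ψ f x r)) := by
  set θ : E → ℝ := fun y => dilate ψ r (x - y) with hθ
  have hθc : HasCompactSupport θ :=
    (dilate_hasCompactSupport hc hr).comp_homeomorph (Homeomorph.subLeft x)
  have hθd : Continuous θ := (dilate_contDiff hψ r).continuous.comp (by fun_prop)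
  have hθL : MemLp θ 2 volume := hθd.memLp_of_hasCompactSupport hθc
  rw [tendsto_iff_norm_sub_tendsto_zero]
  have hint : ∀ k : E → ℂ, MemLp k 2 volume → Integrable (fun y => θ y • k y) := fun k hk =>
    memLp_one_iff_integrable.1 (hk.smul hθL)
  have hb : ∀ k, ENNReal.ofReal ‖avg ψ (g k) x r - avg ψ f x r‖
      ≤ eLpNorm θ 2 volume * eLpNorm (g k - f) 2 volume := fun k => by
    rw [avg_eq_integral_dilate ψ _ x hr, avg_eq_integral_dilate ψ _ x hr,
      ← integral_sub (hint _ (hg k)) (hint _ hf), ofReal_norm]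
    refine (enorm_integral_le_lintegral_enorm _).trans ?_
    have h1 := eLpNorm_smul_le_mul_eLpNorm (p := 2) (q := 2) (r := 1) (μ := volume)
      (f := g k - f) (φ := θ) ((hg k).sub hf).1 hθL.1
    rw [eLpNorm_one_eq_lintegral_enorm] at h1
    refine le_trans (le_of_eq ?_) h1
    congr 1; ext y
    simp [hθ, smul_sub]
  have h3 : Tendsto (fun k => eLpNorm θ 2 volume * eLpNorm (g k - f) 2 volume) atTop (𝓝 0) := by
    have := ENNReal.Tendsto.const_mul h (Or.inr hθL.eLpNorm_ne_top)
    simpa using this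
  have h4 := tendsto_of_tendsto_of_tendsto_of_le_of_le tendsto_const_nhds h3
    (fun _ => zero_le) hb
  have h5 := (ENNReal.tendsto_toReal ENNReal.zero_ne_top).comp h4
  simpa [Function.comp_def, ENNReal.toReal_ofReal (norm_nonneg _)] using h5

/-- Schwartz functions are dense in L² and, at each fixed (x,r), the average is continuous on L².
Fatou's lemma, used once in x and once in r, passes the estimate to the limit. -/
lemma square_function_memLp {ψ : E → ℝ} (hψ : ContDiff ℝ ∞ ψ) (hc : HasCompactSupport ψ)
    (h0 : ∫ u, ψ u = 0) :
    ∃ C : ℝ≥0∞, C ≠ ⊤ ∧ ∀ f : E → ℂ, MemLp f 2 volume →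
      ∫⁻ r, (∫⁻ x, ‖avg ψ f x r‖ₑ ^ 2) ∂logMeasure ≤ C * ∫⁻ x, ‖f x‖ₑ ^ 2 := by
  obtain ⟨C, hC, hle⟩ := square_function_schwartz hψ hc h0
  refine ⟨C, hC, fun f hf => ?_⟩
  have hdense := SchwartzMap.denseRange_toLpCLM (E := E) (F := ℂ) (p := 2)
    (μ := volume) ENNReal.ofNat_ne_top
  have hmem : hf.toLp f ∈ closure (range (SchwartzMap.toLpCLM ℝ ℂ 2 (volume : Measure E))) :=
    hdense _
  obtain ⟨s, hs, hlim⟩ := mem_closure_iff_seq_limit.1 hmem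
  choose g hg using hs
  have hgs : ∀ k, g k =ᵐ[volume] s k := fun k => by
    rw [← hg k]; exact ((g k).coeFn_toLp 2 volume).symm
  have hnorm : Tendsto (fun k => eLpNorm (⇑(g k) - f) 2 volume) atTop (𝓝 0) := by
    have := (Lp.tendsto_Lp_iff_tendsto_eLpNorm' s (hf.toLp f)).1 hlim
    refine this.congr fun k => eLpNorm_congr_ae ?_
    exact (hgs k).symm.sub hf.coeFn_toLp
  have hT := fun x (r : ℝ) (hr : 0 < r) =>
    tendsto_avg_of_tendsto_eLpNorm hψ hc hf (g := fun k => ⇑(g k)) (fun k => (g k).memLp 2) hnorm x hr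
  have hsq : ∀ k : E → ℂ, MemLp k 2 volume → ∫⁻ x, ‖k x‖ₑ ^ 2 = eLpNorm k 2 volume ^ 2 := fun k hk => by
    rw [eLpNorm_eq_lintegral_rpow_enorm_toReal (by norm_num) (by norm_num), ← ENNReal.rpow_natCast,
      ← ENNReal.rpow_mul]
    norm_num
  have hL : Tendsto (fun k => ∫⁻ x, ‖g k x‖ₑ ^ 2) atTop (𝓝 (∫⁻ x, ‖f x‖ₑ ^ 2)) := by
    simp_rw [hsq _ ((g _).memLp 2), hsq f hf]
    refine (ENNReal.continuous_pow 2).continuousAt.tendsto.comp ?_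
    have h1 := hlim.norm
    have h2 : ∀ k, eLpNorm (g k) 2 volume = ENNReal.ofReal ‖s k‖ := fun k => by
      rw [Lp.norm_def, ENNReal.ofReal_toReal (Lp.eLpNorm_ne_top _)]
      exact eLpNorm_congr_ae (hgs k)
    have h3 : eLpNorm f 2 volume = ENNReal.ofReal ‖hf.toLp f‖ := by
      rw [Lp.norm_toLp, ENNReal.ofReal_toReal hf.eLpNorm_ne_top]
    simp_rw [h2, h3]
    exact ENNReal.tendsto_ofReal h1
  have hmeas : ∀ k, Measurable fun z : ℝ × E => ‖avg ψ (g k) z.2 z.1‖ₑ ^ 2 := fun k => by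
    have := (measurable_uncurry_avg hψ.continuous.measurable
      (g k).continuous.stronglyMeasurable).measurable
    exact (this.comp measurable_swap).enorm.pow_const 2
  have hmeas' : ∀ k (r : ℝ), Measurable fun x : E => ‖avg ψ (g k) x r‖ₑ ^ 2 := fun k r => by
    have h5 := (measurable_uncurry_avg hψ.continuous.measurable
      (g k).continuous.stronglyMeasurable).measurable
    have h6 : Measurable fun x : E => avg ψ (g k) x r :=
      h5.comp (measurable_id.prodMk measurable_const)
    exact h6.enorm.pow_const 2
  have hgk : ∀ k, ∫⁻ r, (∫⁻ x, ‖avg ψ (g k) x r‖ₑ ^ 2) ∂logMeasure ≤ C * ∫⁻ x, ‖g k x‖ₑ ^ 2 :=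
    fun k => hle (g k)
  have hlim' : Tendsto (fun k => C * ∫⁻ x, ‖g k x‖ₑ ^ 2) atTop (𝓝 (C * ∫⁻ x, ‖f x‖ₑ ^ 2)) :=
    ENNReal.Tendsto.const_mul hL (Or.inr hC)
  calc ∫⁻ r, (∫⁻ x, ‖avg ψ f x r‖ₑ ^ 2) ∂logMeasure
      ≤ ∫⁻ r, liminf (fun k => ∫⁻ x, ‖avg ψ (g k) x r‖ₑ ^ 2) atTop ∂logMeasure := by
        refine lintegral_mono_ae ?_
        filter_upwards [ae_logMeasure_pos] with r hr
        refine le_trans (lintegral_mono fun x => le_of_eq ?_)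
          (lintegral_liminf_le fun k => hmeas' k r)
        have h5 := (ENNReal.continuous_pow 2).continuousAt.tendsto.comp (hT x r hr).enorm
        exact h5.liminf_eq.symm
    _ ≤ liminf (fun k => ∫⁻ r, (∫⁻ x, ‖avg ψ (g k) x r‖ₑ ^ 2) ∂logMeasure) atTop :=
        lintegral_liminf_le fun k => (hmeas k).lintegral_prod_right'
    _ ≤ liminf (fun k => C * ∫⁻ x, ‖g k x‖ₑ ^ 2) atTop :=
        liminf_le_liminf (Eventually.of_forall hgk)
    _ = C * ∫⁻ x, ‖f x‖ₑ ^ 2 := hlim'.liminf_eq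

/-- Averages of bounded real functions against mean zero profiles are Carleson densities. -/
lemma halfCarleson_avg_real {ψ : E → ℝ} (hψ : ContDiff ℝ ∞ ψ)
    (hs : ∀ u, 1 < ‖u‖ → ψ u = 0) (h0 : ∫ u, ψ u = 0) :
    ∃ C : ℝ≥0∞, C ≠ ⊤ ∧ ∀ (f : E → ℝ) (M : ℝ≥0∞), M ≠ ⊤ → Measurable f → (∀ x, ‖f x‖ₑ ≤ M) →
      HalfCarleson (C * M ^ 2) fun x r => ‖avg ψ f x r‖ₑ ^ 2 := by
  have hc : HasCompactSupport ψ := HasCompactSupport.intro (isCompact_closedBall (0 : E) 1)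
    fun u hu => hs u (by simpa using hu)
  obtain ⟨C, hC, hle⟩ := square_function_memLp hψ hc h0
  refine ⟨C * (2 ^ Module.finrank ℝ E * volume (ball (0 : E) 1)), by finiteness,
    fun f M hMt hf hM x₀ R hR => ?_⟩
  -- The profile lives in the unit ball, so for x in B(x₀, R) and r < R the average sees f only in
  -- B(x₀, 2R). Truncating there costs nothing and puts f in L² with norm squared O(R^d).
  set F : E → ℂ := (ball x₀ (2 * R)).indicator fun x => (f x : ℂ) with hF
  have hFm : Measurable F := (Complex.measurable_ofReal.comp hf).indicator measurableSet_ball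
  have hFb : ∀ x, ‖F x‖ₑ ≤ (ball x₀ (2 * R)).indicator (fun _ => M) x := fun x => by
    by_cases hx : x ∈ ball x₀ (2 * R)
    · simp only [hF, indicator_of_mem hx]
      rw [← ofReal_norm, Complex.norm_real, ofReal_norm]; exact hM x
    · simp [hF, indicator_of_notMem hx]
  have hFint : ∫⁻ x, ‖F x‖ₑ ^ 2 ≤ M ^ 2 * volume (ball x₀ (2 * R)) := by
    calc _ ≤ ∫⁻ x, (ball x₀ (2 * R)).indicator (fun _ => M ^ 2) x := by
          refine lintegral_mono fun x => (pow_le_pow_left' (hFb x) 2).trans (le_of_eq ?_)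
          by_cases hx : x ∈ ball x₀ (2 * R) <;> simp [hx]
      _ = _ := by rw [lintegral_indicator_const measurableSet_ball]
  have hFL : MemLp F 2 volume := by
    refine ⟨hFm.aestronglyMeasurable, ?_⟩
    rw [eLpNorm_lt_top_iff_lintegral_rpow_enorm_lt_top (by norm_num) (by norm_num)]
    norm_num
    exact hFint.trans_lt (ENNReal.mul_lt_top (by finiteness) measure_ball_lt_top)
  have h1 : ∫⁻ r in Ioo 0 R, (∫⁻ x in ball x₀ R, ‖avg ψ f x r‖ₑ ^ 2) ∂logMeasure
      ≤ ∫⁻ r, (∫⁻ x, ‖avg ψ F x r‖ₑ ^ 2) ∂logMeasure := by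
    refine le_trans ?_ (setLIntegral_le_lintegral (Ioo 0 R) _)
    refine setLIntegral_mono' measurableSet_Ioo fun r hr => ?_
    refine le_trans ?_ (setLIntegral_le_lintegral (ball x₀ R) _)
    refine setLIntegral_mono' measurableSet_ball fun x hx => le_of_eq ?_
    congr 1
    rw [← ofReal_norm, ← ofReal_norm]
    congr 1
    have h2 : avg ψ F x r = ((avg ψ f x r : ℝ) : ℂ) := by
      rw [avg, avg, ← integral_complex_ofReal]
      congr 1; ext u
      by_cases hu : 1 < ‖u‖
      · simp [hs u hu]
      · have : x - r • u ∈ ball x₀ (2 * R) := by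
          rw [mem_ball, dist_eq_norm] at hx ⊢
          calc ‖x - r • u - x₀‖ = ‖(x - x₀) - r • u‖ := by congr 1; abel
            _ ≤ ‖x - x₀‖ + ‖r • u‖ := norm_sub_le _ _
            _ ≤ ‖x - x₀‖ + r * 1 := by
                rw [norm_smul, Real.norm_of_nonneg hr.1.le]
                have := hr.1
                gcongr; exact not_lt.1 hu
            _ < 2 * R := by linarith [hr.2]
        simp [hF, indicator_of_mem this]
    rw [h2, Complex.norm_real]
  refine h1.trans ((hle F hFL).trans ?_)
  calc C * ∫⁻ x, ‖F x‖ₑ ^ 2 ≤ C * (M ^ 2 * volume (ball x₀ (2 * R))) := by gcongr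
    _ = _ := by
      rw [volume_ball_eq x₀ (by positivity), ENNReal.ofReal_mul (by norm_num), mul_pow]
      norm_num
      ring

/-- Averages of bounded functions against mean zero profiles are Carleson densities. -/
lemma halfCarleson_avg [FiniteDimensional ℝ V] [MeasurableSpace V] [BorelSpace V]
    {ψ : E → ℝ} (hψ : ContDiff ℝ ∞ ψ)
    (hs : ∀ u, 1 < ‖u‖ → ψ u = 0) (h0 : ∫ u, ψ u = 0) :
    ∃ C : ℝ≥0∞, C ≠ ⊤ ∧ ∀ (f : E → V) (M : ℝ≥0∞), M ≠ ⊤ → Measurable f → (∀ x, ‖f x‖ₑ ≤ M) →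
      HalfCarleson (C * M ^ 2) fun x r => ‖avg ψ f x r‖ₑ ^ 2 := by
  have hc : HasCompactSupport ψ := HasCompactSupport.intro (isCompact_closedBall (0 : E) 1)
    fun u hu => hs u (by simpa using hu)
  obtain ⟨C, hC, hle⟩ := halfCarleson_avg_real hψ hs h0
  set b := Module.finBasis ℝ V
  set n := Module.finrank ℝ V
  -- Vector values are reduced to real ones through coordinates; the factor n in D is the
  -- Cauchy–Schwarz loss for a sum of n terms.
  set ℓ : Fin n → V →L[ℝ] ℝ := fun i => LinearMap.toContinuousLinearMap (b.coord i) with hℓ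
  set D : ℝ≥0∞ := n * ∑ i, (‖b i‖ₑ ^ 2) * (C * ‖ℓ i‖ₑ ^ 2) with hD
  have hDt : D ≠ ⊤ := ENNReal.mul_ne_top (ENNReal.natCast_ne_top n)
    (ENNReal.sum_ne_top.2 fun i _ => by finiteness)
  refine ⟨D, hDt, fun f M hMt hf hM => ?_⟩
  have hint : ∀ (x : E) (r : ℝ), Integrable fun u => ψ u • f (x - r • u) := fun x r => by
    refine Integrable.mono' (g := fun u => ‖ψ u‖ * M.toReal)
      ((hψ.continuous.integrable_of_hasCompactSupport hc).norm.mul_const _) ?_ ?_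
    · exact (hψ.continuous.measurable.smul (hf.comp
        (by fun_prop : Continuous fun u : E => x - r • u).measurable)).aestronglyMeasurable
    · refine .of_forall fun u => ?_
      rw [norm_smul]
      gcongr
      have := ENNReal.toReal_mono hMt (hM (x - r • u))
      simpa using this
  have hcomp : ∀ i x r, ℓ i (avg ψ f x r) = avg ψ (fun y => ℓ i (f y)) x r := fun i x r => by
    rw [avg, ← ContinuousLinearMap.integral_comp_comm _ (hint x r)]
    simp [avg]
  have hfi : ∀ i, Measurable fun y => ℓ i (f y) := fun i => (ℓ i).continuous.measurable.comp hf
  have hi : ∀ i, HalfCarleson (C * (‖ℓ i‖ₑ * M) ^ 2)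
      fun x r => ‖avg ψ (fun y => ℓ i (f y)) x r‖ₑ ^ 2 := fun i => by
    refine hle _ _ (by finiteness) (hfi i) fun x => ?_
    exact ((ℓ i).le_opENorm _).trans (by gcongr; exact hM x)
  have hm : ∀ i, Measurable (Function.uncurry fun x r =>
      ‖avg ψ (fun y => ℓ i (f y)) x r‖ₑ ^ 2) := fun i =>
    (measurable_uncurry_avg hψ.continuous.measurable
      (hfi i).stronglyMeasurable).measurable.enorm.pow_const 2
  have hsum := HalfCarleson.const_mul (HalfCarleson.sum Finset.univ
    (fun i _ => (hi i).const_mul (hm i) (‖b i‖ₑ ^ 2)) (fun i _ => (hm i).const_mul _))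
    (Finset.measurable_sum _ fun i _ => (hm i).const_mul _) (n : ℝ≥0∞)
  refine hsum.mono (le_of_eq ?_) fun x r _ => ?_
  · rw [hD, mul_assoc, Finset.sum_mul]
    congr 2; ext i; ring
  · have h1 : avg ψ f x r = ∑ i, ℓ i (avg ψ f x r) • b i := (b.sum_repr _).symm
    calc ‖avg ψ f x r‖ₑ ^ 2 ≤ (∑ i, ‖b i‖ₑ * ‖ℓ i (avg ψ f x r)‖ₑ) ^ 2 := by
          gcongr
          conv_lhs => rw [h1]
          refine (enorm_sum_le _ _).trans (Finset.sum_le_sum fun i _ => ?_)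
          rw [enorm_smul, mul_comm]
      _ ≤ n * ∑ i, (‖b i‖ₑ * ‖ℓ i (avg ψ f x r)‖ₑ) ^ 2 := by
          have h2 := ENNReal.inner_le_Lp_mul_Lq Finset.univ (fun _ : Fin n => (1 : ℝ≥0∞))
            (fun i => ‖b i‖ₑ * ‖ℓ i (avg ψ f x r)‖ₑ) (p := 2) (q := 2)
            (by rw [Real.holderConjugate_iff]; norm_num)
          simp only [one_mul, ENNReal.one_rpow, Finset.sum_const, Finset.card_univ,
            Fintype.card_fin, nsmul_eq_mul, mul_one] at h2
          calc _ ≤ ((n : ℝ≥0∞) ^ (1 / 2 : ℝ)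
              * (∑ i, (‖b i‖ₑ * ‖ℓ i (avg ψ f x r)‖ₑ) ^ (2 : ℝ)) ^ (1 / 2 : ℝ)) ^ 2 := by gcongr
            _ = _ := by
              rw [mul_pow, ← ENNReal.rpow_natCast, ← ENNReal.rpow_natCast, ← ENNReal.rpow_mul,
                ← ENNReal.rpow_mul]
              norm_num
      _ = _ := by simp_rw [mul_pow, hcomp]

end SquareFunction

/-! ### Derivatives of averages in position and scale. -/

section Mollifier

open Set Metric Filter Topology
open scoped ContDiff Convolution

variable {E : Type*} [NormedAddCommGroup E] [InnerProductSpace ℝ E] [FiniteDimensional ℝ E]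
  [MeasurableSpace E] [BorelSpace E]
  {V : Type*} [NormedAddCommGroup V] [NormedSpace ℝ V]

/-- A profile: a smooth function supported in the closed unit ball. -/
structure IsProfile (ψ : E → ℝ) : Prop where
  contDiff : ContDiff ℝ ∞ ψ
  eq_zero : ∀ u, 1 < ‖u‖ → ψ u = 0

lemma IsProfile.hasCompactSupport {ψ : E → ℝ} (h : IsProfile ψ) : HasCompactSupport ψ :=
  HasCompactSupport.intro (isCompact_closedBall (0 : E) 1) fun u hu => h.eq_zero u (by simpa using hu)

lemma IsProfile.integrable {ψ : E → ℝ} (h : IsProfile ψ) : Integrable ψ :=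
  h.contDiff.continuous.integrable_of_hasCompactSupport h.hasCompactSupport

lemma IsProfile.fderiv_eq_zero {ψ : E → ℝ} (h : IsProfile ψ) {u : E} (hu : 1 < ‖u‖) :
    fderiv ℝ ψ u = 0 := by
  have h1 : ψ =ᶠ[𝓝 u] fun _ => 0 := by
    filter_upwards [(isOpen_lt continuous_const continuous_norm).mem_nhds hu] with v hv
    exact h.eq_zero v hv
  rw [h1.fderiv_eq]; simp

lemma IsProfile.fderiv_apply {ψ : E → ℝ} (h : IsProfile ψ) (e : E) :
    IsProfile fun u => fderiv ℝ ψ u e where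
  contDiff := (h.contDiff.fderiv_right (m := ∞) (by simp)).clm_apply contDiff_const
  eq_zero u hu := by rw [h.fderiv_eq_zero hu]; simp

/-- With c the dimension, this is the profile produced, up to sign and a factor 1/r, by
differentiating a dilate in the scale. -/
lemma IsProfile.scaling {ψ : E → ℝ} (h : IsProfile ψ) (c : ℝ) :
    IsProfile fun u => c * ψ u + fderiv ℝ ψ u u where
  contDiff := (contDiff_const.mul h.contDiff).add
    ((h.contDiff.fderiv_right (m := ∞) (by simp)).clm_apply contDiff_id)
  eq_zero u hu := by rw [h.fderiv_eq_zero hu, h.eq_zero u hu]; simp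

/-- First moments arise when the scale derivative of F(x - ru) is put on F by the chain rule. -/
lemma IsProfile.inner_mul {ψ : E → ℝ} (h : IsProfile ψ) (e : E) :
    IsProfile fun u => inner ℝ e u * ψ u where
  contDiff := (contDiff_const.inner ℝ contDiff_id).mul h.contDiff
  eq_zero u hu := by rw [h.eq_zero u hu]; simp

lemma IsProfile.integrable_smul {ψ : E → ℝ} (h : IsProfile ψ) [MeasurableSpace V] [BorelSpace V]
    [FiniteDimensional ℝ V]
    {f : E → V} (hf : Measurable f) {M : ℝ} (hM : ∀ x, ‖f x‖ ≤ M) (x : E) (r : ℝ) :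
    Integrable fun u => ψ u • f (x - r • u) := by
  refine Integrable.mono' (g := fun u => ‖ψ u‖ * M) (h.integrable.norm.mul_const _) ?_ ?_
  · exact (h.contDiff.continuous.measurable.smul (hf.comp
      (by fun_prop : Continuous fun u : E => x - r • u).measurable)).aestronglyMeasurable
  · refine .of_forall fun u => ?_
    rw [norm_smul]
    gcongr
    exact hM _

lemma norm_avg_le {ψ : E → ℝ} (h : IsProfile ψ) {f : E → V} {M : ℝ} (hM : ∀ x, ‖f x‖ ≤ M)
    (x : E) (r : ℝ) : ‖avg ψ f x r‖ ≤ (∫ u, ‖ψ u‖) * M := by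
  rw [avg, ← integral_mul_const]
  refine norm_integral_le_of_norm_le (h.integrable.norm.mul_const _) (.of_forall fun u => ?_)
  rw [norm_smul]
  gcongr
  exact hM _

lemma avg_sub_const [MeasurableSpace V] [BorelSpace V] [FiniteDimensional ℝ V]
    {ψ : E → ℝ} (h : IsProfile ψ) {f : E → V} (hf : Measurable f) {M : ℝ}
    (hM : ∀ x, ‖f x‖ ≤ M) (c : V) (x : E) (r : ℝ) :
    avg ψ (fun y => f y - c) x r = avg ψ f x r - (∫ u, ψ u) • c := by
  simp only [avg, smul_sub]
  rw [integral_sub (h.integrable_smul hf hM x r) (h.integrable.smul_const c), integral_smul_const]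

lemma map_avg [MeasurableSpace V] [BorelSpace V] [FiniteDimensional ℝ V]
    {V' : Type*} [NormedAddCommGroup V'] [NormedSpace ℝ V'] [CompleteSpace V']
    {ψ : E → ℝ} (h : IsProfile ψ) {f : E → V} (hf : Measurable f) {M : ℝ}
    (hM : ∀ x, ‖f x‖ ≤ M) (ℓ : V →L[ℝ] V') (x : E) (r : ℝ) :
    ℓ (avg ψ f x r) = avg ψ (fun y => ℓ (f y)) x r := by
  have : CompleteSpace V := FiniteDimensional.complete ℝ V
  rw [avg, ← ContinuousLinearMap.integral_comp_comm _ (h.integrable_smul hf hM x r)]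
  simp [avg]

lemma avg_eq_convolution (ψ : E → ℝ) (f : E → V) (x : E) {r : ℝ} (hr : 0 < r) :
    avg ψ f x r = (f ⋆[(ContinuousLinearMap.lsmul ℝ ℝ).flip, volume] dilate ψ r) x := by
  rw [avg_eq_integral_dilate ψ f x hr, convolution]
  rfl

lemma dilate_contDiffOn {ψ : E → ℝ} (h : ContDiff ℝ ∞ ψ) (R : ℝ) :
    ContDiffOn ℝ 1 (Function.HasUncurry.uncurry (fun (r : ℝ) (u : E) => dilate ψ r u))
      (Ioo 0 R ×ˢ univ) := by
  have hψ : ContDiff ℝ 1 ψ := h.of_le (by exact_mod_cast le_top)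
  have h1 : ContDiffOn ℝ 1 (fun q : ℝ × E => (q.1 ^ Module.finrank ℝ E)⁻¹ * ψ (q.1⁻¹ • q.2))
      (Ioo 0 R ×ˢ univ) := by
    have h2 : ContDiffOn ℝ 1 (fun q : ℝ × E => q.1⁻¹) (Ioo 0 R ×ˢ univ) :=
      contDiff_fst.contDiffOn.inv fun q hq => hq.1.1.ne'
    have h3 : ContDiffOn ℝ 1 (fun q : ℝ × E => (q.1 ^ Module.finrank ℝ E)⁻¹) (Ioo 0 R ×ˢ univ) :=
      (contDiff_fst.pow _).contDiffOn.inv fun q hq => (pow_pos hq.1.1 _).ne'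
    exact h3.mul (hψ.comp_contDiffOn (h2.smul contDiff_snd.contDiffOn))
  exact h1

lemma dilate_eq_zero {ψ : E → ℝ} (h : IsProfile ψ) {R r : ℝ} (hr : r ∈ Ioo 0 R) {u : E}
    (hu : u ∉ closedBall (0 : E) R) : dilate ψ r u = 0 := by
  have h1 : R < ‖u‖ := by simpa using hu
  rw [dilate, h.eq_zero, mul_zero]
  rw [norm_smul, norm_inv, Real.norm_of_nonneg hr.1.le, ← div_eq_inv_mul, one_lt_div hr.1]
  exact hr.2.trans h1

lemma hasFDerivAt_dilate {ψ : E → ℝ} (h : ContDiff ℝ ∞ ψ) {r : ℝ} (hr : 0 < r) (u : E) :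
    ∃ L : ℝ × E →L[ℝ] ℝ, HasFDerivAt (fun q : ℝ × E => dilate ψ q.1 q.2) L (r, u) ∧
      ∀ ς e, L (ς, e) = r⁻¹ * (dilate (fun u => fderiv ℝ ψ u e) r u
        - ς * dilate (fun u => Module.finrank ℝ E * ψ u + fderiv ℝ ψ u u) r u) := by
  set n := Module.finrank ℝ E
  have hi : HasFDerivAt (fun q : ℝ × E => q.1⁻¹) ((-(r ^ 2)⁻¹) • ContinuousLinearMap.fst ℝ ℝ E)
      (r, u) := (hasDerivAt_inv (x := r) hr.ne').comp_hasFDerivAt (r, u) hasFDerivAt_fst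
  have hp : HasDerivAt (fun r : ℝ => (r ^ n)⁻¹) (-(n : ℝ) * r⁻¹ * (r ^ n)⁻¹) r := by
    refine ((hasDerivAt_pow n r).inv (pow_ne_zero _ hr.ne')).congr_deriv ?_
    rcases n with _ | k
    · simp
    · simp only [Nat.add_sub_cancel]; field_simp; ring
  have h3 : HasFDerivAt (fun q : ℝ × E => (q.1 ^ n)⁻¹)
      ((-(n : ℝ) * r⁻¹ * (r ^ n)⁻¹) • ContinuousLinearMap.fst ℝ ℝ E) (r, u) :=
    hp.comp_hasFDerivAt (f := fun q : ℝ × E => q.1) (r, u) hasFDerivAt_fst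
  have h1 := hi.smul (hasFDerivAt_snd (𝕜 := ℝ) (p := (r, u)))
  have hd : HasFDerivAt ψ (fderiv ℝ ψ (r⁻¹ • u)) (r⁻¹ • u) :=
    (h.differentiable (by simp) _).hasFDerivAt
  have h2 := HasFDerivAt.comp (r, u) hd h1
  refine ⟨_, h3.mul h2, fun ς e => ?_⟩
  simp only [dilate, _root_.add_apply, _root_.smul_apply,
    ContinuousLinearMap.comp_apply, ContinuousLinearMap.smulRight_apply,
    ContinuousLinearMap.coe_fst', ContinuousLinearMap.coe_snd', smul_eq_mul, map_add, map_smul]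
  field_simp
  ring

/-- The derivative in `(x, r)` of an average, in terms of averages against mean zero profiles. -/
lemma hasFDerivAt_avg [MeasurableSpace V] [BorelSpace V] [FiniteDimensional ℝ V]
    {ψ : E → ℝ} (h : IsProfile ψ) {f : E → V} (hf : Measurable f) {M : ℝ}
    (hM : ∀ x, ‖f x‖ ≤ M) (x : E) {r : ℝ} (hr : 0 < r) :
    ∃ L : E × ℝ →L[ℝ] V, HasFDerivAt (fun z : E × ℝ => avg ψ f z.1 z.2) L (x, r) ∧
      ∀ e ς, L (e, ς) = r⁻¹ • (avg (fun u => fderiv ℝ ψ u e) f x r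
        - ς • avg (fun u => Module.finrank ℝ E * ψ u + fderiv ℝ ψ u u) f x r) := by
  have hfl : LocallyIntegrable f := by
    refine (locallyIntegrable_const M).mono hf.aestronglyMeasurable (.of_forall fun x => ?_)
    exact (hM x).trans (le_abs_self M)
  -- Any bound larger than r would do: the convolution lemma asks for one compact set supporting all
  -- dilates with parameter near r.
  set R := r + 1
  have hrR : r ∈ Ioo 0 R := ⟨hr, by simp [R]⟩
  have h1 := hasFDerivAt_convolution_right_with_param (L := (ContinuousLinearMap.lsmul ℝ ℝ).flip)
    (μ := volume) (g := fun (r : ℝ) (u : E) => dilate ψ r u) (f := f) isOpen_Ioo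
    (isCompact_closedBall (0 : E) R) (fun p u hp hu => dilate_eq_zero h hp hu) hfl
    (dilate_contDiffOn h.contDiff R) (r, x) hrR
  have h2 := h1.comp (x, r) (f := fun z : E × ℝ => (z.2, z.1)) (hasFDerivAt_snd.prodMk hasFDerivAt_fst)
  refine ⟨_, h2.congr_of_eventuallyEq ?_, fun e ς => ?_⟩
  · filter_upwards [(isOpen_lt continuous_const continuous_snd).mem_nhds hr] with z hz
    exact avg_eq_convolution ψ f z.1 hz
  · simp only [ContinuousLinearMap.comp_apply, ContinuousLinearMap.prod_apply,
      ContinuousLinearMap.coe_fst', ContinuousLinearMap.coe_snd']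
    set G : E → ℝ × E →L[ℝ] ℝ := fun u => fderiv ℝ
      (Function.HasUncurry.uncurry fun (r : ℝ) (u : E) => dilate ψ r u) (r, u) with hG
    have hGa : ∀ u ς e, G u (ς, e) = r⁻¹ * (dilate (fun u => fderiv ℝ ψ u e) r u
        - ς * dilate (fun u => Module.finrank ℝ E * ψ u + fderiv ℝ ψ u u) r u) := fun u => by
      obtain ⟨L, hL, hLa⟩ := hasFDerivAt_dilate h.contDiff hr u
      have : G u = L := hL.fderiv
      rw [this]; exact hLa
    have hGc : Continuous G := by
      have h3 := (dilate_contDiffOn h.contDiff R).continuousOn_fderiv_of_isOpen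
        (isOpen_Ioo.prod isOpen_univ) le_rfl
      exact h3.comp_continuous (by fun_prop) fun u => ⟨hrR, mem_univ _⟩
    have hGs : HasCompactSupport G := by
      refine HasCompactSupport.intro (isCompact_closedBall (0 : E) R) fun u hu => ?_
      refine ContinuousLinearMap.ext fun p => ?_
      obtain ⟨ς, e⟩ := p
      rw [hGa, dilate_eq_zero (h.fderiv_apply e) hrR hu, dilate_eq_zero (h.scaling _) hrR hu]
      simp
    rw [convolution_precompR_apply _ hfl hGs hGc, avg_eq_integral_dilate _ _ _ hr,
      avg_eq_integral_dilate _ _ _ hr]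
    have hi : ∀ {φ : E → ℝ}, IsProfile φ → Integrable fun y => dilate φ r (x - y) • f y := by
      intro φ hφ
      have h4 : HasCompactSupport fun y => dilate φ r (x - y) :=
        (dilate_hasCompactSupport hφ.hasCompactSupport hr).comp_homeomorph (Homeomorph.subLeft x)
      have h5 : Continuous fun y => dilate φ r (x - y) :=
        (dilate_contDiff hφ.contDiff r).continuous.comp (by fun_prop)
      exact hfl.integrable_smul_left_of_hasCompactSupport h5 h4
    have hi' : Integrable fun y =>
        ς • dilate (fun u => Module.finrank ℝ E * ψ u + fderiv ℝ ψ u u) r (x - y) • f y :=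
      (hi (h.scaling _)).smul ς
    rw [convolution, ← integral_smul, ← integral_sub (hi (h.fderiv_apply e)) hi', ← integral_smul]
    refine integral_congr_ae (.of_forall fun y => ?_)
    simp only [ContinuousLinearMap.flip_apply, ContinuousLinearMap.lsmul_apply, hGa]
    rw [← smul_smul, sub_smul, mul_smul]

lemma contDiffOn_avg [MeasurableSpace V] [BorelSpace V] [FiniteDimensional ℝ V]
    {ψ : E → ℝ} (h : IsProfile ψ) {f : E → V} (hf : LocallyIntegrable f) :
    ContDiffOn ℝ 1 (fun z : E × ℝ => avg ψ f z.1 z.2) {z | 0 < z.2} := by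
  intro z hz
  set R := z.2 + 1
  have hrR : z.2 ∈ Ioo 0 R := ⟨hz, by simp [R]⟩
  have h1 := contDiffOn_convolution_right_with_param (L := (ContinuousLinearMap.lsmul ℝ ℝ).flip)
    (μ := volume) (g := fun (r : ℝ) (u : E) => dilate ψ r u) (f := f) (n := 1) isOpen_Ioo
    (isCompact_closedBall (0 : E) R) (fun p u hp hu => dilate_eq_zero h hp hu) hf
    (dilate_contDiffOn h.contDiff R)
  have h2 := (h1.contDiffAt ((isOpen_Ioo.prod isOpen_univ).mem_nhds
    (x := (z.2, z.1)) ⟨hrR, mem_univ _⟩)).comp z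
    (f := fun z : E × ℝ => (z.2, z.1)) (contDiff_snd.prodMk contDiff_fst).contDiffAt
  refine (h2.congr_of_eventuallyEq ?_).contDiffWithinAt
  filter_upwards [(isOpen_lt continuous_const continuous_snd).mem_nhds hz] with z hz
  exact avg_eq_convolution ψ f z.1 hz

/-- Averages of the constant 1 do not depend on (x,r), so the derivative formula applied to f = 1
forces both integrals to vanish, without an integration by parts. -/
lemma integral_fderiv_apply_eq_zero_and {ψ : E → ℝ} (h : IsProfile ψ) :
    (∀ e, ∫ u, fderiv ℝ ψ u e = 0) ∧
      ∫ u, (Module.finrank ℝ E * ψ u + fderiv ℝ ψ u u) = 0 := by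
  obtain ⟨L, hL, hLa⟩ := hasFDerivAt_avg h (f := fun _ : E => (1 : ℝ)) measurable_const
    (M := 1) (by simp) 0 one_pos
  have h0 : L = 0 := by
    refine hL.unique ?_
    simpa [avg] using hasFDerivAt_const (𝕜 := ℝ) (∫ u, ψ u) ((0 : E), (1 : ℝ))
  constructor
  · intro e
    have := hLa e 0
    simpa [h0, avg] using this.symm
  · have := hLa 0 1
    simpa [h0, avg] using this.symm

end Mollifier

/-! ### The oscillation functional and the variation of averages along paths. -/

section Oscillation

open Set Metric Filter Topology
open scoped ContDiff Convolution

variable {E : Type*} [NormedAddCommGroup E] [InnerProductSpace ℝ E] [FiniteDimensional ℝ E]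
  [MeasurableSpace E] [BorelSpace E]
  {V : Type*} [NormedAddCommGroup V] [NormedSpace ℝ V]
  [MeasurableSpace V] [BorelSpace V] [FiniteDimensional ℝ V]

/-- A nonnegative even smooth bump supported in the unit ball, with integral one. -/
def bump : E → ℝ := (⟨1 / 2, 1, by norm_num, by norm_num⟩ : ContDiffBump (0 : E)).normed volume

lemma bump_isProfile : IsProfile (bump : E → ℝ) where
  contDiff := ContDiffBump.contDiff_normed _
  eq_zero u hu := by
    by_contra h
    have : u ∈ Function.support (bump : E → ℝ) := h
    rw [bump, ContDiffBump.support_normed_eq] at this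
    simp at this
    linarith

lemma bump_nonneg (u : E) : 0 ≤ bump u := ContDiffBump.nonneg_normed _ _

lemma bump_neg (u : E) : bump (-u) = bump u := ContDiffBump.normed_neg _ _

lemma integral_bump : ∫ u : E, bump u = 1 := ContDiffBump.integral_normed _

/-- Indices of the mean zero profiles entering `osc`. -/
abbrev ProfileIndex (E : Type*) [NormedAddCommGroup E] [InnerProductSpace ℝ E] : Type :=
  (Fin (Module.finrank ℝ E) ⊕ Fin (Module.finrank ℝ E)) ⊕ Unit

/-- The mean zero profiles controlling the derivatives of averages against `bump`. -/
def prof : ProfileIndex E → E → ℝ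
  | .inl (.inl j) => fun u => fderiv ℝ bump u (stdOrthonormalBasis ℝ E j)
  | .inl (.inr j) => fun u => inner ℝ (stdOrthonormalBasis ℝ E j) u * bump u
  | .inr _ => fun u => Module.finrank ℝ E * bump u + fderiv ℝ bump u u

lemma prof_isProfile (k : ProfileIndex E) : IsProfile (prof k) := by
  rcases k with (j | j) | _
  · exact bump_isProfile.fderiv_apply _
  · exact bump_isProfile.inner_mul _
  · exact bump_isProfile.scaling _

/-- The derivative and scaling profiles come from differentiating averages of a constant; the first
moments vanish because the bump is even. -/
lemma integral_prof (k : ProfileIndex E) : ∫ u, prof k u = 0 := by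
  rcases k with (j | j) | _
  · exact (integral_fderiv_apply_eq_zero_and bump_isProfile).1 _
  · have h := integral_neg_eq_self (prof (.inl (.inr j)) : E → ℝ) volume
    have h2 : ∀ u : E, prof (.inl (.inr j)) (-u) = - prof (.inl (.inr j)) u := fun u => by
      simp [prof, bump_neg]
    simp_rw [h2, integral_neg] at h
    linarith
  · exact (integral_fderiv_apply_eq_zero_and bump_isProfile).2

/-- The oscillation of `f` around `x` at scale `r`: the size of the averages of `f` against the
mean zero profiles. -/
def osc (f : E → V) (x : E) (r : ℝ) : ℝ := ∑ k, ‖avg (prof k) f x r‖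

lemma osc_nonneg (f : E → V) (x : E) (r : ℝ) : 0 ≤ osc f x r :=
  Finset.sum_nonneg fun _ _ => norm_nonneg _

lemma norm_avg_prof_le_osc (f : E → V) (k : ProfileIndex E) (x : E) (r : ℝ) :
    ‖avg (prof k) f x r‖ ≤ osc f x r :=
  Finset.single_le_sum (f := fun k => ‖avg (prof k) f x r‖) (fun _ _ => norm_nonneg _)
    (Finset.mem_univ k)

lemma measurable_osc {f : E → V} (hf : Measurable f) : Measurable (Function.uncurry (osc f)) := by
  change Measurable fun z : E × ℝ => ∑ k, ‖avg (prof k) f z.1 z.2‖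
  refine Finset.measurable_sum _ fun k _ => ?_
  exact ((measurable_uncurry_avg (prof_isProfile k).contDiff.continuous.measurable
    hf.stronglyMeasurable).measurable).norm

variable (E) in
/-- The sum of the `L¹` norms of the mean zero profiles. -/
def profMass : ℝ := ∑ k : ProfileIndex E, ∫ u, ‖prof k u‖

variable (E) in
lemma profMass_nonneg : 0 ≤ profMass E :=
  Finset.sum_nonneg fun _ _ => integral_nonneg fun _ => norm_nonneg _

/-- The profiles have mean zero, so a constant c may be subtracted for free; this makes the
oscillation small for fields close to a constant. -/
lemma osc_le {f : E → V} (hf : Measurable f) {M : ℝ} (hM : ∀ x, ‖f x‖ ≤ M) (c : V) {δ : ℝ}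
    (hδ : ∀ x, ‖f x - c‖ ≤ δ) (x : E) (r : ℝ) : osc f x r ≤ profMass E * δ := by
  rw [osc, profMass, Finset.sum_mul]
  refine Finset.sum_le_sum fun k _ => ?_
  have h1 := avg_sub_const (prof_isProfile k) hf hM c x r
  rw [integral_prof, zero_smul, sub_zero] at h1
  rw [← h1]
  exact norm_avg_le (prof_isProfile k) hδ x r

lemma norm_avg_bump_sub_le {f : E → V} (hf : Measurable f) {M : ℝ} (hM : ∀ x, ‖f x‖ ≤ M) (c : V)
    {δ : ℝ} (hδ : ∀ x, ‖f x - c‖ ≤ δ) (x : E) (r : ℝ) : ‖avg bump f x r - c‖ ≤ δ := by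
  have h1 := avg_sub_const bump_isProfile hf hM c x r
  rw [integral_bump, one_smul] at h1
  rw [← h1]
  refine (norm_avg_le bump_isProfile hδ x r).trans (le_of_eq ?_)
  simp_rw [Real.norm_of_nonneg (bump_nonneg _), integral_bump, one_mul]

lemma sum_sq_le_card {ι : Type*} (s : Finset ι) (a : ι → ℝ≥0∞) :
    (∑ i ∈ s, a i) ^ 2 ≤ s.card * ∑ i ∈ s, a i ^ 2 := by
  have h2 := ENNReal.inner_le_Lp_mul_Lq s (fun _ => (1 : ℝ≥0∞)) a (p := 2) (q := 2)
    (by rw [Real.holderConjugate_iff]; norm_num)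
  simp only [one_mul, ENNReal.one_rpow, Finset.sum_const, nsmul_eq_mul, mul_one] at h2
  calc _ ≤ ((s.card : ℝ≥0∞) ^ (1 / 2 : ℝ) * (∑ i ∈ s, a i ^ (2 : ℝ)) ^ (1 / 2 : ℝ)) ^ 2 := by
        gcongr
    _ = _ := by
        rw [mul_pow, ← ENNReal.rpow_natCast, ← ENNReal.rpow_natCast, ← ENNReal.rpow_mul,
          ← ENNReal.rpow_mul]
        norm_num

/-- The squared oscillation of a bounded function is a Carleson density. -/
lemma halfCarleson_osc :
    ∃ C : ℝ≥0∞, C ≠ ⊤ ∧ ∀ (f : E → V) (M : ℝ≥0∞), M ≠ ⊤ → Measurable f → (∀ x, ‖f x‖ₑ ≤ M) →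
      HalfCarleson (C * M ^ 2) fun x r => ENNReal.ofReal (osc f x r) ^ 2 := by
  choose C hC h using fun k : ProfileIndex E => halfCarleson_avg (V := V)
    (prof_isProfile k).contDiff (prof_isProfile k).eq_zero (integral_prof k)
  refine ⟨Finset.univ.card (α := ProfileIndex E) * ∑ k, C k,
    ENNReal.mul_ne_top (ENNReal.natCast_ne_top _) (ENNReal.sum_ne_top.2 fun k _ => hC k),
    fun f M hM hf hfM => ?_⟩
  have hm : ∀ k : ProfileIndex E,
      Measurable (Function.uncurry fun x r => ‖avg (prof k) f x r‖ₑ ^ 2) := fun k =>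
    (measurable_uncurry_avg (prof_isProfile k).contDiff.continuous.measurable
      hf.stronglyMeasurable).measurable.enorm.pow_const 2
  refine ((HalfCarleson.sum Finset.univ (fun k _ => h k f M hM hf hfM)
    (fun k _ => hm k)).const_mul (Finset.measurable_sum _ fun k _ => hm k)
    (Finset.univ.card (α := ProfileIndex E) : ℝ≥0∞)).mono (le_of_eq ?_) fun x r _ => ?_
  · rw [← Finset.sum_mul, mul_assoc]
  · refine le_trans (le_of_eq ?_) (sum_sq_le_card _ _)
    rw [osc, ENNReal.ofReal_sum_of_nonneg fun _ _ => norm_nonneg _]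
    simp_rw [ofReal_norm]

/-- Linear dependence of the profile on a direction reduces all directions to an orthonormal basis,
so that finitely many profiles suffice in `osc`. -/
lemma sum_inner_smul_avg (ψ : E → E → ℝ) (h : ∀ e, IsProfile (ψ e)) {f : E → V}
    (hf : Measurable f) {M : ℝ} (hM : ∀ x, ‖f x‖ ≤ M)
    (hψ : ∀ e u, ψ e u = ∑ j, inner ℝ (stdOrthonormalBasis ℝ E j) e * ψ (stdOrthonormalBasis ℝ E j) u)
    (e x : E) (r : ℝ) :
    avg (ψ e) f x r = ∑ j, inner ℝ (stdOrthonormalBasis ℝ E j) e •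
      avg (ψ (stdOrthonormalBasis ℝ E j)) f x r := by
  simp only [avg]
  simp_rw [← integral_smul]
  have hi : ∀ j, Integrable fun u => inner ℝ (stdOrthonormalBasis ℝ E j) e •
      ψ (stdOrthonormalBasis ℝ E j) u • f (x - r • u) := fun j =>
    ((h _).integrable_smul hf hM x r).smul _
  rw [← integral_finsetSum _ fun j _ => hi j]
  refine integral_congr_ae (.of_forall fun u => ?_)
  simp only [hψ e u, Finset.sum_smul, smul_smul]

/-- Averages against `bump` are differentiable, with derivative controlled by `osc`. -/
lemma hasFDerivAt_avg_bump {f : E → V} (hf : Measurable f) {M : ℝ} (hM : ∀ x, ‖f x‖ ≤ M) (x : E)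
    {r : ℝ} (hr : 0 < r) :
    ∃ L : E × ℝ →L[ℝ] V, HasFDerivAt (fun z : E × ℝ => avg bump f z.1 z.2) L (x, r) ∧
      ‖L‖ ≤ (Module.finrank ℝ E + 1) * (r⁻¹ * osc f x r) := by
  obtain ⟨L, hL, hLa⟩ := hasFDerivAt_avg bump_isProfile hf hM x hr
  refine ⟨L, hL, L.opNorm_le_bound ?_ fun z => ?_⟩
  · have := osc_nonneg f x r
    positivity
  · obtain ⟨e, ς⟩ := z
    rw [hLa]
    have hb : ∀ e u : E, fderiv ℝ bump u e = ∑ j, inner ℝ (stdOrthonormalBasis ℝ E j) e *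
        fderiv ℝ bump u (stdOrthonormalBasis ℝ E j) := fun e u => by
      conv_lhs => rw [← (stdOrthonormalBasis ℝ E).sum_repr' e]
      simp
    rw [sum_inner_smul_avg (fun e u => fderiv ℝ bump u e) (fun e => bump_isProfile.fderiv_apply e)
      hf hM hb e x r]
    have h1 : ‖∑ j, inner ℝ (stdOrthonormalBasis ℝ E j) e •
        avg (fun u => fderiv ℝ bump u (stdOrthonormalBasis ℝ E j)) f x r‖
        ≤ Module.finrank ℝ E * (‖e‖ * osc f x r) := by
      refine (norm_sum_le _ _).trans ?_
      refine (Finset.sum_le_card_nsmul _ _ (‖e‖ * osc f x r) fun j _ => ?_).trans (by simp)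
      rw [norm_smul]
      gcongr
      · exact (norm_inner_le_norm _ _).trans (by simp)
      · exact norm_avg_prof_le_osc f (.inl (.inl j)) x r
    have h2 : ‖avg (fun u => Module.finrank ℝ E * bump u + fderiv ℝ bump u u) f x r‖ ≤ osc f x r :=
      norm_avg_prof_le_osc f (.inr ()) x r
    rw [norm_smul, norm_inv, Real.norm_of_nonneg hr.le]
    have he : ‖e‖ ≤ ‖(e, ς)‖ := norm_fst_le (e, ς)
    have hς : ‖ς‖ ≤ ‖(e, ς)‖ := norm_snd_le (e, ς)
    have h0 := osc_nonneg f x r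
    calc r⁻¹ * _ ≤ r⁻¹ * (Module.finrank ℝ E * (‖(e, ς)‖ * osc f x r) + ‖(e, ς)‖ * osc f x r) := by
          gcongr
          refine (norm_sub_le _ _).trans (add_le_add (h1.trans (by gcongr)) ?_)
          rw [norm_smul]
          gcongr
      _ = _ := by ring

/-- The variation of an average along a curve in the half space, in terms of `osc`. -/
lemma enorm_avg_bump_sub_le {f : E → V} (hf : Measurable f) {M : ℝ} (hM : ∀ x, ‖f x‖ ≤ M)
    {γ : ℝ → E × ℝ} {γ' : ℝ → E × ℝ} (hγ : ∀ θ, HasDerivAt γ (γ' θ) θ) (hc : Continuous γ')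
    (hpos : ∀ θ, 0 < (γ θ).2) {B : ℝ} (hB : ∀ θ, ‖γ' θ‖ ≤ B * (γ θ).2) :
    ‖avg bump f (γ 1).1 (γ 1).2 - avg bump f (γ 0).1 (γ 0).2‖ₑ
      ≤ ENNReal.ofReal ((Module.finrank ℝ E + 1) * B)
        * ∫⁻ θ in Icc (0 : ℝ) 1, ENNReal.ofReal (osc f (γ θ).1 (γ θ).2) := by
  choose L hL hLn using fun z : {z : E × ℝ // 0 < z.2} => hasFDerivAt_avg_bump hf hM z.1.1 z.2
  set p : E × ℝ → V := fun z => avg bump f z.1 z.2 with hp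
  have hfl : LocallyIntegrable f := by
    refine (locallyIntegrable_const M).mono hf.aestronglyMeasurable (.of_forall fun x => ?_)
    exact (hM x).trans (le_abs_self M)
  have hB0 : 0 ≤ B := by
    have := (norm_nonneg _).trans (hB 0)
    exact nonneg_of_mul_nonneg_left this (hpos 0)
  have hd : ∀ θ, HasDerivAt (p ∘ γ) (L ⟨γ θ, hpos θ⟩ (γ' θ)) θ := fun θ =>
    (hL ⟨γ θ, hpos θ⟩).comp_hasDerivAt θ (hγ θ)
  have hcont : Continuous fun θ => L ⟨γ θ, hpos θ⟩ (γ' θ) := by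
    have h1 : ∀ θ, L ⟨γ θ, hpos θ⟩ = fderiv ℝ p (γ θ) := fun θ => (hL ⟨γ θ, hpos θ⟩).fderiv.symm
    simp_rw [h1]
    have h2 : ContinuousOn (fderiv ℝ p) {z | 0 < z.2} :=
      (contDiffOn_avg bump_isProfile hfl).continuousOn_fderiv_of_isOpen
        (isOpen_lt continuous_const continuous_snd) le_rfl
    have hγc : Continuous γ := continuous_iff_continuousAt.2 fun θ => (hγ θ).continuousAt
    exact (h2.comp_continuous hγc hpos).clm_apply hc
  have : CompleteSpace V := FiniteDimensional.complete ℝ V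
  have hint := intervalIntegral.integral_eq_sub_of_hasDerivAt (a := 0) (b := 1)
    (fun θ _ => hd θ) (hcont.intervalIntegrable _ _)
  have h3 : p (γ 1) - p (γ 0) = ∫ θ in Icc (0 : ℝ) 1, L ⟨γ θ, hpos θ⟩ (γ' θ) := by
    rw [integral_Icc_eq_integral_Ioc, ← intervalIntegral.integral_of_le zero_le_one, hint]
    rfl
  change ‖p (γ 1) - p (γ 0)‖ₑ ≤ _
  rw [h3, ← lintegral_const_mul' _ _ (by finiteness)]
  refine (enorm_integral_le_lintegral_enorm _).trans (lintegral_mono fun θ => ?_)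
  rw [← ofReal_norm, ← ENNReal.ofReal_mul (by positivity)]
  refine ENNReal.ofReal_le_ofReal ?_
  have h5 := osc_nonneg f (γ θ).1 (γ θ).2
  have h6 := hpos θ
  -- The factor 1/r of the derivative bound cancels against the height in `hB`: only the hyperbolic
  -- speed of the curve matters.
  calc _ ≤ ‖L ⟨γ θ, hpos θ⟩‖ * ‖γ' θ‖ := ContinuousLinearMap.le_opNorm _ _
    _ ≤ ((Module.finrank ℝ E + 1) * ((γ θ).2⁻¹ * osc f (γ θ).1 (γ θ).2)) * (B * (γ θ).2) := by
        gcongr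
        · exact hLn ⟨γ θ, hpos θ⟩
        · exact hB θ
    _ = _ := by field_simp

/-- Comparison of averages at two points at the same height, with logarithmic loss. -/
lemma enorm_avg_bump_sub_shift_le {f : E → V} (hf : Measurable f) {M : ℝ} (hM : ∀ x, ‖f x‖ ≤ M)
    (x : E) {r : ℝ} (hr : 0 < r) {v : E} {A : ℝ} (hv : ‖v‖ ≤ A) :
    ‖avg bump f (x + r • v) r - avg bump f x r‖ₑ
      ≤ ENNReal.ofReal ((Module.finrank ℝ E + 1) * (1 + Real.log (1 + A)))
        * ((∫⁻ θ in Icc (0 : ℝ) 1, ENNReal.ofReal (osc f (x + r • v) ((1 + A) ^ θ * r)))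
          + (∫⁻ θ in Icc (0 : ℝ) 1, ENNReal.ofReal (osc f (x + r • θ • v) ((1 + A) * r)))
          + ∫⁻ θ in Icc (0 : ℝ) 1, ENNReal.ofReal (osc f x ((1 + A) ^ θ * r))) := by
  have hA : 0 ≤ A := (norm_nonneg v).trans hv
  have hA1 : (0 : ℝ) < 1 + A := by positivity
  have hl : 0 ≤ Real.log (1 + A) := Real.log_nonneg (by linarith)
  -- The path goes up to height (1+A)r, across, and down again. The vertical legs are parametrised
  -- geometrically, so their hyperbolic speed is the constant log(1+A).
  have vert : ∀ y : E, ‖avg bump f y ((1 + A) * r) - avg bump f y r‖ₑ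
      ≤ ENNReal.ofReal ((Module.finrank ℝ E + 1) * (1 + Real.log (1 + A)))
        * ∫⁻ θ in Icc (0 : ℝ) 1, ENNReal.ofReal (osc f y ((1 + A) ^ θ * r)) := fun y => by
    have hd : ∀ θ : ℝ, HasDerivAt (fun θ : ℝ => (y, (1 + A) ^ θ * r))
        ((0 : E), (1 + A) ^ θ * Real.log (1 + A) * r) θ := fun θ => by
      refine (hasDerivAt_const θ y).prodMk ?_
      exact ((Real.hasStrictDerivAt_const_rpow hA1 θ).hasDerivAt).mul_const r
    have h := enorm_avg_bump_sub_le hf hM hd (B := Real.log (1 + A)) ?_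
      (fun θ => by positivity) ?_
    · simp only [Real.rpow_one, Real.rpow_zero, one_mul] at h
      refine h.trans ?_
      gcongr
      linarith
    · have : Continuous fun θ : ℝ => (1 + A) ^ θ := Real.continuous_const_rpow hA1.ne'
      fun_prop
    · intro θ
      have : 0 ≤ (1 + A) ^ θ * Real.log (1 + A) * r := by positivity
      rw [Prod.norm_mk, norm_zero, Real.norm_of_nonneg this, max_eq_right this]
      exact le_of_eq (by ring)
  -- At height (1+A)r a displacement of length at most Ar has hyperbolic length at most 1.
  have hor : ‖avg bump f (x + r • v) ((1 + A) * r) - avg bump f x ((1 + A) * r)‖ₑ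
      ≤ ENNReal.ofReal ((Module.finrank ℝ E + 1) * (1 + Real.log (1 + A)))
        * ∫⁻ θ in Icc (0 : ℝ) 1, ENNReal.ofReal (osc f (x + r • θ • v) ((1 + A) * r)) := by
    have hd : ∀ θ : ℝ, HasDerivAt (fun θ : ℝ => (x + r • θ • v, (1 + A) * r))
        (r • v, (0 : ℝ)) θ := fun θ => by
      refine HasDerivAt.prodMk ?_ (hasDerivAt_const θ _)
      have := (((hasDerivAt_id θ).smul_const v).const_smul r).const_add x
      simpa using this
    have h := enorm_avg_bump_sub_le hf hM hd (B := 1) continuous_const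
      (fun θ => by positivity) ?_
    · simp only [one_smul, zero_smul, smul_zero, add_zero] at h
      refine h.trans ?_
      gcongr
      linarith
    · intro θ
      rw [Prod.norm_mk, norm_zero, max_eq_left (norm_nonneg _), norm_smul,
        Real.norm_of_nonneg hr.le]
      nlinarith
  have htri : avg bump f (x + r • v) r - avg bump f x r
      = -(avg bump f (x + r • v) ((1 + A) * r) - avg bump f (x + r • v) r)
        + (avg bump f (x + r • v) ((1 + A) * r) - avg bump f x ((1 + A) * r))
        + (avg bump f x ((1 + A) * r) - avg bump f x r) := by abel
  rw [htri, mul_add, mul_add]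
  refine (enorm_add_le _ _).trans (add_le_add ((enorm_add_le _ _).trans (add_le_add ?_ hor)) (vert x))
  rw [enorm_neg]
  exact vert _

end Oscillation

/-! ### Mollification error of a merely bounded function, tested against a smooth kernel. -/

section Duality

open Set Metric Filter Topology
open scoped ContDiff Convolution

variable {E : Type*} [NormedAddCommGroup E] [InnerProductSpace ℝ E] [FiniteDimensional ℝ E]
  [MeasurableSpace E] [BorelSpace E]

lemma avg_comp_affine {V : Type*} [NormedAddCommGroup V] [NormedSpace ℝ V] (ψ : E → ℝ) (f : E → V)
    (x u : E) (r σ : ℝ) :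
    avg ψ (fun y => f (x + r • y)) u σ = avg ψ f (x + r • u) (σ * r) := by
  simp only [avg]
  congr 1; ext w
  congr 2
  rw [smul_sub, smul_smul, mul_comm σ r]
  abel

lemma osc_comp_affine {V : Type*} [NormedAddCommGroup V] [NormedSpace ℝ V] (f : E → V)
    (x u : E) (r σ : ℝ) :
    osc (fun y => f (x + r • y)) u σ = osc f (x + r • u) (σ * r) := by
  simp only [osc, avg_comp_affine]

/-- The product of the bump with a linear form is a combination of the first moment profiles. -/
lemma abs_integral_bump_mul_le {f : E → ℝ} (hf : Measurable f) {M : ℝ} (hM : ∀ x, ‖f x‖ ≤ M)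
    (ℓ : E →L[ℝ] ℝ) (u : E) (σ : ℝ) :
    ‖∫ w, bump w * (ℓ w * f (u - σ • w))‖ ≤ ‖ℓ‖ * osc f u σ := by
  have h1 : ∫ w, bump w * (ℓ w * f (u - σ • w))
      = ∑ j, ℓ (stdOrthonormalBasis ℝ E j) * avg (prof (.inl (.inr j))) f u σ := by
    have hi : ∀ j : Fin (Module.finrank ℝ E), Integrable fun w =>
        ℓ (stdOrthonormalBasis ℝ E j) * (prof (.inl (.inr j)) w • f (u - σ • w)) := fun j =>
      ((prof_isProfile (.inl (.inr j))).integrable_smul hf hM u σ).const_mul _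
    simp only [avg]
    simp_rw [← integral_const_mul]
    rw [← integral_finsetSum _ fun j _ => hi j]
    refine integral_congr_ae (.of_forall fun w => ?_)
    simp only
    conv_lhs => rw [← (stdOrthonormalBasis ℝ E).sum_repr' w]
    rw [(stdOrthonormalBasis ℝ E).sum_repr' w, ← (stdOrthonormalBasis ℝ E).sum_repr' w, map_sum,
      (stdOrthonormalBasis ℝ E).sum_repr' w, Finset.sum_mul, Finset.mul_sum]
    refine Finset.sum_congr rfl fun j _ => ?_
    simp only [prof, map_smul, smul_eq_mul]
    ring
  rw [h1, osc, Finset.mul_sum]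
  refine (norm_sum_le _ _).trans ?_
  calc ∑ j, ‖ℓ (stdOrthonormalBasis ℝ E j) * avg (prof (.inl (.inr j))) f u σ‖
      ≤ ∑ j : Fin (Module.finrank ℝ E), ‖ℓ‖ * ‖avg (prof (.inl (.inr j))) f u σ‖ := by
        refine Finset.sum_le_sum fun j _ => ?_
        rw [norm_mul]
        gcongr
        exact (ℓ.le_opNorm _).trans (by simp)
    _ ≤ ∑ k : ProfileIndex E, ‖ℓ‖ * ‖avg (prof k) f u σ‖ := by
        rw [Fintype.sum_sum_type, Fintype.sum_sum_type, add_assoc, add_comm, add_assoc]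
        refine le_add_of_nonneg_right (add_nonneg ?_ ?_) <;>
        exact Finset.sum_nonneg fun _ _ => by positivity

/-- The difference between a function and its mollification, paired with a smooth kernel. -/
lemma enorm_integral_mul_sub_avg_le {f : E → ℝ} (hf : Measurable f) {M : ℝ} (hM : ∀ x, ‖f x‖ ≤ M)
    {k : E → ℝ} (hk : ContDiff ℝ 1 k) (hki : Integrable k) (hdk : Integrable (fderiv ℝ k)) :
    ‖∫ u, k u * (f u - avg bump f u 1)‖ₑ
      ≤ ∫⁻ σ in Icc (0 : ℝ) 1, ∫⁻ u, ‖fderiv ℝ k u‖ₑ * ENNReal.ofReal (osc f u σ) := by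
  have hM0 : 0 ≤ M := (norm_nonneg _).trans (hM 0)
  have hkc := hk.continuous
  have hdc : Continuous (fderiv ℝ k) := hk.continuous_fderiv (by simp)
  have hbc : Continuous (bump : E → ℝ) := bump_isProfile.contDiff.continuous
  set ν : Measure ℝ := volume.restrict (Icc (0 : ℝ) 1) with hν
  -- the contribution of a fixed translation
  have hw : ∀ w : E, ∫ u, k u * (f u - f (u - w))
      = -∫ p : ℝ × E, fderiv ℝ k p.2 w * f (p.2 - p.1 • w) ∂(ν.prod volume) := by
    intro w
    have i1 : Integrable fun u => k u * f u :=
      hki.mul_bdd (c := M) hf.aestronglyMeasurable (.of_forall hM)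
    have i2 : Integrable fun u => k u * f (u - w) :=
      hki.mul_bdd (c := M) (hf.comp (by fun_prop : Measurable fun u : E => u - w)).aestronglyMeasurable
        (.of_forall fun u => hM _)
    have i3 : Integrable fun u => k (u + w) * f u :=
      (hki.comp_add_right w).mul_bdd (c := M) hf.aestronglyMeasurable (.of_forall hM)
    have e1 : ∫ u, k u * f (u - w) = ∫ u, k (u + w) * f u := by
      rw [← integral_add_right_eq_self _ w]
      simp
    have i4 : Integrable (fun p : ℝ × E => fderiv ℝ k (p.2 + p.1 • w) w * f p.2)
        (ν.prod volume) := by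
      have hm : AEStronglyMeasurable (fun p : ℝ × E => fderiv ℝ k (p.2 + p.1 • w) w * f p.2)
          (ν.prod volume) :=
        ((by fun_prop : Continuous fun p : ℝ × E => fderiv ℝ k (p.2 + p.1 • w) w).measurable.mul
          (hf.comp measurable_snd)).aestronglyMeasurable
      have hs : ∀ σ : ℝ, Integrable fun u => fderiv ℝ k (u + σ • w) w * f u := fun σ => by
        have := (hdk.comp_add_right (σ • w)).apply_continuousLinearMap w
        exact this.mul_bdd (c := M) hf.aestronglyMeasurable (.of_forall hM)
      rw [integrable_prod_iff hm]
      refine ⟨.of_forall hs, ?_⟩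
      refine Integrable.mono' (g := fun _ => (∫ u, ‖fderiv ℝ k u‖) * ‖w‖ * M) (integrable_const _)
        hm.norm.integral_prod_right' (.of_forall fun σ => ?_)
      rw [Real.norm_of_nonneg (integral_nonneg fun _ => norm_nonneg _)]
      rw [← integral_add_right_eq_self (fun u => ‖fderiv ℝ k u‖) (σ • w), ← integral_mul_const,
        ← integral_mul_const]
      refine integral_mono (hs σ).norm
        (((hdk.comp_add_right (σ • w)).norm.mul_const _).mul_const _) fun u => ?_
      simp only [norm_mul]
      gcongr
      · exact ContinuousLinearMap.le_opNorm _ _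
      · exact hM u
    have e2 : ∀ u, k u - k (u + w) = -∫ σ, fderiv ℝ k (u + σ • w) w ∂ν := fun u => by
      have hd : ∀ σ : ℝ, HasDerivAt (fun σ : ℝ => k (u + σ • w)) (fderiv ℝ k (u + σ • w) w) σ :=
        fun σ => by
          have h1 : HasDerivAt (fun σ : ℝ => u + σ • w) w σ := by
            simpa using ((hasDerivAt_id σ).smul_const w).const_add u
          exact ((hk.differentiable (by simp) _).hasFDerivAt).comp_hasDerivAt σ h1
      have h2 := intervalIntegral.integral_eq_sub_of_hasDerivAt (a := 0) (b := 1)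
        (fun σ _ => hd σ) ((by fun_prop : Continuous fun σ : ℝ =>
          fderiv ℝ k (u + σ • w) w).intervalIntegrable _ _)
      rw [intervalIntegral.integral_of_le zero_le_one, ← integral_Icc_eq_integral_Ioc] at h2
      rw [hν, h2]
      simp
    -- The translation is moved from f to the kernel, whose increment is the integral of its
    -- derivative along the segment; no regularity of f enters.
    calc ∫ u, k u * (f u - f (u - w)) = ∫ u, (k u - k (u + w)) * f u := by
          simp_rw [mul_sub, sub_mul]
          rw [integral_sub i1 i2, integral_sub i1 i3, e1]
      _ = -∫ u, ∫ σ, fderiv ℝ k (u + σ • w) w * f u ∂ν := by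
          rw [← integral_neg]
          refine integral_congr_ae (.of_forall fun u => ?_)
          simp only
          rw [e2, integral_mul_const, neg_mul]
      _ = -∫ σ, (∫ u, fderiv ℝ k (u + σ • w) w * f u) ∂ν := by
          rw [integral_integral_swap (f := fun u σ => fderiv ℝ k (u + σ • w) w * f u)]
          exact i4.swap
      _ = -∫ σ, (∫ u, fderiv ℝ k u w * f (u - σ • w)) ∂ν := by
          congr 2; ext σ
          rw [← integral_add_right_eq_self (fun u => fderiv ℝ k u w * f (u - σ • w)) (σ • w)]
          simp
      _ = _ := by
          rw [integral_prod]
          have h6 : MeasurePreserving (fun p : ℝ × E => (p.1, p.2 - p.1 • w))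
              (ν.prod volume) (ν.prod volume) := by
            refine (MeasurePreserving.id ν).skew_product (g := fun σ u => u - σ • w)
              (by fun_prop) (.of_forall fun σ => ?_)
            exact (measurePreserving_sub_right volume (σ • w)).map_eq
          have := h6.integrable_comp_of_integrable i4
          simpa [Function.comp_def] using this
  have i5 : Integrable (fun p : E × E => bump p.2 * (k p.1 * (f p.1 - f (p.1 - p.2))))
      (volume.prod volume) := by
    have := (hki.norm.mul_prod (bump_isProfile (E := E)).integrable.norm).mul_const (2 * M)
    refine this.mono' ?_ (.of_forall fun p => ?_)
    · exact ((hbc.measurable.comp measurable_snd).mul ((hkc.measurable.comp measurable_fst).mul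
        ((hf.comp measurable_fst).sub (hf.comp (measurable_fst.sub measurable_snd))))).aestronglyMeasurable
    · simp only [norm_mul]
      have : ‖f p.1 - f (p.1 - p.2)‖ ≤ 2 * M := by
        refine (norm_sub_le _ _).trans ?_
        linarith [hM p.1, hM (p.1 - p.2)]
      calc _ ≤ ‖bump p.2‖ * (‖k p.1‖ * (2 * M)) := by gcongr
        _ = _ := by ring
  have e3 : ∫ u, k u * (f u - avg bump f u 1)
      = ∫ u, ∫ w, bump w * (k u * (f u - f (u - w))) := by
    refine integral_congr_ae (.of_forall fun u => ?_)
    simp only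
    have j1 : Integrable fun w => bump w * f (u - w) := by
      simpa using bump_isProfile.integrable_smul hf hM u 1
    have j2 : Integrable fun w : E => bump w * f u := bump_isProfile.integrable.mul_const _
    have : avg bump f u 1 = ∫ w, bump w * f (u - w) := by simp [avg]
    rw [this]
    have j3 : f u = ∫ w : E, bump w * f u := by
      rw [integral_mul_const, integral_bump, one_mul]
    conv_lhs => rw [j3]
    rw [← integral_sub j2 j1, ← integral_const_mul]
    congr 1; ext w; ring
  have i6 : Integrable (fun p : E × ℝ × E => bump p.1 *
      (fderiv ℝ k p.2.2 p.1 * f (p.2.2 - p.2.1 • p.1))) (volume.prod (ν.prod volume)) := by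
    have hb1 : Integrable fun w : E => ‖w‖ * ‖bump w‖ :=
      (by fun_prop : Continuous fun w : E => ‖w‖ * ‖bump w‖).integrable_of_hasCompactSupport
        (bump_isProfile.hasCompactSupport.norm.mul_left)
    have := (hb1.mul_prod ((integrable_const (1 : ℝ) (μ := ν)).mul_prod hdk.norm)).mul_const M
    refine this.mono' ?_ (.of_forall fun p => ?_)
    · refine Measurable.aestronglyMeasurable ?_
      refine Measurable.mul (hbc.measurable.comp measurable_fst) (Measurable.mul ?_ (hf.comp
        (by fun_prop : Measurable fun p : E × ℝ × E => p.2.2 - p.2.1 • p.1)))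
      exact (by fun_prop : Continuous fun p : E × ℝ × E => fderiv ℝ k p.2.2 p.1).measurable
    · simp only [norm_mul]
      calc _ ≤ ‖bump p.1‖ * ((‖fderiv ℝ k p.2.2‖ * ‖p.1‖) * M) := by
            gcongr
            · exact ContinuousLinearMap.le_opNorm _ _
            · exact hM _
        _ = _ := by ring
  -- Integrating in w first collects the bump and the linear form Dk(u) into a mean zero first
  -- moment profile, acting on f at scale σ.
  have e4 : ∫ u, k u * (f u - avg bump f u 1)
      = -∫ p : ℝ × E, (∫ w, bump w * (fderiv ℝ k p.2 w * f (p.2 - p.1 • w)))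
        ∂(ν.prod volume) := by
    rw [e3, integral_integral_swap i5]
    simp_rw [integral_const_mul, hw, mul_neg, integral_neg, ← integral_const_mul]
    rw [integral_integral_swap (f := fun (w : E) (p : ℝ × E) =>
      bump w * (fderiv ℝ k p.2 w * f (p.2 - p.1 • w))) i6]
  rw [e4, enorm_neg]
  refine (enorm_integral_le_lintegral_enorm _).trans ?_
  have hmeas : Measurable fun p : ℝ × E => ‖fderiv ℝ k p.2‖ₑ * ENNReal.ofReal (osc f p.2 p.1) := by
    refine Measurable.mul (hdc.comp continuous_snd).enorm.measurable ?_
    exact ((measurable_osc hf).comp measurable_swap).ennreal_ofReal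
  rw [← lintegral_prod _ hmeas.aemeasurable]
  refine lintegral_mono fun p => ?_
  rw [← ofReal_norm, ← ofReal_norm, ← ENNReal.ofReal_mul (norm_nonneg _)]
  exact ENNReal.ofReal_le_ofReal (abs_integral_bump_mul_le hf hM _ _ _)

end Duality

/-! ### Averages of Lipschitz functions: derivatives and Taylor remainders. -/

section LipschitzAverage

open Set Metric Filter Topology
open scoped ContDiff

variable {E : Type*} [NormedAddCommGroup E] [InnerProductSpace ℝ E] [FiniteDimensional ℝ E]
  [MeasurableSpace E] [BorelSpace E]
  {V : Type*} [NormedAddCommGroup V] [NormedSpace ℝ V] [FiniteDimensional ℝ V]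
  [MeasurableSpace V] [BorelSpace V]

lemma avg_bump_zero [CompleteSpace V] (f : E → V) (x : E) : avg bump f x 0 = f x := by
  simp only [avg, zero_smul, sub_zero]
  rw [integral_smul_const, integral_bump, one_smul]

/-- Transports Rademacher's theorem: for fixed x and r ≠ 0, F is differentiable at x - ru for almost
every u. -/
lemma quasiMeasurePreserving_sub_smul (x : E) {r : ℝ} (hr : r ≠ 0) :
    Measure.QuasiMeasurePreserving (fun u : E => x - r • u) volume volume := by
  refine ⟨by fun_prop, ?_⟩
  refine Measure.AbsolutelyContinuous.mk fun s hs h0 => ?_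
  rw [Measure.map_apply (by fun_prop) hs]
  have h1 : (fun u : E => x - r • u) ⁻¹' s = (r • ·) ⁻¹' ((x - ·) ⁻¹' s) := rfl
  rw [h1, Measure.addHaar_preimage_smul _ hr,
    (Measure.measurePreserving_sub_left volume x).measure_preimage hs.nullMeasurableSet, h0, mul_zero]

lemma integrable_bump_smul_continuous {f : E → V} (hf : Continuous f) :
    Integrable fun u => bump u • f u :=
  (bump_isProfile.contDiff.continuous.smul hf).integrable_of_hasCompactSupport
    bump_isProfile.hasCompactSupport.smul_right

/-- The derivative of the averages of a Lipschitz function. -/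
lemma hasFDerivAt_avg_lipschitz {F : E → V} {K : ℝ≥0} (hF : LipschitzWith K F) (x : E) {r : ℝ}
    (hr : r ≠ 0) :
    ∃ L : E × ℝ →L[ℝ] V, HasFDerivAt (fun z : E × ℝ => avg bump F z.1 z.2) L (x, r) ∧
      ∀ e ς, L (e, ς) = avg bump (fderiv ℝ F) x r e
        - ς • ∑ j, avg (prof (.inl (.inr j))) (fderiv ℝ F) x r (stdOrthonormalBasis ℝ E j) := by
  have : CompleteSpace V := FiniteDimensional.complete ℝ V
  have hDm : Measurable (fderiv ℝ F) := measurable_fderiv ℝ F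
  have hDb : ∀ y, ‖fderiv ℝ F y‖ ≤ K := fun y => norm_fderiv_le_of_lipschitz ℝ hF
  set T : E → E × ℝ →L[ℝ] E := fun u =>
    ContinuousLinearMap.fst ℝ E ℝ - (ContinuousLinearMap.snd ℝ E ℝ).smulRight u with hT
  set F' : E → E × ℝ →L[ℝ] V := fun u => bump u • (fderiv ℝ F (x - r • u)).comp (T u) with hF'
  have hTc : Continuous T := by
    refine continuous_const.sub ?_
    exact (ContinuousLinearMap.smulRightL ℝ (E × ℝ) E (ContinuousLinearMap.snd ℝ E ℝ)).continuous
  have hF'm : AEStronglyMeasurable F' volume := by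
    refine Measurable.aestronglyMeasurable ?_
    refine bump_isProfile.contDiff.continuous.measurable.smul ?_
    have h1 : Measurable fun u => fderiv ℝ F (x - r • u) := hDm.comp
      (by fun_prop : Measurable fun u : E => x - r • u)
    exact (ContinuousLinearMap.compL ℝ (E × ℝ) E V).continuous₂.measurable.comp
      (h1.prodMk hTc.measurable)
  have main := hasFDerivAt_integral_of_dominated_loc_of_lip (μ := (volume : Measure E)) (𝕜 := ℝ)
    (s := univ) (x₀ := (x, r)) (F := fun (z : E × ℝ) u => bump u • F (z.1 - z.2 • u)) (F' := F')
    (bound := fun u => bump u • (K * (1 + ‖u‖))) univ_mem ?_ ?_ hF'm ?_ ?_ ?_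
  · obtain ⟨hint, hder⟩ := main
    refine ⟨_, hder, fun e ς => ?_⟩
    rw [ContinuousLinearMap.integral_apply hint]
    have i1 := bump_isProfile.integrable_smul hDm hDb x r
    have i2 := fun j : Fin (Module.finrank ℝ E) =>
      (prof_isProfile (.inl (.inr j))).integrable_smul hDm hDb x r
    have i3 := fun j => (i2 j).apply_continuousLinearMap (stdOrthonormalBasis ℝ E j)
    simp only [avg]
    rw [ContinuousLinearMap.integral_apply i1]
    simp_rw [ContinuousLinearMap.integral_apply (i2 _)]
    have i4 : Integrable fun a => ς • ∑ j, (prof (.inl (.inr j)) a • fderiv ℝ F (x - r • a))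
        (stdOrthonormalBasis ℝ E j) := (integrable_finsetSum _ fun j _ => i3 j).smul ς
    rw [← integral_finsetSum _ fun j _ => i3 j, ← integral_smul,
      ← integral_sub (i1.apply_continuousLinearMap e) i4]
    refine integral_congr_ae (.of_forall fun u => ?_)
    have hu : fderiv ℝ F (x - r • u) u = ∑ j, inner ℝ (stdOrthonormalBasis ℝ E j) u •
        fderiv ℝ F (x - r • u) (stdOrthonormalBasis ℝ E j) := by
      have h5 := congrArg (fderiv ℝ F (x - r • u)) ((stdOrthonormalBasis ℝ E).sum_repr' u)
      rw [map_sum] at h5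
      simpa using h5.symm
    simp only [hF', hT, prof, _root_.smul_apply, ContinuousLinearMap.comp_apply,
      _root_.sub_apply, ContinuousLinearMap.coe_fst', ContinuousLinearMap.smulRight_apply,
      ContinuousLinearMap.coe_snd', map_sub, map_smul, hu, smul_sub, Finset.smul_sum, smul_smul]
    congr 1
    refine Finset.sum_congr rfl fun j _ => ?_
    congr 1; ring
  · refine .of_forall fun z => Continuous.aestronglyMeasurable ?_
    exact bump_isProfile.contDiff.continuous.smul (hF.continuous.comp (by fun_prop))
  · exact integrable_bump_smul_continuous (hF.continuous.comp (by fun_prop))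
  · refine .of_forall fun u => LipschitzOnWith.of_dist_le_mul fun z _ w _ => ?_
    have hb := bump_nonneg u
    have h0 : 0 ≤ bump u • ((K : ℝ) * (1 + ‖u‖)) := by rw [smul_eq_mul]; positivity
    rw [dist_eq_norm, ← smul_sub, norm_smul, Real.norm_of_nonneg hb, Real.coe_nnabs,
      abs_of_nonneg h0, smul_eq_mul, mul_assoc]
    gcongr
    have h1 := hF.dist_le_mul (z.1 - z.2 • u) (w.1 - w.2 • u)
    rw [dist_eq_norm, dist_eq_norm] at h1
    refine h1.trans ?_
    rw [mul_assoc]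
    gcongr
    have h2 : z.1 - z.2 • u - (w.1 - w.2 • u) = (z - w).1 - (z - w).2 • u := by
      simp only [Prod.fst_sub, Prod.snd_sub, sub_smul]; abel
    rw [h2, dist_eq_norm]
    refine (norm_sub_le _ _).trans ?_
    rw [norm_smul]
    nlinarith [norm_fst_le (z - w), norm_snd_le (z - w), norm_nonneg u]
  · exact integrable_bump_smul_continuous (by fun_prop)
  · have h1 := (quasiMeasurePreserving_sub_smul x hr).ae hF.ae_differentiableAt
    filter_upwards [h1] with u hu
    have h2 : HasFDerivAt (fun z : E × ℝ => z.1 - z.2 • u) (T u) (x, r) :=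
      hasFDerivAt_fst.sub (hasFDerivAt_snd.smul_const u)
    exact (HasFDerivAt.comp (x, r) (f := fun z : E × ℝ => z.1 - z.2 • u)
      hu.hasFDerivAt h2).const_smul _

lemma contDiffOn_avg_lipschitz {F : E → V} {K : ℝ≥0} (hF : LipschitzWith K F) :
    ContDiffOn ℝ 1 (fun z : E × ℝ => avg bump F z.1 z.2) {z | 0 < z.2} :=
  contDiffOn_avg bump_isProfile hF.continuous.locallyIntegrable

lemma norm_sum_avg_le_osc {W : Type*} [NormedAddCommGroup W] [NormedSpace ℝ W]
    (f : E → E →L[ℝ] W) (x : E) (r : ℝ) :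
    ‖∑ j, avg (prof (.inl (.inr j))) f x r (stdOrthonormalBasis ℝ E j)‖ ≤ osc f x r := by
  refine (norm_sum_le _ _).trans ?_
  calc _ ≤ ∑ j : Fin (Module.finrank ℝ E), ‖avg (prof (.inl (.inr j))) f x r‖ := by
        refine Finset.sum_le_sum fun j _ => ?_
        refine (ContinuousLinearMap.le_opNorm _ _).trans ?_
        simp
    _ ≤ _ := by
        rw [osc, Fintype.sum_sum_type, Fintype.sum_sum_type, add_assoc, add_comm, add_assoc]
        refine le_add_of_nonneg_right (add_nonneg ?_ ?_) <;>
        exact Finset.sum_nonneg fun _ _ => norm_nonneg _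

/-- The profile is carried by |u| ≤ 1, where (x,r) ↦ x - ru moves by at most |Δx| + |Δr|. Height
zero is included, so this also compares F itself with its averages. -/
lemma lipschitzWith_avg {F : E → V} {K : ℝ≥0} (hF : LipschitzWith K F) (z w : E × ℝ) :
    ‖avg bump F z.1 z.2 - avg bump F w.1 w.2‖ ≤ K * (‖z.1 - w.1‖ + |z.2 - w.2|) := by
  have hi : ∀ z : E × ℝ, Integrable fun u => bump u • F (z.1 - z.2 • u) := fun z =>
    integrable_bump_smul_continuous (hF.continuous.comp (by fun_prop))
  simp only [avg]
  rw [← integral_sub (hi z) (hi w)]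
  have h1 : ∫ u : E, bump u * (K * (‖z.1 - w.1‖ + |z.2 - w.2|))
      = K * (‖z.1 - w.1‖ + |z.2 - w.2|) := by
    rw [integral_mul_const, integral_bump, one_mul]
  rw [← h1]
  refine norm_integral_le_of_norm_le (bump_isProfile.integrable.mul_const _) (.of_forall fun u => ?_)
  rw [← smul_sub, norm_smul, Real.norm_of_nonneg (bump_nonneg u)]
  rcases le_or_gt ‖u‖ 1 with hu | hu
  · have hb := bump_nonneg u
    gcongr
    have h1 := hF.dist_le_mul (z.1 - z.2 • u) (w.1 - w.2 • u)
    rw [dist_eq_norm, dist_eq_norm] at h1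
    refine h1.trans ?_
    gcongr
    have h2 : z.1 - z.2 • u - (w.1 - w.2 • u) = (z.1 - w.1) - (z.2 - w.2) • u := by
      simp only [sub_smul]; abel
    rw [h2]
    refine (norm_sub_le _ _).trans ?_
    rw [norm_smul, Real.norm_eq_abs]
    gcongr
    exact mul_le_of_le_one_right (abs_nonneg _) hu
  · simp [bump_isProfile.eq_zero u hu]

/-- The distance between a Lipschitz function and its averages. -/
lemma enorm_sub_avg_lipschitz_le {F : E → V} {K : ℝ≥0} (hF : LipschitzWith K F) (x : E) {r : ℝ}
    (hr : 0 < r) :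
    ‖F x - avg bump F x r‖ₑ ≤ ENNReal.ofReal r
      * ∫⁻ σ in Icc (0 : ℝ) 1, ENNReal.ofReal (osc (fderiv ℝ F) x (σ * r)) := by
  have : CompleteSpace V := FiniteDimensional.complete ℝ V
  have hDm : Measurable (fderiv ℝ F) := measurable_fderiv ℝ F
  have hDb : ∀ y, ‖fderiv ℝ F y‖ ≤ K := fun y => norm_fderiv_le_of_lipschitz ℝ hF
  set g : ℝ → V := fun σ => avg bump F x (σ * r) with hg
  have hd : ∀ σ : ℝ, 0 < σ → ∃ v, HasDerivAt g v σ ∧ ‖v‖ ≤ r * osc (fderiv ℝ F) x (σ * r) := by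
    intro σ hσ
    obtain ⟨L, hL, hLa⟩ := hasFDerivAt_avg_lipschitz hF x (r := σ * r) (by positivity)
    have h1 : HasDerivAt (fun σ : ℝ => (x, σ * r)) ((0 : E), r) σ := by
      refine (hasDerivAt_const σ x).prodMk ?_
      simpa using (hasDerivAt_id σ).mul_const r
    have h2 : HasDerivAt g (L (0, r)) σ :=
      HasFDerivAt.comp_hasDerivAt (f := fun σ : ℝ => (x, σ * r)) σ hL h1
    refine ⟨_, h2, ?_⟩
    rw [hLa, map_zero, zero_sub, norm_neg, norm_smul, Real.norm_of_nonneg hr.le]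
    gcongr
    exact norm_sum_avg_le_osc _ _ _
  have hder : ∀ σ ∈ Ioo (0 : ℝ) 1, HasDerivAt g (deriv g σ) σ := fun σ hσ => by
    obtain ⟨v, hv, -⟩ := hd σ hσ.1
    exact hv.differentiableAt.hasDerivAt
  have hnd : ∀ σ : ℝ, 0 < σ → ‖deriv g σ‖ ≤ r * osc (fderiv ℝ F) x (σ * r) := fun σ hσ => by
    obtain ⟨v, hv, hvn⟩ := hd σ hσ
    rwa [hv.deriv]
  have hgc : Continuous g := by
    refine continuous_iff_continuousAt.2 fun σ => ?_
    refine tendsto_iff_norm_sub_tendsto_zero.2 ?_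
    refine squeeze_zero (fun _ => norm_nonneg _)
      (fun σ' => lipschitzWith_avg hF (x, σ' * r) (x, σ * r)) ?_
    have : Continuous fun σ' : ℝ => (K : ℝ) * (‖x - x‖ + |σ' * r - σ * r|) := by fun_prop
    simpa using this.tendsto σ
  have hint : IntegrableOn (deriv g) (Icc 0 1) := by
    rw [integrableOn_Icc_iff_integrableOn_Ioo]
    refine Measure.integrableOn_of_bounded (M := r * (profMass E * K)) (by simp)
      (aestronglyMeasurable_deriv g _) ?_
    filter_upwards [ae_restrict_mem measurableSet_Ioo] with σ hσ
    refine (hnd σ hσ.1).trans ?_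
    gcongr
    exact osc_le hDm hDb 0 (by simpa using hDb) _ _
  -- F need not be differentiable at x, so the path from F(x) to its average is differentiable only
  -- for σ > 0; at σ = 0 continuity is enough.
  have h1 := intervalIntegral.integral_eq_sub_of_hasDerivAt_of_le zero_le_one hgc.continuousOn hder
    ((intervalIntegrable_iff_integrableOn_Icc_of_le zero_le_one).2 hint)
  have h2 : F x - avg bump F x r = -∫ σ in Ioo (0 : ℝ) 1, deriv g σ := by
    rw [← integral_Icc_eq_integral_Ioo, integral_Icc_eq_integral_Ioc,
      ← intervalIntegral.integral_of_le zero_le_one, h1]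
    simp [hg, avg_bump_zero]
  rw [h2, enorm_neg, Measure.restrict_congr_set (Ioo_ae_eq_Icc (a := (0 : ℝ)) (b := 1)).symm,
    ← lintegral_const_mul' _ _ (by finiteness)]
  refine (enorm_integral_le_lintegral_enorm _).trans ?_
  refine setLIntegral_mono' measurableSet_Ioo fun σ hσ => ?_
  rw [← ofReal_norm, ← ENNReal.ofReal_mul hr.le]
  exact ENNReal.ofReal_le_ofReal (hnd σ hσ.1)

/-- The first order Taylor remainder of the averages of a Lipschitz function. -/
lemma enorm_avg_lipschitz_sub_le {F : E → V} {K : ℝ≥0} (hF : LipschitzWith K F) (x v : E) {r : ℝ}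
    (hr : 0 < r) :
    ‖avg bump F (x + r • v) r - avg bump F x r - r • avg bump (fderiv ℝ F) x r v‖ₑ
      ≤ ENNReal.ofReal (r * ‖v‖) * ∫⁻ τ in Icc (0 : ℝ) 1,
        ‖avg bump (fderiv ℝ F) (x + r • τ • v) r - avg bump (fderiv ℝ F) x r‖ₑ := by
  have : CompleteSpace V := FiniteDimensional.complete ℝ V
  have hDm : Measurable (fderiv ℝ F) := measurable_fderiv ℝ F
  have hDb : ∀ y, ‖fderiv ℝ F y‖ ≤ K := fun y => norm_fderiv_le_of_lipschitz ℝ hF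
  have hDl : LocallyIntegrable (fderiv ℝ F) := by
    refine (locallyIntegrable_const (K : ℝ)).mono hDm.aestronglyMeasurable (.of_forall fun x => ?_)
    exact (hDb x).trans (le_abs_self _)
  set G : E → E →L[ℝ] V := fun y => avg bump (fderiv ℝ F) y r with hG
  have hGc : Continuous G :=
    ((contDiffOn_avg bump_isProfile hDl).continuousOn).comp_continuous
      (by fun_prop : Continuous fun y : E => (y, r)) fun y => hr
  -- With the linear part at x subtracted, the derivative along the segment is the variation of the
  -- averaged slope.
  have hd : ∀ τ : ℝ, HasDerivAt (fun τ : ℝ => avg bump F (x + r • τ • v) r - τ • (r • G x v))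
      (r • (G (x + r • τ • v) - G x) v) τ := fun τ => by
    obtain ⟨L, hL, hLa⟩ := hasFDerivAt_avg_lipschitz hF (x + r • τ • v) hr.ne'
    have h1 : HasDerivAt (fun τ : ℝ => (x + r • τ • v, r)) (r • v, (0 : ℝ)) τ := by
      refine HasDerivAt.prodMk ?_ (hasDerivAt_const τ r)
      simpa using (((hasDerivAt_id τ).smul_const v).const_smul r).const_add x
    have h2 := (hL.comp_hasDerivAt τ h1).sub ((hasDerivAt_id τ).smul_const (r • G x v))
    refine h2.congr_deriv ?_
    rw [hLa]
    simp [hG, smul_sub]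
  have hc : Continuous fun τ : ℝ => r • (G (x + r • τ • v) - G x) v := by fun_prop
  have h1 := intervalIntegral.integral_eq_sub_of_hasDerivAt (a := 0) (b := 1)
    (fun τ _ => hd τ) (hc.intervalIntegrable _ _)
  have h2 : avg bump F (x + r • v) r - avg bump F x r - r • G x v
      = ∫ τ in Icc (0 : ℝ) 1, r • (G (x + r • τ • v) - G x) v := by
    rw [integral_Icc_eq_integral_Ioc, ← intervalIntegral.integral_of_le zero_le_one, h1]
    simp only [one_smul, zero_smul, smul_zero, add_zero, sub_zero]
    abel
  change ‖avg bump F (x + r • v) r - avg bump F x r - r • G x v‖ₑ ≤ _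
  rw [h2, ← lintegral_const_mul' _ _ (by finiteness)]
  refine (enorm_integral_le_lintegral_enorm _).trans (lintegral_mono fun τ => ?_)
  rw [← ofReal_norm, ← ofReal_norm, ← ENNReal.ofReal_mul (by positivity)]
  refine ENNReal.ofReal_le_ofReal ?_
  rw [norm_smul, Real.norm_of_nonneg hr.le, mul_assoc, mul_comm ‖v‖]
  gcongr
  exact ContinuousLinearMap.le_opNorm _ _

end LipschitzAverage

/-! ### Coordinates on the ambient space and the Hausdorff measure of a Lipschitz graph. -/

section Graph

open Set Metric Filter Topology

/-- The component along the plane of a point of `ℝⁿ`, as a linear map. -/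
def baseL : Amb d m →L[ℝ] EuclideanSpace ℝ (Fin d) :=
  LinearMap.toContinuousLinearMap
    { toFun := fun z => WithLp.toLp 2 fun i => z (Sum.inl i)
      map_add' := fun _ _ => rfl
      map_smul' := fun _ _ => rfl }

/-- The transversal component of a point of `ℝⁿ`, as a linear map. -/
def transvL : Amb d m →L[ℝ] EuclideanSpace ℝ (Fin m) :=
  LinearMap.toContinuousLinearMap
    { toFun := transv
      map_add' := fun _ _ => rfl
      map_smul' := fun _ _ => rfl }

/-- The map `(x, t) ↦ pt x t` as a linear equivalence. -/
def ptL : (EuclideanSpace ℝ (Fin d) × EuclideanSpace ℝ (Fin m)) ≃L[ℝ] Amb d m :=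
  LinearEquiv.toContinuousLinearEquiv
    { toFun := fun p => pt p.1 p.2
      map_add' := fun p q => by ext i; rcases i with i | i <;> rfl
      map_smul' := fun c p => by ext i; rcases i with i | i <;> rfl
      invFun := fun z => (baseL z, transvL z)
      left_inv := fun p => rfl
      right_inv := fun z => by ext i; rcases i with i | i <;> rfl }

lemma ptL_apply (p : EuclideanSpace ℝ (Fin d) × EuclideanSpace ℝ (Fin m)) :
    ptL p = pt p.1 p.2 := rfl

@[simp] lemma transvL_apply (z : Amb d m) : transvL z = transv z := rfl

@[simp] lemma baseL_pt (x : EuclideanSpace ℝ (Fin d)) (t : EuclideanSpace ℝ (Fin m)) :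
    baseL (pt x t) = x := rfl

@[simp] lemma transv_pt (x : EuclideanSpace ℝ (Fin d)) (t : EuclideanSpace ℝ (Fin m)) :
    transv (pt x t) = t := rfl

lemma pt_base_transv (z : Amb d m) : pt (baseL z) (transv z) = z := ptL.apply_symm_apply z

lemma pt_add (x x' : EuclideanSpace ℝ (Fin d)) (t t' : EuclideanSpace ℝ (Fin m)) :
    pt (x + x') (t + t') = pt x t + pt x' t' := ptL.map_add (x, t) (x', t')

lemma pt_sub (x x' : EuclideanSpace ℝ (Fin d)) (t t' : EuclideanSpace ℝ (Fin m)) :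
    pt (x - x') (t - t') = pt x t - pt x' t' := ptL.map_sub (x, t) (x', t')

lemma pt_smul (c : ℝ) (x : EuclideanSpace ℝ (Fin d)) (t : EuclideanSpace ℝ (Fin m)) :
    pt (c • x) (c • t) = c • pt x t := ptL.map_smul c (x, t)

lemma norm_pt_sq (x : EuclideanSpace ℝ (Fin d)) (t : EuclideanSpace ℝ (Fin m)) :
    ‖pt x t‖ ^ 2 = ‖x‖ ^ 2 + ‖t‖ ^ 2 := by
  simp [EuclideanSpace.norm_sq_eq, Fintype.sum_sum_type, pt]

lemma norm_sq_eq_base_transv (z : Amb d m) : ‖z‖ ^ 2 = ‖baseL z‖ ^ 2 + ‖transv z‖ ^ 2 := by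
  conv_lhs => rw [← pt_base_transv z]
  exact norm_pt_sq _ _

lemma norm_baseL_le (z : Amb d m) : ‖baseL z‖ ≤ ‖z‖ := by
  refine le_of_sq_le_sq ?_ (norm_nonneg _)
  rw [norm_sq_eq_base_transv z]
  nlinarith [sq_nonneg ‖transv z‖]

lemma norm_transv_le (z : Amb d m) : ‖transv z‖ ≤ ‖z‖ := by
  refine le_of_sq_le_sq ?_ (norm_nonneg _)
  rw [norm_sq_eq_base_transv z]
  nlinarith [sq_nonneg ‖baseL z‖]

lemma norm_pt_le (x : EuclideanSpace ℝ (Fin d)) (t : EuclideanSpace ℝ (Fin m)) :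
    ‖pt x t‖ ≤ ‖x‖ + ‖t‖ := by
  refine le_of_sq_le_sq ?_ (by positivity)
  rw [norm_pt_sq]
  nlinarith [norm_nonneg x, norm_nonneg t]

@[simp] lemma norm_pt_zero_left (t : EuclideanSpace ℝ (Fin m)) :
    ‖(pt 0 t : Amb d m)‖ = ‖t‖ := by
  have h := norm_pt_sq (0 : EuclideanSpace ℝ (Fin d)) t
  rw [norm_zero, zero_pow two_ne_zero, zero_add] at h
  exact (sq_eq_sq₀ (norm_nonneg _) (norm_nonneg _)).1 h

lemma mem_plane_iff (z : Amb d m) : z ∈ plane d m ↔ transv z = 0 := by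
  constructor
  · rintro ⟨x, rfl⟩; rfl
  · intro h
    exact ⟨baseL z, by simp only; rw [← h]; exact pt_base_transv z⟩

lemma isClosed_plane : IsClosed (plane d m) := by
  have : plane d m = transvL ⁻¹' {0} := by ext z; simp [mem_plane_iff]
  rw [this]
  exact isClosed_singleton.preimage transvL.continuous

lemma mem_graphOf_iff (F : EuclideanSpace ℝ (Fin d) → EuclideanSpace ℝ (Fin m)) (z : Amb d m) :
    z ∈ graphOf F ↔ transv z = F (baseL z) := by
  constructor
  · rintro ⟨x, rfl⟩; rfl
  · intro h
    exact ⟨baseL z, by simp only; rw [← h]; exact pt_base_transv z⟩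

lemma isClosed_graphOf {F : EuclideanSpace ℝ (Fin d) → EuclideanSpace ℝ (Fin m)}
    (hF : Continuous F) : IsClosed (graphOf F) := by
  have : graphOf F = {z | transvL z = F (baseL z)} := by ext z; simp [mem_graphOf_iff]
  rw [this]
  exact isClosed_eq transvL.continuous (hF.comp baseL.continuous)

lemma measurePreserving_ptL :
    MeasurePreserving (ptL : (EuclideanSpace ℝ (Fin d) × EuclideanSpace ℝ (Fin m)) → Amb d m)
      (volume.prod volume) volume := by
  have h1 := (PiLp.volume_preserving_ofLp (Fin d)).prod (PiLp.volume_preserving_ofLp (Fin m))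
  have h2 := volume_measurePreserving_sumPiEquivProdPi_symm (fun _ : Fin d ⊕ Fin m => ℝ)
  exact (PiLp.volume_preserving_toLp (Fin d ⊕ Fin m)).comp (h2.comp h1)

instance isAddHaarMeasure_hausdorffMeasure_euclidean :
    (Measure.hausdorffMeasure (d : ℝ) : Measure (EuclideanSpace ℝ (Fin d))).IsAddHaarMeasure := by
  have := isAddHaarMeasure_hausdorffMeasure (E := EuclideanSpace ℝ (Fin d))
  rwa [finrank_euclideanSpace_fin] at this

/-- The projection to the plane of the Hausdorff measure on a Lipschitz graph has a density that
is bounded above and below. -/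
lemma exists_graph_density (d m : ℕ) : ∃ c : ℝ, 0 < c ∧
    ∀ (F : EuclideanSpace ℝ (Fin d) → EuclideanSpace ℝ (Fin m)) (K : ℝ≥0), LipschitzWith K F →
      ∃ J : EuclideanSpace ℝ (Fin d) → ℝ, Measurable J ∧ (∀ x, c ≤ J x) ∧
        (∀ x, J x ≤ c * (1 + K) ^ d) ∧ ∀ g : Amb d m → ℝ, Measurable g →
          ∫ y in graphOf F, g y ∂(Measure.hausdorffMeasure (d : ℝ))
            = ∫ y, J y * g (pt y (F y)) := by
  -- c is the ratio of Hausdorff to Lebesgue measure on the plane. It does not depend on F, so the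
  -- frames can be centred at this density before the graph is given.
  obtain ⟨c, hc0, hct, hc⟩ : ∃ c : ℝ≥0∞, c ≠ 0 ∧ c ≠ ⊤ ∧
      (Measure.hausdorffMeasure (d : ℝ) : Measure (EuclideanSpace ℝ (Fin d))) = c • volume := by
    refine ⟨(Measure.addHaarScalarFactor _ _ : ℝ≥0), ?_, ENNReal.coe_ne_top,
      Measure.isAddLeftInvariant_eq_smul _ _⟩
    exact ENNReal.coe_ne_zero.2
      (Measure.addHaarScalarFactor_pos_of_isAddHaarMeasure _ _).ne'
  have hcr : 0 < c.toReal := ENNReal.toReal_pos hc0 hct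
  refine ⟨c.toReal, hcr, fun F K hF => ?_⟩
  set gm : EuclideanSpace ℝ (Fin d) → Amb d m := fun x => pt x (F x) with hgm
  have hgmL : LipschitzWith (1 + K) gm := LipschitzWith.of_dist_le_mul fun x y => by
    rw [dist_eq_norm, dist_eq_norm, hgm]
    simp only
    rw [← pt_sub]
    refine (norm_pt_le _ _).trans ?_
    have := hF.dist_le_mul x y
    rw [dist_eq_norm, dist_eq_norm] at this
    push_cast
    linarith
  have hbL : LipschitzWith 1 (baseL : Amb d m → _) := LipschitzWith.of_dist_le_mul fun x y => by
    rw [dist_eq_norm, dist_eq_norm, ← map_sub]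
    simpa using norm_baseL_le (x - y)
  have hΓ : MeasurableSet (graphOf F) := (isClosed_graphOf hF.continuous).measurableSet
  -- In place of the area formula, ν is squeezed between two multiples of Lebesgue measure: the
  -- graph map is (1+K)-Lipschitz and the projection back is 1-Lipschitz. A Radon–Nikodym density
  -- then inherits the two bounds.
  set ν : Measure (EuclideanSpace ℝ (Fin d)) :=
    ((Measure.hausdorffMeasure (d : ℝ)).restrict (graphOf F)).map baseL with hν
  have hbm : Measurable (baseL : Amb d m → EuclideanSpace ℝ (Fin d)) := baseL.continuous.measurable
  have hνA : ∀ A, MeasurableSet A → ν A = Measure.hausdorffMeasure (d : ℝ) (gm '' A) := by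
    intro A hA
    rw [hν, Measure.map_apply hbm hA, Measure.restrict_apply (hbm hA)]
    congr 1
    ext z
    constructor
    · rintro ⟨hz, x, rfl⟩
      exact ⟨x, hz, rfl⟩
    · rintro ⟨x, hx, rfl⟩
      exact ⟨hx, x, rfl⟩
  set D : ℝ≥0∞ := (1 + (K : ℝ≥0∞)) ^ d with hD
  have hup : ∀ A, MeasurableSet A → ν A ≤ c * D * volume A := by
    intro A hA
    rw [hνA A hA]
    refine (hgmL.hausdorffMeasure_image_le (by positivity) A).trans (le_of_eq ?_)
    rw [hc, Measure.smul_apply, smul_eq_mul, ENNReal.rpow_natCast, hD]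
    push_cast
    ring
  have hlow : ∀ A, MeasurableSet A → c * volume A ≤ ν A := by
    intro A hA
    rw [hνA A hA]
    have h1 := hbL.hausdorffMeasure_image_le (d := d) (by positivity) (gm '' A)
    have h2 : baseL '' (gm '' A) = A := by
      rw [image_image]; simp [hgm]
    rw [h2, hc, Measure.smul_apply, smul_eq_mul] at h1
    simpa using h1
  have hDt : c * D ≠ ⊤ := by finiteness
  have hle : ν ≤ (c * D) • volume := Measure.le_iff.2 fun A hA => hup A hA
  have hfin : IsFiniteMeasureOnCompacts ν := ⟨fun k hk =>
    (hle k).trans_lt (by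
      rw [Measure.smul_apply, smul_eq_mul]
      exact ENNReal.mul_lt_top hDt.lt_top hk.measure_lt_top)⟩
  have hac : ν ≪ volume := (Measure.absolutelyContinuous_of_le hle).trans
    Measure.smul_absolutelyContinuous
  have hden : volume.withDensity (ν.rnDeriv volume) = ν := Measure.withDensity_rnDeriv_eq _ _ hac
  have hset : ∀ A, MeasurableSet A → ∫⁻ x in A, ν.rnDeriv volume x = ν A := fun A hA => by
    rw [← withDensity_apply _ hA, hden]
  have h1 : ν.rnDeriv volume ≤ᵐ[volume] fun _ => c * D := by
    refine ae_le_of_forall_setLIntegral_le_of_sigmaFinite (Measure.measurable_rnDeriv _ _) ?_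
    intro A hA _
    rw [hset A hA, setLIntegral_const]
    exact hup A hA
  have h2 : (fun _ => c) ≤ᵐ[volume] ν.rnDeriv volume := by
    refine ae_le_of_forall_setLIntegral_le_of_sigmaFinite measurable_const ?_
    intro A hA _
    rw [hset A hA, setLIntegral_const]
    exact hlow A hA
  have hcD : (c * D).toReal = c.toReal * (1 + K) ^ d := by
    rw [ENNReal.toReal_mul, hD, ENNReal.toReal_pow, ENNReal.toReal_add (by simp) (by simp)]
    simp
  have hDge : c.toReal ≤ c.toReal * (1 + K) ^ d :=
    le_mul_of_one_le_right hcr.le (one_le_pow₀ (by simp))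
  -- Truncation turns the almost everywhere bounds on the density into bounds at every point.
  set J : EuclideanSpace ℝ (Fin d) → ℝ := fun x =>
    max c.toReal (min (ν.rnDeriv volume x).toReal (c.toReal * (1 + K) ^ d)) with hJ
  have hJm : Measurable J :=
    measurable_const.max ((Measure.measurable_rnDeriv _ _).ennreal_toReal.min measurable_const)
  have hJe : ν.rnDeriv volume =ᵐ[volume] fun x => ENNReal.ofReal (J x) := by
    filter_upwards [h1, h2] with x hx1 hx2
    have ht : ν.rnDeriv volume x ≠ ⊤ := ne_top_of_le_ne_top hDt hx1
    have e1 : (ν.rnDeriv volume x).toReal ≤ c.toReal * (1 + K) ^ d := by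
      rw [← hcD]; exact ENNReal.toReal_mono hDt hx1
    have e2 : c.toReal ≤ (ν.rnDeriv volume x).toReal := ENNReal.toReal_mono ht hx2
    simp only [hJ]
    rw [min_eq_left e1, max_eq_right e2, ENNReal.ofReal_toReal ht]
  refine ⟨J, hJm, fun x => le_max_left _ _, fun x => max_le hDge (min_le_right _ _),
    fun g hg => ?_⟩
  have hgc : Measurable fun y => g (gm y) := hg.comp hgmL.continuous.measurable
  calc ∫ y in graphOf F, g y ∂(Measure.hausdorffMeasure (d : ℝ))
      = ∫ y in graphOf F, g (gm (baseL y)) ∂(Measure.hausdorffMeasure (d : ℝ)) := by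
        refine setIntegral_congr_fun hΓ fun y hy => ?_
        obtain ⟨x, rfl⟩ := hy
        rfl
    _ = ∫ x, g (gm x) ∂ν := by
        rw [hν, integral_map hbm.aemeasurable hgc.aestronglyMeasurable]
    _ = ∫ x, g (gm x) ∂(volume.withDensity fun x => ENNReal.ofReal (J x)) := by
        rw [← hden, withDensity_congr_ae hJe]
    _ = ∫ y, J y * g (pt y (F y)) := by
        rw [integral_withDensity_eq_integral_toReal_smul (by fun_prop) (by simp)]
        refine integral_congr_ae (.of_forall fun x => ?_)
        simp only
        rw [ENNReal.toReal_ofReal (hcr.le.trans (le_max_left _ _)), smul_eq_mul]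

end Graph

/-! ### Square roots near the identity of a Banach algebra. -/

section SquareRoot

open Set Metric Filter Topology

/-- The square root of elements close to `1` in a real Banach algebra with an involution. -/
lemma exists_contDiffAt_sqrt (R : Type*) [NormedRing R] [NormedAlgebra ℝ R] [CompleteSpace R]
    [StarRing R] [ContinuousStar R] :
    ∃ σ : R → R, ContDiffAt ℝ 1 σ 1 ∧ σ 1 = 1 ∧ (∀ᶠ H in 𝓝 (1 : R), σ H * σ H = H) ∧
      ∀ᶠ H in 𝓝 (1 : R), star H = H → star (σ H) = σ H := by
  have hf : ContDiff ℝ 1 fun X : R => X * X := contDiff_id.mul contDiff_id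
  let e : R ≃L[ℝ] R := ContinuousLinearEquiv.smulLeft (Units.mk0 (2 : ℝ) two_ne_zero)
  have hf' : HasFDerivAt (fun X : R => X * X) (e : R →L[ℝ] R) 1 := by
    have h := (hasFDerivAt_id (𝕜 := ℝ) (1 : R)).mul' (hasFDerivAt_id (1 : R))
    refine h.congr_fderiv ?_
    ext x
    simp [e, two_smul, Units.smul_def]
  have h1 := hf.contDiffAt (x := (1 : R))
  have hs := h1.hasStrictFDerivAt' hf' one_ne_zero
  set σ := h1.localInverse hf' one_ne_zero with hσ
  have hcd : ContDiffAt ℝ 1 σ 1 := by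
    have := h1.to_localInverse hf' one_ne_zero
    rwa [one_mul] at this
  have hr : ∀ᶠ H in 𝓝 (1 : R), σ H * σ H = H := by
    have := hs.eventually_right_inverse
    rwa [one_mul] at this
  have hl : ∀ᶠ X in 𝓝 (1 : R), σ (X * X) = X := hs.eventually_left_inverse
  have hσ1 : σ 1 = 1 := by simpa using hl.self_of_nhds
  refine ⟨σ, hcd, hσ1, hr, ?_⟩
  have hc : Tendsto (fun H => star (σ H)) (𝓝 1) (𝓝 1) := by
    have := (continuous_star.tendsto (σ 1)).comp hcd.continuousAt
    rw [hσ1, star_one] at this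
    exact this
  filter_upwards [hr, hc.eventually hl] with H h2 h3 hH
  -- For self-adjoint H, star (σ H) is another square root of H close to 1, so local uniqueness
  -- identifies it with σ H.
  rw [← star_mul, h2, hH] at h3
  exact h3.symm

end SquareRoot

/-! ### Smoothness of determinants. -/

section Determinant

variable {X : Type*} [NormedAddCommGroup X] [NormedSpace ℝ X]

lemma contDiffAt_matrix_det {ι : Type*} [Fintype ι] [DecidableEq ι] {n : WithTop ℕ∞}
    {M : X → Matrix ι ι ℝ} {x : X} (hM : ∀ i j, ContDiffAt ℝ n (fun x => M x i j) x) :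
    ContDiffAt ℝ n (fun x => (M x).det) x := by
  simp only [Matrix.det_apply]
  refine ContDiffAt.sum fun σ _ => ?_
  simp only [Units.smul_def, zsmul_eq_mul]
  exact contDiffAt_const.mul (contDiffAt_prod fun i _ => hM _ _)

lemma contDiff_linearMap_det {E : Type*} [NormedAddCommGroup E] [NormedSpace ℝ E]
    [FiniteDimensional ℝ E] {n : WithTop ℕ∞} :
    ContDiff ℝ n fun f : E →L[ℝ] E => LinearMap.det (f : E →ₗ[ℝ] E) := by
  set b := Module.finBasis ℝ E
  have : (fun f : E →L[ℝ] E => LinearMap.det (f : E →ₗ[ℝ] E))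
      = fun f : E →L[ℝ] E => (LinearMap.toMatrix b b (f : E →ₗ[ℝ] E)).det := by
    ext f; rw [LinearMap.det_toMatrix]
  rw [this]
  refine contDiff_iff_contDiffAt.2 fun f => contDiffAt_matrix_det fun i j => ?_
  have h : (fun f : E →L[ℝ] E => LinearMap.toMatrix b b (f : E →ₗ[ℝ] E) i j)
      = (LinearMap.toContinuousLinearMap (b.coord i)) ∘ ContinuousLinearMap.apply ℝ E (b j) := by
    ext f; simp [LinearMap.toMatrix_apply]
  rw [h]
  exact ((ContinuousLinearMap.contDiff _).comp (ContinuousLinearMap.contDiff _)).contDiffAt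

end Determinant

/-! ### The Riesz-type integral over a flat graph. -/

section ModelIntegral

variable {E : Type*} [NormedAddCommGroup E] [InnerProductSpace ℝ E] [FiniteDimensional ℝ E]
  [MeasurableSpace E] [BorelSpace E]

variable (E) in
/-- The integral of the Riesz-type kernel of order `finrank E + α` at height one. -/
def modelMass (α : ℝ) : ℝ := ∫ v : E, (1 + ‖v‖ ^ 2) ^ (-(Module.finrank ℝ E + α) / 2)

lemma modelMass_pos {α : ℝ} (hα : 0 < α) : 0 < modelMass E α := by
  have hi := integrable_rpow_neg_one_add_norm_sq (E := E) (μ := volume)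
    (r := Module.finrank ℝ E + α) (by linarith)
  have hp : ∀ v : E, 0 < (1 + ‖v‖ ^ 2) ^ (-(Module.finrank ℝ E + α) / 2) := fun v => by positivity
  rw [modelMass, integral_pos_iff_support_of_nonneg (fun v => (hp v).le) hi]
  have : (Function.support fun v : E => (1 + ‖v‖ ^ 2) ^ (-(Module.finrank ℝ E + α) / 2))
      = Set.univ := by
    ext v; simpa only [Function.mem_support, Set.mem_univ, iff_true] using (hp v).ne'
  rw [this]
  exact Measure.measure_univ_pos.2 (NeZero.ne _)

/-- Substituting w = Rv and then dilating by h evaluates the integral explicitly, so the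
normalisation that defines the height of a frame can be solved in closed form. -/
lemma integral_model {α : ℝ} {R : E →L[ℝ] E} (hR : LinearMap.det (R : E →ₗ[ℝ] E) ≠ 0) {h : ℝ}
    (hh : 0 < h) :
    ∫ v : E, (‖R v‖ ^ 2 + h ^ 2) ^ (-(Module.finrank ℝ E + α) / 2)
      = |LinearMap.det (R : E →ₗ[ℝ] E)|⁻¹ * h ^ (-α) * modelMass E α := by
  set s : ℝ := Module.finrank ℝ E + α with hs
  set k : E → ℝ := fun v => (‖v‖ ^ 2 + h ^ 2) ^ (-s / 2) with hk
  have hkm : Measurable k := by fun_prop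
  have h1 : ∫ v, k (R v) = |LinearMap.det (R : E →ₗ[ℝ] E)|⁻¹ * ∫ v, k v := by
    have e : ∫ v, k (R v) = ∫ v, k v ∂(Measure.map (⇑(R : E →ₗ[ℝ] E)) volume) :=
      (integral_map R.continuous.measurable.aemeasurable hkm.aestronglyMeasurable).symm
    rw [e, Measure.map_linearMap_addHaar_eq_smul_addHaar volume hR, integral_smul_measure,
      ENNReal.toReal_ofReal (abs_nonneg _), abs_inv, smul_eq_mul]
  have h2 : ∀ w, k (h • w) = h ^ (-s) * (1 + ‖w‖ ^ 2) ^ (-s / 2) := fun w => by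
    simp only [hk]
    rw [norm_smul, Real.norm_of_nonneg hh.le,
      show (h * ‖w‖) ^ 2 + h ^ 2 = h ^ 2 * (1 + ‖w‖ ^ 2) by ring,
      Real.mul_rpow (by positivity) (by positivity), ← Real.rpow_natCast h 2, ← Real.rpow_mul hh.le]
    congr 2
    push_cast
    ring
  have h3 := Measure.integral_comp_smul (volume : Measure E) k h
  simp only [h2] at h3
  rw [integral_const_mul, smul_eq_mul, abs_of_pos (by positivity)] at h3
  have h4 : ∫ v, k v = h ^ (-α) * modelMass E α := by
    have h5 : h ^ (-α) = h ^ (-s) * h ^ (Module.finrank ℝ E) := by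
      rw [← Real.rpow_natCast, ← Real.rpow_add hh]; congr 1; rw [hs]; ring
    have h6 : (h ^ Module.finrank ℝ E) ≠ 0 := by positivity
    rw [h5, modelMass, ← hs]
    rw [eq_inv_mul_iff_mul_eq₀ h6] at h3
    rw [← h3]
    ring
  change ∫ v, k (R v) = _
  rw [h1, h4]
  ring

end ModelIntegral
-- Frames adapted to an approximate graph.
section Frame

open Set Metric Filter Topology

variable (d m) in
/-- The parameters of an approximate graph: a slope and a density. -/
abbrev Param : Type :=
  (EuclideanSpace ℝ (Fin d) →L[ℝ] EuclideanSpace ℝ (Fin m)) × ℝ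

lemma inner_pt (x x' : EuclideanSpace ℝ (Fin d)) (t t' : EuclideanSpace ℝ (Fin m)) :
    inner ℝ (pt x t) (pt x' t') = inner ℝ x x' + inner ℝ t t' := by
  simp [PiLp.inner_apply, Fintype.sum_sum_type, pt]

/-- The inclusion of the plane, as a linear map. -/
def inclB : EuclideanSpace ℝ (Fin d) →L[ℝ] Amb d m :=
  (ptL (d := d) (m := m)).toContinuousLinearMap ∘L ContinuousLinearMap.inl ℝ _ _

/-- The inclusion of the transversal space, as a linear map. -/
def inclT : EuclideanSpace ℝ (Fin m) →L[ℝ] Amb d m :=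
  (ptL (d := d) (m := m)).toContinuousLinearMap ∘L ContinuousLinearMap.inr ℝ _ _

@[simp] lemma inclB_apply (x : EuclideanSpace ℝ (Fin d)) : (inclB x : Amb d m) = pt x 0 := rfl

@[simp] lemma inclT_apply (t : EuclideanSpace ℝ (Fin m)) : (inclT t : Amb d m) = pt 0 t := rfl

section Adjoint

variable (E E' : Type*) [NormedAddCommGroup E] [InnerProductSpace ℝ E] [FiniteDimensional ℝ E]
  [NormedAddCommGroup E'] [InnerProductSpace ℝ E'] [FiniteDimensional ℝ E']
  [CompleteSpace E] [CompleteSpace E']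

/-- The adjoint, as a linear map over the reals. -/
def adjointL : (E →L[ℝ] E') →L[ℝ] (E' →L[ℝ] E) :=
  LinearMap.toContinuousLinearMap
    { toFun := fun G => ContinuousLinearMap.adjoint G
      map_add' := fun _ _ => map_add _ _ _
      map_smul' := fun c G => by simp }

variable {E E'}

lemma inner_adjointL_left (G : E →L[ℝ] E') (y : E') (x : E) :
    inner ℝ (adjointL E E' G y) x = inner ℝ y (G x) :=
  ContinuousLinearMap.adjoint_inner_left G x y

variable (E E')

/-- A factor of `1 + GᵀG`. -/
lemma exists_contDiffAt_factor : ∃ R : (E →L[ℝ] E') → (E →L[ℝ] E), ContDiffAt ℝ 1 R 0 ∧ R 0 = 1 ∧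
    ∀ᶠ G in 𝓝 (0 : E →L[ℝ] E'), ∀ v, ‖R G v‖ ^ 2 = ‖v‖ ^ 2 + ‖G v‖ ^ 2 := by
  obtain ⟨τ, hτ, hτ1, hτs, hτa⟩ := exists_contDiffAt_sqrt (E →L[ℝ] E)
  -- The factor is the self-adjoint square root of 1 + GᵀG, whence |Rv|² = ⟨v, (1 + GᵀG)v⟩ = |v|² +
  -- |Gv|².
  set Q : (E →L[ℝ] E') → (E →L[ℝ] E) := fun G => 1 + adjointL E E' G ∘L G with hQ
  have hQc : ContDiff ℝ 1 Q := by fun_prop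
  have hQ0 : Q 0 = 1 := by simp [hQ]
  have hQt : Tendsto Q (𝓝 0) (𝓝 1) := by simpa only [hQ0] using hQc.continuous.tendsto 0
  refine ⟨fun G => τ (Q G), ContDiffAt.comp 0 (by rwa [hQ0]) hQc.contDiffAt, by simp only [hQ0, hτ1], ?_⟩
  filter_upwards [hQt.eventually hτs, hQt.eventually hτa] with G hs ha v
  have e2 : ∀ v, Q G v = v + adjointL E E' G (G v) := fun v => rfl
  have hsa : star (τ (Q G)) = τ (Q G) := ha
    (ContinuousLinearMap.isSelfAdjoint_iff_isSymmetric.2 fun x y => by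
      simp only [ContinuousLinearMap.coe_coe]
      rw [e2, e2, inner_add_left, inner_add_right, inner_adjointL_left,
        real_inner_comm (adjointL E E' G (G y)), inner_adjointL_left,
        real_inner_comm (G x)])
  have e1 : inner ℝ v ((τ (Q G) * τ (Q G)) v) = inner ℝ (star (τ (Q G)) v) (τ (Q G) v) :=
    (ContinuousLinearMap.adjoint_inner_left (τ (Q G)) (τ (Q G) v) v).symm
  rw [hs, hsa, real_inner_self_eq_norm_sq, e2, inner_add_right, real_inner_self_eq_norm_sq,
    real_inner_comm, inner_adjointL_left, real_inner_self_eq_norm_sq] at e1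
  exact e1.symm

/-- An isometric parametrisation of the space `{(-Gᵀs, s)}`. -/
lemma exists_contDiffAt_normal : ∃ S : (E →L[ℝ] E') → (E' →L[ℝ] E'), ContDiffAt ℝ 1 S 0 ∧ S 0 = 1 ∧
    ∀ᶠ G in 𝓝 (0 : E →L[ℝ] E'), ∀ t t', inner ℝ (S G t) (S G t') +
      inner ℝ (adjointL E E' G (S G t)) (adjointL E E' G (S G t')) = inner ℝ t t' := by
  obtain ⟨σ, hσ, hσ1, hσs, hσa⟩ := exists_contDiffAt_sqrt (E' →L[ℝ] E')
  -- Here S = (1 + GGᵀ)^(-1/2), so that ⟨St, St'⟩ + ⟨GᵀSt, GᵀSt'⟩ = ⟨St, (1 + GGᵀ)St'⟩ = ⟨t, t'⟩.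
  set P : (E →L[ℝ] E') → (E' →L[ℝ] E') := fun G => 1 + G ∘L adjointL E E' G with hP
  have hPc : ContDiff ℝ 1 P := by fun_prop
  have hP0 : P 0 = 1 := by simp [hP]
  have hPt : Tendsto P (𝓝 0) (𝓝 1) := by simpa only [hP0] using hPc.continuous.tendsto 0
  have hTc : ContDiffAt ℝ 1 (fun G => σ (P G)) 0 :=
    ContDiffAt.comp 0 (by rwa [hP0]) hPc.contDiffAt
  have hT0 : σ (P 0) = 1 := by rw [hP0, hσ1]
  refine ⟨fun G => Ring.inverse (σ (P G)), ?_, by simp only [hT0, Ring.inverse_one], ?_⟩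
  · refine ContDiffAt.comp (g := Ring.inverse) 0 ?_ hTc
    rw [hT0]
    exact contDiffAt_ringInverse ℝ (1 : (E' →L[ℝ] E')ˣ)
  have hunit : ∀ᶠ G in 𝓝 (0 : E →L[ℝ] E'), IsUnit (σ (P G)) := by
    have : {x : E' →L[ℝ] E' | IsUnit x} ∈ 𝓝 (σ (P 0)) :=
      Units.isOpen.mem_nhds (by rw [hT0]; exact isUnit_one)
    exact hTc.continuousAt.eventually this
  filter_upwards [hunit, hPt.eventually hσs, hPt.eventually hσa] with G hu hs ha t t'
  have e2 : ∀ v, P G v = v + G (adjointL E E' G v) := fun v => rfl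
  have hsa : star (σ (P G)) = σ (P G) := ha
    (ContinuousLinearMap.isSelfAdjoint_iff_isSymmetric.2 fun x y => by
      simp only [ContinuousLinearMap.coe_coe]
      rw [e2, e2, inner_add_left, inner_add_right, ← inner_adjointL_left G x,
        real_inner_comm y (G _), ← inner_adjointL_left G y,
        real_inner_comm (adjointL E E' G x)])
  set S := Ring.inverse (σ (P G)) with hS
  have hTS : ∀ t, σ (P G) (S t) = t := fun t => by
    have := Ring.mul_inverse_cancel _ hu
    exact congrArg (fun A : E' →L[ℝ] E' => A t) this
  have e1 : inner ℝ (S t) ((σ (P G) * σ (P G)) (S t'))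
      = inner ℝ (star (σ (P G)) (S t)) (σ (P G) (S t')) :=
    (ContinuousLinearMap.adjoint_inner_left (σ (P G)) (σ (P G) (S t')) (S t)).symm
  rw [hs, hsa, hTS, hTS, e2, inner_add_right, ← inner_adjointL_left G (S t)] at e1
  exact e1

end Adjoint

/-- Frames adapted to approximate graphs: the linear map `B p` sends the transversal space
conformally, with ratio `h p`, onto the orthogonal complement of the graph of the slope `p.1`, and
the height `h p` normalises the Riesz-type integral over this graph with the density `p.2`. -/
structure IsFrame (α c₀ δ M : ℝ) (h : Param d m → ℝ)
    (B : Param d m → EuclideanSpace ℝ (Fin m) →L[ℝ] Amb d m) : Prop where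
  pos : 0 < δ
  contDiffOn_h : ContDiffOn ℝ 1 h (ball (0, c₀) δ)
  contDiffOn_B : ContDiffOn ℝ 1 B (ball (0, c₀) δ)
  lip_h : ∀ p ∈ ball ((0, c₀) : Param d m) δ, ∀ q ∈ ball ((0, c₀) : Param d m) δ, |h p - h q| ≤ M * ‖p - q‖
  lip_B : ∀ p ∈ ball ((0, c₀) : Param d m) δ, ∀ q ∈ ball ((0, c₀) : Param d m) δ, ‖B p - B q‖ ≤ M * ‖p - q‖
  h_pos : ∀ p ∈ ball ((0, c₀) : Param d m) δ, 0 < h p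
  base : ∀ t, B (0, c₀) t = pt 0 (h (0, c₀) • t)
  orth : ∀ p ∈ ball ((0, c₀) : Param d m) δ, ∀ v t, inner ℝ (pt v (p.1 v)) (B p t) = 0
  conf : ∀ p ∈ ball ((0, c₀) : Param d m) δ, ∀ t t', inner ℝ (B p t) (B p t') = h p ^ 2 * inner ℝ t t'
  mass : ∀ p ∈ ball ((0, c₀) : Param d m) δ, p.2 * ∫ v : EuclideanSpace ℝ (Fin d),
    (‖v‖ ^ 2 + ‖p.1 v‖ ^ 2 + h p ^ 2) ^ (-(d + α) / 2) = 1

lemma exists_isFrame (d m : ℕ) {α c₀ : ℝ} (hα : 0 < α) (hc₀ : 0 < c₀) :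
    ∃ (δ M : ℝ) (h : Param d m → ℝ) (B : Param d m → EuclideanSpace ℝ (Fin m) →L[ℝ] Amb d m),
      IsFrame α c₀ δ M h B := by
  obtain ⟨S, hSc, hS0, hS⟩ :=
    exists_contDiffAt_normal (EuclideanSpace ℝ (Fin d)) (EuclideanSpace ℝ (Fin m))
  obtain ⟨R, hRc, hR0, hR⟩ :=
    exists_contDiffAt_factor (EuclideanSpace ℝ (Fin d)) (EuclideanSpace ℝ (Fin m))
  set p₀ : Param d m := (0, c₀) with hp₀
  have hfst : Tendsto (Prod.fst : Param d m → _) (𝓝 p₀) (𝓝 0) := continuous_fst.tendsto p₀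
  have hSc' : ContDiffAt ℝ 1 (fun p : Param d m => S p.1) p₀ :=
    ContDiffAt.comp p₀ hSc contDiffAt_fst
  have hRc' : ContDiffAt ℝ 1 (fun p : Param d m => R p.1) p₀ :=
    ContDiffAt.comp p₀ hRc contDiffAt_fst
  set D : Param d m → ℝ := fun p => LinearMap.det (R p.1 : EuclideanSpace ℝ (Fin d) →ₗ[ℝ] _) with hD
  have hdetc : ContDiffAt ℝ 1 D p₀ := contDiff_linearMap_det.contDiffAt.comp p₀ hRc'
  have hdet0 : D p₀ = 1 := by
    simp only [hD, hp₀]; rw [hR0]; exact LinearMap.det_id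
  have hdetp : ∀ᶠ p in 𝓝 p₀, 0 < D p :=
    hdetc.continuousAt.eventually (lt_mem_nhds (by rw [hdet0]; exact one_pos))
  have hκ := modelMass_pos (E := EuclideanSpace ℝ (Fin d)) hα
  set κ := modelMass (EuclideanSpace ℝ (Fin d)) α with hκd
  -- This solves λ κ h^(-α) / det R = 1, which is the mass condition once `integral_model` is
  -- inserted.
  set h : Param d m → ℝ := fun p => (p.2 * κ / D p) ^ (1 / α) with hh
  have hhc : ContDiffAt ℝ 1 h p₀ := by
    refine ContDiffAt.rpow_const_of_ne ?_ ?_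
    · exact (contDiffAt_snd.mul contDiffAt_const).div hdetc (by rw [hdet0]; exact one_ne_zero)
    · rw [hdet0]; positivity
  have hp2 : ∀ᶠ p : Param d m in 𝓝 p₀, 0 < p.2 :=
    continuous_snd.continuousAt.eventually (lt_mem_nhds hc₀)
  -- The vectors (-Gᵀs, s) are exactly those orthogonal to the graph of G; s = S t makes the
  -- parametrisation isometric, and h scales it.
  set B : Param d m → (EuclideanSpace ℝ (Fin m) →L[ℝ] Amb d m) := fun p =>
    h p • (inclT ∘L S p.1 - inclB ∘L adjointL _ _ p.1 ∘L S p.1) with hB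
  have hBc : ContDiffAt ℝ 1 B p₀ := by fun_prop
  have hBa : ∀ p t, B p t = pt (-(h p • adjointL _ _ p.1 (S p.1 t))) (h p • S p.1 t) := fun p t => by
    have : B p t = h p • (inclT (S p.1 t) - inclB (adjointL _ _ p.1 (S p.1 t))) := rfl
    rw [this, inclT_apply, inclB_apply, ← pt_sub, ← pt_smul]
    simp
  have key : ∀ᶠ p in 𝓝 p₀, 0 < h p ∧ (∀ v t, inner ℝ (pt v (p.1 v)) (B p t) = 0) ∧
      (∀ t t', inner ℝ (B p t) (B p t') = h p ^ 2 * inner ℝ t t') ∧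
      p.2 * ∫ v : EuclideanSpace ℝ (Fin d),
        (‖v‖ ^ 2 + ‖p.1 v‖ ^ 2 + h p ^ 2) ^ (-(d + α) / 2) = 1 := by
    filter_upwards [hdetp, hp2, hfst.eventually hS, hfst.eventually hR] with p hdp h2 hs hr
    have hhp : 0 < h p := by simp only [hh]; positivity
    refine ⟨hhp, fun v t => ?_, fun t t' => ?_, ?_⟩
    · rw [hBa, inner_pt, inner_neg_right, inner_smul_right, inner_smul_right,
        real_inner_comm, inner_adjointL_left, real_inner_comm]
      ring
    · rw [hBa, hBa, inner_pt, inner_neg_neg, inner_smul_left, inner_smul_right, inner_smul_left,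
        inner_smul_right, ← hs t t']
      simp only [conj_trivial]
      ring
    · simp only [← hr]
      have h5 := integral_model (α := α) (R := R p.1) hdp.ne' hhp
      rw [finrank_euclideanSpace_fin] at h5
      have h7 : |LinearMap.det (R p.1 : EuclideanSpace ℝ (Fin d) →ₗ[ℝ] _)| = D p := abs_of_pos hdp
      rw [h5, h7]
      have h6 : h p ^ (-α) = (p.2 * κ / D p)⁻¹ := by
        simp only [hh]
        rw [← Real.rpow_mul (by positivity), show 1 / α * -α = -1 by field_simp,
          Real.rpow_neg_one]
      rw [h6, ← hκd]
      field_simp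
  obtain ⟨K₁, s₁, hs₁, hL₁⟩ := hhc.exists_lipschitzOnWith
  obtain ⟨K₂, s₂, hs₂, hL₂⟩ := hBc.exists_lipschitzOnWith
  obtain ⟨u₁, hu₁, hcu₁⟩ := hhc.contDiffOn le_rfl (by simp)
  obtain ⟨u₂, hu₂, hcu₂⟩ := hBc.contDiffOn le_rfl (by simp)
  have hu₁' : u₁ ∈ 𝓝 p₀ := by simpa using hu₁
  have hu₂' : u₂ ∈ 𝓝 p₀ := by simpa using hu₂
  obtain ⟨δ, hδ, hball⟩ := Metric.mem_nhds_iff.1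
    (inter_mem (inter_mem hs₁ hs₂) (inter_mem (inter_mem hu₁' hu₂') key))
  refine ⟨δ, max K₁ K₂, h, B, ⟨hδ, hcu₁.mono fun p hp => (hball hp).2.1.1,
    hcu₂.mono fun p hp => (hball hp).2.1.2, fun p hp q hq => ?_, fun p hp q hq => ?_,
    fun p hp => (hball hp).2.2.1, fun t => ?_, fun p hp => (hball hp).2.2.2.1,
    fun p hp => (hball hp).2.2.2.2.1, fun p hp => (hball hp).2.2.2.2.2⟩⟩
  · rw [← Real.norm_eq_abs]
    refine (hL₁.norm_sub_le (hball hp).1.1 (hball hq).1.1).trans ?_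
    gcongr
    exact le_max_left _ _
  · refine (hL₂.norm_sub_le (hball hp).1.2 (hball hq).1.2).trans ?_
    gcongr
    exact le_max_right _ _
  · rw [hBa]
    simp [hS0]

end Frame

/-! ### The nonlocal oscillation and its Carleson bound. -/

section DistOsc

open Set Metric Filter Topology

/-- Logarithmic losses are paid by an arbitrarily small power of the decay. -/
lemma one_add_log_le {β y : ℝ} (hβ : 0 < β) (hy : 1 ≤ y) :
    1 + Real.log y ≤ (1 + β⁻¹) * y ^ β := by
  have h1 := Real.log_le_rpow_div (by linarith : 0 ≤ y) hβ
  have h2 : 1 ≤ y ^ β := Real.one_le_rpow hy hβ.le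
  rw [div_eq_mul_inv] at h1
  nlinarith

variable {E : Type*} [NormedAddCommGroup E] [InnerProductSpace ℝ E] [FiniteDimensional ℝ E]
  [MeasurableSpace E] [BorelSpace E]
  {V : Type*} [NormedAddCommGroup V] [NormedSpace ℝ V]
  [MeasurableSpace V] [BorelSpace V] [FiniteDimensional ℝ V]

/-- The displacements of the oscillations that control the smooth distance. -/
def node (i : Fin 6) (u : E) (τ θ : ℝ) : E :=
  -- Type 0 compares a function with its average at the displaced point. Types 1, 2, 3 are the legs
  -- (vertical, horizontal, vertical at x) of the path to τu used in the Taylor remainder; types 4,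
  -- 5, 3 are the legs of the path to u.
  ![u, τ • u, θ • τ • u, 0, u, θ • u] i

/-- The scales of the oscillations that control the smooth distance. -/
def scaleAt (i : Fin 6) (u : E) (θ : ℝ) : ℝ :=
  ![θ, (1 + ‖u‖) ^ θ, 1 + ‖u‖, (1 + ‖u‖) ^ θ, (1 + ‖u‖) ^ θ, 1 + ‖u‖] i

/-- A weight slightly larger than the Riesz-type kernel of order `finrank E + α`. -/
def weight (α : ℝ) (u : E) : ℝ := (1 + ‖u‖) ^ (-(Module.finrank ℝ E + α / 2))

/-- The space of parameters of the oscillations that control the smooth distance. -/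
def nodeMeasure (E : Type*) [NormedAddCommGroup E] [InnerProductSpace ℝ E] [FiniteDimensional ℝ E]
    [MeasurableSpace E] [BorelSpace E] : Measure (E × ℝ × ℝ) :=
  volume.prod ((volume.restrict (Icc 0 1)).prod (volume.restrict (Icc 0 1)))

instance : SFinite (nodeMeasure E) := by unfold nodeMeasure; infer_instance

/-- The weighted average of the oscillations at the nodes of one type. -/
def nodeTerm (α : ℝ) (f : E → V) (i : Fin 6) (x : E) (r : ℝ) : ℝ≥0∞ :=
  ∫⁻ ω, ENNReal.ofReal (weight α ω.1) *
    ENNReal.ofReal (osc f (x + r • node i ω.1 ω.2.1 ω.2.2) (scaleAt i ω.1 ω.2.2 * r)) ∂(nodeMeasure E)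

/-- The weighted average of oscillations that controls the smooth distance. -/
def distOsc (α : ℝ) (f : E → V) (x : E) (r : ℝ) : ℝ≥0∞ := ∑ i, nodeTerm α f i x r

/-- The average over the auxiliary parameters of the oscillation at a node. -/
def nodeOsc (f : E → V) (x : E) (r : ℝ) (i : Fin 6) (u : E) : ℝ≥0∞ :=
  ∫⁻ τ in Icc (0 : ℝ) 1, ∫⁻ θ in Icc (0 : ℝ) 1,
    ENNReal.ofReal (osc f (x + r • node i u τ θ) (scaleAt i u θ * r))

lemma measurable_node (i : Fin 6) :
    Measurable fun ω : E × ℝ × ℝ => node i ω.1 ω.2.1 ω.2.2 := by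
  fin_cases i <;> simp only [node] <;> simp <;> fun_prop

lemma measurable_scaleAt (i : Fin 6) :
    Measurable fun ω : E × ℝ × ℝ => scaleAt i ω.1 ω.2.2 := by
  fin_cases i <;> simp only [scaleAt] <;> simp <;> fun_prop

lemma measurable_weight (α : ℝ) : Measurable (weight α : E → ℝ) := by
  unfold weight; fun_prop

lemma weight_pos (α : ℝ) (u : E) : 0 < weight α u := by unfold weight; positivity

lemma integrable_weight {α : ℝ} (hα : 0 < α) : Integrable (weight α : E → ℝ) :=
  integrable_one_add_norm (by linarith)

/-- The endpoint θ = 0 is discarded because nodes of type 0 have scale θ, which must be positive. -/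
lemma ae_nodeMeasure : ∀ᵐ ω ∂(nodeMeasure E), ω.2.1 ∈ Icc (0 : ℝ) 1 ∧ ω.2.2 ∈ Ioc (0 : ℝ) 1 := by
  have h1 : ∀ᵐ τ ∂((volume : Measure ℝ).restrict (Icc 0 1)), τ ∈ Icc (0 : ℝ) 1 :=
    ae_restrict_mem measurableSet_Icc
  have h2 : ∀ᵐ τ ∂((volume : Measure ℝ).restrict (Icc 0 1)), τ ∈ Ioc (0 : ℝ) 1 := by
    rw [← restrict_Ioc_eq_restrict_Icc]
    exact ae_restrict_mem measurableSet_Ioc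
  have h3 : ∀ᵐ p ∂((volume : Measure ℝ).restrict (Icc 0 1)).prod (volume.restrict (Icc 0 1)),
      p.1 ∈ Icc (0 : ℝ) 1 ∧ p.2 ∈ Ioc (0 : ℝ) 1 :=
    (Measure.quasiMeasurePreserving_fst.ae h1).and (Measure.quasiMeasurePreserving_snd.ae h2)
  exact Measure.quasiMeasurePreserving_snd.ae h3

lemma scaleAt_pos (i : Fin 6) (u : E) {θ : ℝ} (hθ : 0 < θ) : 0 < scaleAt i u θ := by
  fin_cases i <;> simp [scaleAt] <;> positivity

lemma scaleAt_le (i : Fin 6) (u : E) {θ : ℝ} (hθ : θ ∈ Icc (0 : ℝ) 1) :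
    scaleAt i u θ ≤ 1 + ‖u‖ := by
  have h : (1 + ‖u‖) ^ θ ≤ 1 + ‖u‖ := by
    conv_rhs => rw [← Real.rpow_one (1 + ‖u‖)]
    exact Real.rpow_le_rpow_of_exponent_le (by linarith [norm_nonneg u]) hθ.2
  have h' := norm_nonneg u
  have h1 := hθ.2
  fin_cases i <;> simp [scaleAt] <;> linarith

lemma norm_node_le (i : Fin 6) (u : E) {τ θ : ℝ} (hτ : τ ∈ Icc (0 : ℝ) 1)
    (hθ : θ ∈ Icc (0 : ℝ) 1) : ‖node i u τ θ‖ ≤ ‖u‖ := by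
  have h : ∀ {c : ℝ} {v : E}, c ∈ Icc (0 : ℝ) 1 → ‖v‖ ≤ ‖u‖ → ‖c • v‖ ≤ ‖u‖ := by
    intro c v hc hv
    rw [norm_smul, Real.norm_of_nonneg hc.1]
    calc c * ‖v‖ ≤ 1 * ‖u‖ := by gcongr; exact hc.2
      _ = ‖u‖ := one_mul _
  fin_cases i <;> simp only [node]
  · exact le_rfl
  · exact h hτ le_rfl
  · exact h hθ (h hτ le_rfl)
  · simp
  · exact le_rfl
  · exact h hθ le_rfl

attribute [irreducible] node scaleAt

lemma measurable_osc_node {f : E → V} (hf : Measurable f) (i : Fin 6) :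
    Measurable fun z : (E × ℝ) × (E × ℝ × ℝ) =>
      ENNReal.ofReal (osc f (z.1.1 + z.1.2 • node i z.2.1 z.2.2.1 z.2.2.2)
        (scaleAt i z.2.1 z.2.2.2 * z.1.2)) := by
  refine ENNReal.measurable_ofReal.comp ((measurable_osc hf).comp (Measurable.prodMk ?_ ?_))
  · exact (measurable_fst.comp measurable_fst).add
      ((measurable_snd.comp measurable_fst).smul ((measurable_node i).comp measurable_snd))
  · exact ((measurable_scaleAt i).comp measurable_snd).mul (measurable_snd.comp measurable_fst)

lemma measurable_nodeTerm (α : ℝ) {f : E → V} (hf : Measurable f) (i : Fin 6) :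
    Measurable (Function.uncurry (nodeTerm α f i)) := by
  refine Measurable.lintegral_prod_right' (f := fun z : (E × ℝ) × (E × ℝ × ℝ) =>
    ENNReal.ofReal (weight α z.2.1) *
      ENNReal.ofReal (osc f (z.1.1 + z.1.2 • node i z.2.1 z.2.2.1 z.2.2.2)
        (scaleAt i z.2.1 z.2.2.2 * z.1.2))) ?_
  exact (((measurable_weight α).comp (measurable_fst.comp measurable_snd)).ennreal_ofReal).mul
    (measurable_osc_node hf i)

lemma measurable_distOsc (α : ℝ) {f : E → V} (hf : Measurable f) :
    Measurable (Function.uncurry (distOsc α f)) := by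
  unfold Function.uncurry distOsc
  exact Finset.measurable_fun_sum _ fun i _ => measurable_nodeTerm α hf i

lemma lintegral_nodeMeasure {g : E × ℝ × ℝ → ℝ≥0∞} (hg : Measurable g) :
    ∫⁻ ω, g ω ∂(nodeMeasure E)
      = ∫⁻ u, ∫⁻ τ in Icc (0 : ℝ) 1, ∫⁻ θ in Icc (0 : ℝ) 1, g (u, τ, θ) := by
  rw [nodeMeasure, lintegral_prod _ hg.aemeasurable]
  refine lintegral_congr fun u => ?_
  exact lintegral_prod (fun p : ℝ × ℝ => g (u, p))
    (hg.comp (measurable_const.prodMk measurable_id)).aemeasurable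

lemma lintegral_nodeMeasure_fst {g : E → ℝ≥0∞} (hg : Measurable g) :
    ∫⁻ ω, g ω.1 ∂(nodeMeasure E) = ∫⁻ u, g u := by
  rw [lintegral_nodeMeasure (g := fun ω => g ω.1) (hg.comp measurable_fst)]
  simp

lemma nodeTerm_eq (α : ℝ) {f : E → V} (hf : Measurable f) (i : Fin 6) (x : E) (r : ℝ) :
    nodeTerm α f i x r = ∫⁻ u, ENNReal.ofReal (weight α u) * nodeOsc f x r i u := by
  have hm : Measurable fun ω : E × ℝ × ℝ => ENNReal.ofReal
      (osc f (x + r • node i ω.1 ω.2.1 ω.2.2) (scaleAt i ω.1 ω.2.2 * r)) := by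
    have h : Measurable fun ω : E × ℝ × ℝ => (((x, r) : E × ℝ), ω) :=
      measurable_const.prodMk measurable_id
    have h2 := (measurable_osc_node hf i).comp h
    simpa only [Function.comp_def] using h2
  have hw : Measurable fun ω : E × ℝ × ℝ => ENNReal.ofReal (weight α ω.1) :=
    ((measurable_weight α).comp measurable_fst).ennreal_ofReal
  have hwm : Measurable fun ω : E × ℝ × ℝ => ENNReal.ofReal (weight α ω.1) * ENNReal.ofReal
      (osc f (x + r • node i ω.1 ω.2.1 ω.2.2) (scaleAt i ω.1 ω.2.2 * r)) := hw.mul hm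
  rw [nodeTerm, lintegral_nodeMeasure hwm]
  refine lintegral_congr fun u => ?_
  rw [nodeOsc, ← lintegral_const_mul' _ _ ENNReal.ofReal_ne_top]
  refine lintegral_congr fun τ => ?_
  rw [← lintegral_const_mul' _ _ ENNReal.ofReal_ne_top]

lemma distOsc_le {α : ℝ} {f : E → V} {N : ℝ} (hN : ∀ x r, osc f x r ≤ N) (x : E)
    (r : ℝ) :
    distOsc α f x r ≤ 6 * (∫⁻ u : E, ENNReal.ofReal (weight α u)) * ENNReal.ofReal N := by
  have h : ∀ i : Fin 6, nodeTerm α f i x r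
      ≤ (∫⁻ u : E, ENNReal.ofReal (weight α u)) * ENNReal.ofReal N := by
    intro i
    calc _ ≤ ∫⁻ ω, ENNReal.ofReal (weight α ω.1) * ENNReal.ofReal N ∂(nodeMeasure E) := by
          unfold nodeTerm; gcongr; exact hN _ _
      _ = _ := by
          rw [lintegral_mul_const' _ _ ENNReal.ofReal_ne_top,
            lintegral_nodeMeasure_fst (measurable_weight α).ennreal_ofReal]
  refine (Finset.sum_le_sum fun i _ => h i).trans (le_of_eq ?_)
  simp [mul_assoc]

/-- The weight exceeds the critical decay by α/2; half of that surplus absorbs the logarithm and the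
other half keeps integrability. -/
lemma lintegral_weight_mul_log_lt_top {α : ℝ} (hα : 0 < α) :
    ∫⁻ u : E, ENNReal.ofReal (weight α u) * ENNReal.ofReal (1 + Real.log (1 + ‖u‖)) < ⊤ := by
  have h : ∀ u : E, weight α u * (1 + Real.log (1 + ‖u‖))
      ≤ (1 + (α / 4)⁻¹) * (1 + ‖u‖) ^ (-(Module.finrank ℝ E + α / 4)) := fun u => by
    have h1 : 1 ≤ 1 + ‖u‖ := by linarith [norm_nonneg u]
    calc weight α u * (1 + Real.log (1 + ‖u‖))
        ≤ weight α u * ((1 + (α / 4)⁻¹) * (1 + ‖u‖) ^ (α / 4)) := by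
          have := weight_pos α u
          gcongr
          exact one_add_log_le (by positivity) h1
      _ = _ := by
          rw [weight, mul_left_comm, ← Real.rpow_add (by linarith)]
          congr 2
          ring
  have hi : Integrable fun u : E =>
      (1 + (α / 4)⁻¹) * (1 + ‖u‖) ^ (-(Module.finrank ℝ E + α / 4)) :=
    (integrable_one_add_norm (by linarith)).const_mul _
  refine lt_of_le_of_lt (lintegral_mono fun u => ?_) hi.lintegral_lt_top
  rw [← ENNReal.ofReal_mul (weight_pos α u).le]
  exact ENNReal.ofReal_le_ofReal (h u)

/-- Nodes over u are displaced by at most |u|, at scales at most 1 + |u|. Each type is thus a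
weighted average of displaced copies of `osc`, with logarithmic loss integrable against the weight.
The number of types enters through Cauchy–Schwarz. -/
lemma halfCarleson_distOsc {α : ℝ} (hα : 0 < α) (M : ℝ) :
    ∃ C : ℝ≥0∞, C ≠ ⊤ ∧ ∀ f : E → V, Measurable f → (∀ x, ‖f x‖ ≤ M) →
      HalfCarleson C fun x r => distOsc α f x r ^ 2 := by
  obtain ⟨C₀, hC₀, H⟩ := halfCarleson_osc (E := E) (V := V)
  set C₁ : ℝ≥0∞ := C₀ * ENNReal.ofReal M ^ 2 with hC₁
  set N : ℝ≥0∞ := ENNReal.ofReal (profMass E * M) with hN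
  set B : ℝ≥0∞ := 2 ^ Module.finrank ℝ E * C₁ + N ^ 2 * volume (ball (0 : E) 1) with hB
  have hBt : B ≠ ⊤ := by
    have : volume (ball (0 : E) 1) ≠ ⊤ := measure_ball_lt_top.ne
    finiteness
  set W : ℝ≥0∞ := ∫⁻ u : E, ENNReal.ofReal (weight α u) with hW
  have hWt : W ≠ ⊤ := (integrable_weight hα).lintegral_lt_top.ne
  set W' : ℝ≥0∞ := ∫⁻ u : E, ENNReal.ofReal (weight α u) * ENNReal.ofReal (1 + Real.log (1 + ‖u‖))
  have hWt' : W' ≠ ⊤ := (lintegral_weight_mul_log_lt_top hα).ne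
  refine ⟨6 * ∑ _i : Fin 6, W * (W' * B), by simp; finiteness, fun f hf hM => ?_⟩
  have hM0 : 0 ≤ M := (norm_nonneg _).trans (hM 0)
  have h1 := H f (ENNReal.ofReal M) ENNReal.ofReal_ne_top hf (fun x => by
    rw [← ofReal_norm]; exact ENNReal.ofReal_le_ofReal (hM x))
  have hQ : Measurable (Function.uncurry fun x r => ENNReal.ofReal (osc f x r)) :=
    ENNReal.measurable_ofReal.comp (measurable_osc hf)
  have hQM : ∀ x r, 0 < r → ENNReal.ofReal (osc f x r) ≤ N := fun x r _ =>
    ENNReal.ofReal_le_ofReal (osc_le hf hM 0 (by simpa using hM) x r)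
  have key : ∀ i : Fin 6, HalfCarleson (W * (W' * B)) fun x r =>
      nodeTerm α f i x r ^ 2 := by
    intro i
    have hA : ∀ ω : E × ℝ × ℝ, scaleAt i ω.1 ω.2.2
        ≤ 1 + (‖node i ω.1 ω.2.1 ω.2.2‖ + |scaleAt i ω.1 ω.2.2|) := fun ω => by
      linarith [le_abs_self (scaleAt i ω.1 ω.2.2), norm_nonneg (node i ω.1 ω.2.1 ω.2.2)]
    have hpos : ∀ᵐ ω ∂(nodeMeasure E), 0 < scaleAt i ω.1 ω.2.2 := by
      filter_upwards [ae_nodeMeasure (E := E)] with ω hω using scaleAt_pos i _ hω.2.1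
    have hwm' : Measurable fun ω : E × ℝ × ℝ => ENNReal.ofReal (weight α ω.1) :=
      ((measurable_weight α).comp measurable_fst).ennreal_ofReal
    have h3 := h1.sq_average (Q := fun x r => ENNReal.ofReal (osc f x r)) hQ hQM
      (μ := nodeMeasure E) (w := fun ω => ENNReal.ofReal (weight α ω.1))
      (A := fun ω => ‖node i ω.1 ω.2.1 ω.2.2‖ + |scaleAt i ω.1 ω.2.2|)
      (σ := fun ω => scaleAt i ω.1 ω.2.2) (v := fun ω => node i ω.1 ω.2.1 ω.2.2)
      hwm' (measurable_scaleAt i)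
      (measurable_node i) (fun ω => le_add_of_nonneg_right (abs_nonneg _)) hpos hA
    refine h3.mono ?_ (fun x r _ => le_rfl)
    · rw [lintegral_nodeMeasure_fst (measurable_weight α).ennreal_ofReal]
      gcongr
      have hwm : Measurable fun u : E =>
          ENNReal.ofReal (weight α u) * ENNReal.ofReal (1 + Real.log (1 + ‖u‖)) :=
        (measurable_weight α).ennreal_ofReal.mul (by fun_prop)
      rw [← lintegral_mul_const _ hwm, ← lintegral_nodeMeasure_fst (hwm.mul_const _)]
      refine lintegral_mono_ae ?_
      filter_upwards [ae_nodeMeasure (E := E)] with ω hω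
      have hθ : ω.2.2 ∈ Icc (0 : ℝ) 1 := ⟨hω.2.1.le, hω.2.2⟩
      have hu := norm_nonneg ω.1
      have hlog0 : 0 ≤ Real.log (1 + ‖ω.1‖) := Real.log_nonneg (by linarith)
      -- Displacement and scale together are at most 1 + 2|u|, so the argument is at most 2(1 +
      -- |u|), and log 2 < 1.
      have hlog : Real.log (1 + (‖node i ω.1 ω.2.1 ω.2.2‖ + |scaleAt i ω.1 ω.2.2|))
          ≤ 1 + Real.log (1 + ‖ω.1‖) := by
        have e1 := norm_node_le i ω.1 hω.1 hθ
        have e2 := scaleAt_le i ω.1 hθ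
        rw [abs_of_pos (scaleAt_pos i _ hω.2.1)]
        have e3 := scaleAt_pos i ω.1 hω.2.1
        have e4 := norm_nonneg (node i ω.1 ω.2.1 ω.2.2)
        calc _ ≤ Real.log (2 * (1 + ‖ω.1‖)) := Real.log_le_log (by linarith) (by linarith)
          _ = Real.log 2 + Real.log (1 + ‖ω.1‖) := Real.log_mul (by norm_num) (by linarith)
          _ ≤ _ := by linarith [Real.log_two_lt_d9]
      rw [mul_assoc (ENNReal.ofReal (weight α ω.1)), mul_comm _ B]
      refine mul_le_mul' le_rfl ?_
      rw [hB, add_mul]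
      have h1' : (1 : ℝ≥0∞) ≤ ENNReal.ofReal (1 + Real.log (1 + ‖ω.1‖)) := by
        rw [← ENNReal.ofReal_one]; exact ENNReal.ofReal_le_ofReal (by linarith)
      refine add_le_add (le_mul_of_one_le_right (by positivity) h1') ?_
      gcongr
  have hsum := (HalfCarleson.sum Finset.univ (fun i _ => key i) (fun i _ => ?_)).const_mul ?_ 6
  · refine hsum.mono le_rfl fun x r _ => ?_
    refine (sum_sq_le_card _ _).trans (le_of_eq ?_)
    simp
  · exact (measurable_nodeTerm α hf i).pow_const 2
  · unfold Function.uncurry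
    exact Finset.measurable_fun_sum _ fun i _ => (measurable_nodeTerm α hf i).pow_const 2

end DistOsc

/-! ### Pointwise errors of the flat model in terms of the nodes. -/

section RieszEstimate

open Set Metric Filter Topology

variable {E : Type*} [NormedAddCommGroup E] [InnerProductSpace ℝ E] [FiniteDimensional ℝ E]
  [MeasurableSpace E] [BorelSpace E]
  {V : Type*} [NormedAddCommGroup V] [InnerProductSpace ℝ V]
  [MeasurableSpace V] [BorelSpace V] [FiniteDimensional ℝ V]
  {W : Type*} [NormedAddCommGroup W] [NormedSpace ℝ W]
  [MeasurableSpace W] [BorelSpace W] [FiniteDimensional ℝ W]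

/-- Applied to the two projections, it lets the oscillation of the joint field of slope and density
dominate that of each component. -/
lemma osc_comp_le {V : Type*} [NormedAddCommGroup V] [NormedSpace ℝ V] [CompleteSpace V] {f : E → W} (hf : Measurable f) {M : ℝ} (hM : ∀ x, ‖f x‖ ≤ M)
    (ℓ : W →L[ℝ] V) (hℓ : ‖ℓ‖ ≤ 1) (x : E) (r : ℝ) : osc (fun y => ℓ (f y)) x r ≤ osc f x r := by
  refine Finset.sum_le_sum fun k _ => ?_
  rw [← map_avg (prof_isProfile k) hf hM ℓ]
  exact (ℓ.le_of_opNorm_le hℓ _).trans (one_mul _).le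

lemma measurable_nodeOsc {f : E → W} (hf : Measurable f) (x : E) (r : ℝ) (i : Fin 6) :
    Measurable (nodeOsc f x r i) := by
  have h : Measurable fun z : (E × ℝ) × ℝ => (((x, r) : E × ℝ), ((z.1.1, z.1.2, z.2) : E × ℝ × ℝ)) := by
    fun_prop
  have h2 := (measurable_osc_node hf i).comp h
  exact (h2.lintegral_prod_right').lintegral_prod_right'

lemma measurable_osc_node_snd {f : E → W} (hf : Measurable f) (x : E) (r : ℝ) (i : Fin 6) (u : E) :
    Measurable fun τ : ℝ => ∫⁻ θ in Icc (0 : ℝ) 1,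
      ENNReal.ofReal (osc f (x + r • node i u τ θ) (scaleAt i u θ * r)) := by
  have h : Measurable fun z : ℝ × ℝ => (((x, r) : E × ℝ), ((u, z.1, z.2) : E × ℝ × ℝ)) := by
    fun_prop
  have h2 := (measurable_osc_node hf i).comp h
  exact h2.lintegral_prod_right'

lemma distOsc_eq (α : ℝ) {f : E → W} (hf : Measurable f) (x : E) (r : ℝ) :
    distOsc α f x r = ∫⁻ u, ENNReal.ofReal (weight α u) * ∑ i, nodeOsc f x r i u := by
  simp only [Finset.mul_sum]
  have hm : ∀ i ∈ Finset.univ, Measurable fun u =>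
      ENNReal.ofReal (weight α u) * nodeOsc f x r i u := fun i _ =>
    (measurable_weight α).ennreal_ofReal.mul (measurable_nodeOsc hf x r i)
  rw [lintegral_finsetSum _ hm]
  exact Finset.sum_congr rfl fun i _ => nodeTerm_eq α hf i x r

lemma nodeOsc_zero (f : E → W) (x : E) (r : ℝ) (u : E) : nodeOsc f x r 0 u
    = ∫⁻ θ in Icc (0 : ℝ) 1, ENNReal.ofReal (osc f (x + r • u) (θ * r)) := by
  simp [nodeOsc, node, scaleAt]

lemma nodeOsc_three (f : E → W) (x : E) (r : ℝ) (u : E) : nodeOsc f x r 3 u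
    = ∫⁻ θ in Icc (0 : ℝ) 1, ENNReal.ofReal (osc f x ((1 + ‖u‖) ^ θ * r)) := by
  simp [nodeOsc, node, scaleAt]

lemma nodeOsc_four (f : E → W) (x : E) (r : ℝ) (u : E) : nodeOsc f x r 4 u
    = ∫⁻ θ in Icc (0 : ℝ) 1, ENNReal.ofReal (osc f (x + r • u) ((1 + ‖u‖) ^ θ * r)) := by
  simp [nodeOsc, node, scaleAt]

lemma nodeOsc_five (f : E → W) (x : E) (r : ℝ) (u : E) : nodeOsc f x r 5 u
    = ∫⁻ θ in Icc (0 : ℝ) 1, ENNReal.ofReal (osc f (x + r • θ • u) ((1 + ‖u‖) * r)) := by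
  simp [nodeOsc, node, scaleAt]

/-- The logarithmic loss between the averages at two points. -/
def logLoss (u : E) : ℝ := (Module.finrank ℝ E + 1) * (1 + Real.log (1 + ‖u‖))

lemma one_le_logLoss (u : E) : 1 ≤ logLoss u := by
  have := Real.log_nonneg (by linarith [norm_nonneg u] : (1 : ℝ) ≤ 1 + ‖u‖)
  have h2 : (0 : ℝ) ≤ Module.finrank ℝ E := by positivity
  unfold logLoss
  nlinarith

/-- The three legs of the path from x to x + ru are the nodes of types 4, 5 and 3; the other types
are only added to obtain one common sum. -/
lemma enorm_avg_sub_le_nodeOsc {V : Type*} [NormedAddCommGroup V] [NormedSpace ℝ V]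
    [MeasurableSpace V] [BorelSpace V] [FiniteDimensional ℝ V]
    {g : E → V} (hg : Measurable g) {M : ℝ} (hM : ∀ x, ‖g x‖ ≤ M)
    {f : E → W} (hgf : ∀ x r, osc g x r ≤ osc f x r) (x : E) {r : ℝ} (hr : 0 < r) (u : E) :
    ‖avg bump g (x + r • u) r - avg bump g x r‖ₑ
      ≤ ENNReal.ofReal (logLoss u) * ∑ i, nodeOsc f x r i u := by
  refine (enorm_avg_bump_sub_shift_le hg hM x hr le_rfl).trans ?_
  rw [← logLoss]
  refine mul_le_mul' le_rfl ?_
  have h : nodeOsc f x r 4 u + nodeOsc f x r 5 u + nodeOsc f x r 3 u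
      ≤ ∑ i, nodeOsc f x r i u := by
    rw [Fin.sum_univ_six]
    generalize nodeOsc f x r 0 u = a0
    generalize nodeOsc f x r 1 u = a1
    generalize nodeOsc f x r 2 u = a2
    calc _ ≤ (nodeOsc f x r 4 u + nodeOsc f x r 5 u + nodeOsc f x r 3 u) + (a0 + a1 + a2) :=
          le_self_add
      _ = _ := by ring
  refine le_trans ?_ h
  rw [nodeOsc_three, nodeOsc_four, nodeOsc_five]
  gcongr <;> exact hgf _ _

/-- Two errors add up: F against its own average at x + ru (type 0), and the first order Taylor
remainder of the averages, whose slope variation is followed along paths to τu (types 1, 2, 3). -/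
lemma enorm_sub_affine_le_nodeOsc {F : E → V} {K : ℝ≥0} (hF : LipschitzWith K F)
    {f : E → W} (hf : Measurable f) (hgf : ∀ x r, osc (fderiv ℝ F) x r ≤ osc f x r)
    (x : E) {r : ℝ} (hr : 0 < r) (u : E) :
    ‖F (x + r • u) - avg bump F x r - r • avg bump (fderiv ℝ F) x r u‖ₑ
      ≤ ENNReal.ofReal (r * ((1 + ‖u‖) * logLoss u)) * ∑ i, nodeOsc f x r i u := by
  have hL := one_le_logLoss u
  have hu := norm_nonneg u
  set Y := nodeOsc f x r with hY
  have h1 : ‖F (x + r • u) - avg bump F (x + r • u) r‖ₑ ≤ ENNReal.ofReal r * Y 0 u := by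
    refine (enorm_sub_avg_lipschitz_le hF (x + r • u) hr).trans ?_
    rw [hY, nodeOsc_zero]
    gcongr
    exact hgf _ _
  have hDm : Measurable (fderiv ℝ F) := measurable_fderiv ℝ F
  have h2 : ∀ τ ∈ Icc (0 : ℝ) 1,
      ‖avg bump (fderiv ℝ F) (x + r • τ • u) r - avg bump (fderiv ℝ F) x r‖ₑ
      ≤ ENNReal.ofReal (logLoss u) * ((∫⁻ θ in Icc (0 : ℝ) 1,
          ENNReal.ofReal (osc f (x + r • node 1 u τ θ) (scaleAt 1 u θ * r)))
        + (∫⁻ θ in Icc (0 : ℝ) 1,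
          ENNReal.ofReal (osc f (x + r • node 2 u τ θ) (scaleAt 2 u θ * r)))
        + ∫⁻ θ in Icc (0 : ℝ) 1,
          ENNReal.ofReal (osc f (x + r • node 3 u τ θ) (scaleAt 3 u θ * r))) := by
    intro τ hτ
    have hv : ‖τ • u‖ ≤ ‖u‖ := by
      rw [norm_smul, Real.norm_of_nonneg hτ.1]
      exact mul_le_of_le_one_left hu hτ.2
    refine (enorm_avg_bump_sub_shift_le hDm (M := K)
      (fun y => norm_fderiv_le_of_lipschitz ℝ hF) x hr hv).trans ?_
    rw [← logLoss]
    refine mul_le_mul' le_rfl ?_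
    have e1 : ∀ θ, node 1 u τ θ = τ • u := fun θ => by simp [node]
    have e2 : ∀ θ, node 2 u τ θ = θ • τ • u := fun θ => by simp [node]
    have e3 : ∀ θ, node 3 u τ θ = 0 := fun θ => by simp [node]
    have s1 : ∀ θ, scaleAt 1 u θ = (1 + ‖u‖) ^ θ := fun θ => by simp [scaleAt]
    have s2 : ∀ θ, scaleAt 2 u θ = 1 + ‖u‖ := fun θ => by simp [scaleAt]
    have s3 : ∀ θ, scaleAt 3 u θ = (1 + ‖u‖) ^ θ := fun θ => by simp [scaleAt]
    simp only [e1, e2, e3, s1, s2, s3, smul_zero, add_zero]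
    gcongr <;> exact hgf _ _
  have h3 : ‖avg bump F (x + r • u) r - avg bump F x r - r • avg bump (fderiv ℝ F) x r u‖ₑ
      ≤ ENNReal.ofReal (r * ‖u‖) * (ENNReal.ofReal (logLoss u) * (Y 1 u + Y 2 u + Y 3 u)) := by
    refine (enorm_avg_lipschitz_sub_le hF x u hr).trans ?_
    refine mul_le_mul' le_rfl ((setLIntegral_mono' measurableSet_Icc h2).trans (le_of_eq ?_))
    rw [lintegral_const_mul' _ _ ENNReal.ofReal_ne_top, lintegral_add_right _
      (measurable_osc_node_snd hf x r 3 u), lintegral_add_right _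
      (measurable_osc_node_snd hf x r 2 u)]
    rfl
  have h4 : F (x + r • u) - avg bump F x r - r • avg bump (fderiv ℝ F) x r u
      = (F (x + r • u) - avg bump F (x + r • u) r)
        + (avg bump F (x + r • u) r - avg bump F x r - r • avg bump (fderiv ℝ F) x r u) := by abel
  rw [h4]
  refine (enorm_add_le _ _).trans ((add_le_add h1 h3).trans ?_)
  rw [← mul_assoc, ← ENNReal.ofReal_mul (by positivity)]
  have h5 : ENNReal.ofReal r ≤ ENNReal.ofReal (r * ((1 + ‖u‖) * logLoss u)) := by
    refine ENNReal.ofReal_le_ofReal (le_mul_of_one_le_right hr.le ?_)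
    nlinarith
  have h6 : ENNReal.ofReal (r * ‖u‖ * logLoss u)
      ≤ ENNReal.ofReal (r * ((1 + ‖u‖) * logLoss u)) := by
    refine ENNReal.ofReal_le_ofReal ?_
    nlinarith [mul_pos hr (by linarith : 0 < logLoss u)]
  set c := ENNReal.ofReal (r * ((1 + ‖u‖) * logLoss u))
  calc _ ≤ c * Y 0 u + c * (Y 1 u + Y 2 u + Y 3 u) := by gcongr
    _ = c * (Y 0 u + (Y 1 u + Y 2 u + Y 3 u)) := (mul_add _ _ _).symm
    _ ≤ c * (Y 0 u + (Y 1 u + Y 2 u + Y 3 u)) + c * (Y 4 u + Y 5 u) := le_self_add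
    _ = _ := by rw [← mul_add, Fin.sum_univ_six]; congr 1; ring

end RieszEstimate

/-! ### Comparison of the Riesz-type integral with its flat model. -/

section RieszKernel

open Set Metric Filter Topology

variable {E : Type*} [NormedAddCommGroup E] [InnerProductSpace ℝ E] [FiniteDimensional ℝ E]
  [MeasurableSpace E] [BorelSpace E]
  {V : Type*} [NormedAddCommGroup V] [InnerProductSpace ℝ V]
  [MeasurableSpace V] [BorelSpace V] [FiniteDimensional ℝ V]
  {W : Type*} [NormedAddCommGroup W] [NormedSpace ℝ W]
  [MeasurableSpace W] [BorelSpace W] [FiniteDimensional ℝ W]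

/-- The squared distance from a point at height `h` to the graph of a linear map. -/
def graphSq (G : E →L[ℝ] V) (h : ℝ) (u : E) : ℝ := ‖u‖ ^ 2 + ‖G u‖ ^ 2 + h ^ 2

/-- Uniformly in the slope, a point at height bounded below lies at distance at least c(1 + |u|)
from the model graph. -/
lemma le_graphSq {c : ℝ} (hc : 0 < c) (hc1 : 2 * c ≤ 1) (G : E →L[ℝ] V) {h : ℝ} (hh : 2 * c ≤ h)
    (u : E) : (c * (1 + ‖u‖)) ^ 2 ≤ graphSq G h u := by
  have h1 : (2 * c) ^ 2 ≤ h ^ 2 := by gcongr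
  have h2 : (2 * c) ^ 2 ≤ 1 := by
    calc (2 * c) ^ 2 ≤ 1 ^ 2 := by gcongr
      _ = 1 := one_pow 2
  unfold graphSq
  nlinarith [sq_nonneg (‖u‖ - 1), sq_nonneg ‖u‖, sq_nonneg ‖G u‖, sq_nonneg c,
    mul_nonneg (sq_nonneg c) (sq_nonneg (‖u‖ - 1)), mul_le_mul_of_nonneg_right h2 (sq_nonneg ‖u‖)]

lemma graphSq_pos {c : ℝ} (hc : 0 < c) (G : E →L[ℝ] V) {h : ℝ} (hh : 2 * c ≤ h) (u : E) :
    0 < graphSq G h u := by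
  have : 0 < h := by linarith
  unfold graphSq
  positivity

lemma sq_rpow_neg_div {y : ℝ} (hy : 0 ≤ y) (s : ℝ) : (y ^ 2) ^ (-s / 2) = y ^ (-s) := by
  rw [← Real.rpow_natCast, ← Real.rpow_mul hy]
  congr 1
  push_cast
  ring

lemma sqrt_rpow_neg {q : ℝ} (hq : 0 ≤ q) (s : ℝ) : √q ^ (-s) = q ^ (-s / 2) := by
  rw [← sq_rpow_neg_div (Real.sqrt_nonneg q), Real.sq_sqrt hq]

lemma graphSq_rpow_le {c : ℝ} (hc : 0 < c) (hc1 : 2 * c ≤ 1) (G : E →L[ℝ] V) {h : ℝ}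
    (hh : 2 * c ≤ h) {s : ℝ} (hs : 0 ≤ s) (u : E) :
    graphSq G h u ^ (-s / 2) ≤ c ^ (-s) * (1 + ‖u‖) ^ (-s) := by
  rw [← Real.mul_rpow hc.le (by positivity), ← sq_rpow_neg_div (by positivity)]
  exact Real.rpow_le_rpow_of_nonpos (by positivity) (le_graphSq hc hc1 G hh u) (by linarith)

lemma contDiff_graphSq_rpow {c : ℝ} (hc : 0 < c) (G : E →L[ℝ] V) {h : ℝ}
    (hh : 2 * c ≤ h) (p : ℝ) : ContDiff ℝ 1 fun u => graphSq G h u ^ p := by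
  have h1 : ContDiff ℝ 1 (graphSq G h) := by
    unfold graphSq
    exact ((contDiff_norm_sq ℝ).add (G.contDiff.norm_sq ℝ)).add contDiff_const
  exact h1.rpow_const_of_ne fun u => (graphSq_pos hc G hh u).ne'

/-- Differentiation lowers the exponent by 2 and brings out a factor |u|, so the gradient decays at
least as fast as the kernel. -/
lemma norm_fderiv_graphSq_rpow_le {c : ℝ} (hc : 0 < c) (hc1 : 2 * c ≤ 1) {G : E →L[ℝ] V}
    (hG : ‖G‖ ≤ 1) {h : ℝ} (hh : 2 * c ≤ h) {s : ℝ} (hs : 0 ≤ s) (u : E) :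
    ‖fderiv ℝ (fun u => graphSq G h u ^ (-s / 2)) u‖
      ≤ 2 * s * c ^ (-(s + 2)) * (1 + ‖u‖) ^ (-s) := by
  have hd : HasFDerivAt (graphSq G h)
      (2 • innerSL ℝ u + 2 • (innerSL ℝ (G u)).comp G) u := by
    unfold graphSq
    exact ((hasStrictFDerivAt_norm_sq u).hasFDerivAt.add (G.hasFDerivAt.norm_sq)).add_const _
  have hd2 := hd.rpow_const (p := -s / 2) (Or.inl (graphSq_pos hc G hh u).ne')
  rw [hd2.fderiv, norm_smul]
  have hu := norm_nonneg u
  have h1 : ‖(2 • innerSL ℝ u + 2 • (innerSL ℝ (G u)).comp G : E →L[ℝ] ℝ)‖ ≤ 4 * ‖u‖ := by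
    have e1 : ‖(innerSL ℝ (G u)).comp G‖ ≤ ‖u‖ := by
      refine (ContinuousLinearMap.opNorm_comp_le _ _).trans ?_
      rw [innerSL_apply_norm]
      calc ‖G u‖ * ‖G‖ ≤ (1 * ‖u‖) * 1 := by
            gcongr; exact G.le_of_opNorm_le hG u
        _ = ‖u‖ := by ring
    refine (norm_add_le _ _).trans ?_
    rw [two_nsmul, two_nsmul]
    have e2 := norm_add_le (innerSL ℝ u) (innerSL ℝ u)
    have e3 := norm_add_le ((innerSL ℝ (G u)).comp G) ((innerSL ℝ (G u)).comp G)
    rw [innerSL_apply_norm] at e2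
    linarith
  have h2 : ‖-s / 2 * graphSq G h u ^ (-s / 2 - 1)‖
      ≤ s / 2 * (c ^ (-(s + 2)) * (1 + ‖u‖) ^ (-(s + 2))) := by
    have hp := graphSq_pos hc G hh u
    rw [norm_mul, Real.norm_of_nonneg (Real.rpow_nonneg hp.le _), neg_div, norm_neg,
      Real.norm_of_nonneg (by positivity), show -(s / 2) - 1 = -(s + 2) / 2 by ring]
    gcongr
    exact graphSq_rpow_le hc hc1 G hh (by linarith) u
  have h3 : (1 + ‖u‖) ^ (-(s + 2)) * ‖u‖ ≤ (1 + ‖u‖) ^ (-s) := by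
    have e1 : (1 + ‖u‖) ^ (-(s + 2)) * (1 + ‖u‖) = (1 + ‖u‖) ^ (-(s + 1)) := by
      rw [← Real.rpow_add_one (by positivity)]
      congr 1
      ring
    calc _ ≤ (1 + ‖u‖) ^ (-(s + 2)) * (1 + ‖u‖) := by gcongr; linarith
      _ = _ := e1
      _ ≤ _ := Real.rpow_le_rpow_of_exponent_le (by linarith) (by linarith)
  calc _ ≤ (s / 2 * (c ^ (-(s + 2)) * (1 + ‖u‖) ^ (-(s + 2)))) * (4 * ‖u‖) := by gcongr
    _ = 2 * s * c ^ (-(s + 2)) * ((1 + ‖u‖) ^ (-(s + 2)) * ‖u‖) := by ring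
    _ ≤ _ := by gcongr

lemma abs_rpow_neg_sub_le {b s y z : ℝ} (hb : 0 < b) (hs : 0 ≤ s) (hy : b ≤ y) (hz : b ≤ z) :
    |y ^ (-s) - z ^ (-s)| ≤ s * b ^ (-s - 1) * |y - z| := by
  have h := (convex_Ici b).norm_image_sub_le_of_norm_hasDerivWithin_le
    (f := fun y : ℝ => y ^ (-s)) (f' := fun y => -s * y ^ (-s - 1)) (C := s * b ^ (-s - 1))
    (fun w hw => (Real.hasDerivAt_rpow_const (Or.inl (hb.trans_le hw).ne')).hasDerivWithinAt)
    (fun w hw => by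
      have hw0 : 0 < w := hb.trans_le hw
      rw [norm_mul, norm_neg, Real.norm_of_nonneg hs, Real.norm_of_nonneg (by positivity)]
      refine mul_le_mul_of_nonneg_left ?_ hs
      exact Real.rpow_le_rpow_of_nonpos hb (show b ≤ w from hw) (by linarith : -s - 1 ≤ 0)) hz hy
  simpa [Real.norm_eq_abs] using h

/-- Of the surplus decay α of the kernel, half is spent on the logarithm and half remains in the
weight. -/
lemma rpow_mul_logLoss_le {α : ℝ} (hα : 0 < α) (u : E) :
    (1 + ‖u‖) ^ (-(Module.finrank ℝ E + α)) * logLoss u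
      ≤ (Module.finrank ℝ E + 1) * (1 + (α / 2)⁻¹) * weight α u := by
  have h1 : 1 ≤ 1 + ‖u‖ := by linarith [norm_nonneg u]
  unfold logLoss weight
  calc _ ≤ (1 + ‖u‖) ^ (-(Module.finrank ℝ E + α)) *
        ((Module.finrank ℝ E + 1) * ((1 + (α / 2)⁻¹) * (1 + ‖u‖) ^ (α / 2))) := by
        gcongr; exact one_add_log_le (by positivity) h1
    _ = (Module.finrank ℝ E + 1) * (1 + (α / 2)⁻¹) *
        ((1 + ‖u‖) ^ (-(Module.finrank ℝ E + α)) * (1 + ‖u‖) ^ (α / 2)) := by ring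
    _ = _ := by
        rw [← Real.rpow_add (by linarith)]
        congr 2
        ring

lemma rpow_le_weight {α : ℝ} (hα : 0 < α) (u : E) :
    (1 + ‖u‖) ^ (-(Module.finrank ℝ E + α))
      ≤ (Module.finrank ℝ E + 1) * (1 + (α / 2)⁻¹) * weight α u :=
  (le_mul_of_one_le_right (by positivity) (one_le_logLoss u)).trans (rpow_mul_logLoss_le hα u)

/-- The Riesz-type integral over a Lipschitz graph, compared with the integral over the
approximating plane. -/
lemma exists_riesz_estimate {α c MJ : ℝ} (hα : 0 < α) (hc : 0 < c) (hc1 : 2 * c ≤ 1)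
    (hMJ : 0 ≤ MJ) :
    ∃ C : ℝ, 0 ≤ C ∧ ∀ {F : E → V} {K : ℝ≥0}, LipschitzWith K F → (K : ℝ) ≤ c / 4 →
      ∀ {J : E → ℝ}, Measurable J → (∀ x, ‖J x‖ ≤ MJ) → ∀ {f : E → W}, Measurable f →
      (∀ x r, osc (fderiv ℝ F) x r ≤ osc f x r) → (∀ x r, osc J x r ≤ osc f x r) →
      ∀ (x : E) {r h : ℝ}, 0 < r → 2 * c ≤ h → ∀ {n : E → ℝ}, Measurable n →
      (∀ u, |n u - √(graphSq (avg bump (fderiv ℝ F) x r) h u)|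
        ≤ r⁻¹ * ‖F (x + r • u) - avg bump F x r - r • avg bump (fderiv ℝ F) x r u‖) →
      ‖(∫ u, J (x + r • u) * n u ^ (-(Module.finrank ℝ E + α))) - avg bump J x r *
          ∫ u, graphSq (avg bump (fderiv ℝ F) x r) h u ^ (-(Module.finrank ℝ E + α) / 2)‖ₑ
        ≤ ENNReal.ofReal C * distOsc α f x r := by
  set s : ℝ := Module.finrank ℝ E + α with hs
  have hs0 : 0 ≤ s := by positivity
  set CL : ℝ := (Module.finrank ℝ E + 1) * (1 + (α / 2)⁻¹) with hCL
  have hCL0 : 0 ≤ CL := by positivity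
  -- One constant for each term of `hsplit`: replacing the true distance by the model one, replacing
  -- J by its mollification, and freezing that mollification at x.
  set C₁ : ℝ := MJ * (s * (c / 2) ^ (-s - 1)) * CL with hC₁
  set C₂ : ℝ := 2 * s * c ^ (-(s + 2)) * CL with hC₂
  set C₃ : ℝ := c ^ (-s) * CL with hC₃
  refine ⟨C₁ + C₂ + C₃, by positivity, ?_⟩
  intro F K hF hK J hJ hJM f hf hDF hJf x r h hr hh n hn hna
  set G := avg bump (fderiv ℝ F) x r with hG
  set k : E → ℝ := fun u => graphSq G h u ^ (-s / 2) with hk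
  have hGK : ‖G‖ ≤ K := by
    have := norm_avg_bump_sub_le (measurable_fderiv ℝ F) (M := K)
      (fun y => norm_fderiv_le_of_lipschitz ℝ hF) 0 (δ := K)
      (fun y => by rw [sub_zero]; exact norm_fderiv_le_of_lipschitz ℝ hF) x r
    rwa [sub_zero] at this
  have hG1 : ‖G‖ ≤ 1 := by linarith
  have hk0 : ∀ u, 0 ≤ k u := fun u => Real.rpow_nonneg (graphSq_pos hc G hh u).le _
  have hkle : ∀ u, k u ≤ c ^ (-s) * (1 + ‖u‖) ^ (-s) := fun u =>
    graphSq_rpow_le hc hc1 G hh hs0 u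
  have hjap : Integrable fun u : E => (1 + ‖u‖) ^ (-s) := integrable_one_add_norm (by linarith)
  have hkc : ContDiff ℝ 1 k := contDiff_graphSq_rpow hc G hh _
  have hki : Integrable k := (hjap.const_mul (c ^ (-s))).mono'
    hkc.continuous.aestronglyMeasurable (.of_forall fun u => by
      rw [Real.norm_of_nonneg (hk0 u)]; exact hkle u)
  have hkd : ∀ u, ‖fderiv ℝ k u‖ ≤ 2 * s * c ^ (-(s + 2)) * (1 + ‖u‖) ^ (-s) := fun u =>
    norm_fderiv_graphSq_rpow_le hc hc1 hG1 hh hs0 u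
  have hkdi : Integrable (fderiv ℝ k) := (hjap.const_mul (2 * s * c ^ (-(s + 2)))).mono'
    (hkc.continuous_fderiv one_ne_zero).aestronglyMeasurable (.of_forall hkd)
  -- the perturbed distance
  set e : E → V := fun u => F (x + r • u) - avg bump F x r - r • G u with he
  have hele : ∀ u, r⁻¹ * ‖e u‖ ≤ 2 * K * (1 + ‖u‖) := by
    intro u
    have h1 := lipschitzWith_avg hF (x + r • u, 0) (x, r)
    simp only [avg_bump_zero, add_sub_cancel_left, zero_sub, abs_neg, abs_of_pos hr, norm_smul,
      Real.norm_of_nonneg hr.le] at h1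
    have h2 : ‖r • G u‖ ≤ r * (K * ‖u‖) := by
      rw [norm_smul, Real.norm_of_nonneg hr.le]
      gcongr
      exact G.le_of_opNorm_le hGK u
    have h3 : ‖e u‖ ≤ r * (2 * K * (1 + ‖u‖)) := by
      have h4 : (0 : ℝ) ≤ r * K := by positivity
      refine (norm_sub_le _ _).trans ((add_le_add h1 h2).trans ?_)
      nlinarith
    rw [inv_mul_le_iff₀ hr]
    exact h3
  have hn0 : ∀ u, c * (1 + ‖u‖) ≤ √(graphSq G h u) := fun u =>
    Real.le_sqrt_of_sq_le (le_graphSq hc hc1 G hh u)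
  have hb : ∀ u : E, 0 < c / 2 * (1 + ‖u‖) := fun u => by positivity
  -- This is where K ≤ c/4 enters: the distance is perturbed by at most 2K(1 + |u|), half of the
  -- lower bound for the model.
  have hnl : ∀ u, c / 2 * (1 + ‖u‖) ≤ n u := fun u => by
    have h1 := (abs_le.1 ((hna u).trans (hele u))).1
    have h2 := hn0 u
    have h3 : 2 * (K : ℝ) * (1 + ‖u‖) ≤ 2 * (c / 4) * (1 + ‖u‖) := by gcongr
    linarith
  have hn0' : ∀ u, c / 2 * (1 + ‖u‖) ≤ √(graphSq G h u) := fun u =>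
    le_trans (by have := norm_nonneg u; gcongr; linarith) (hn0 u)
  have hnr : ∀ u, n u ^ (-s) ≤ (c / 2) ^ (-s) * (1 + ‖u‖) ^ (-s) := fun u => by
    rw [← Real.mul_rpow (by positivity) (by positivity)]
    exact Real.rpow_le_rpow_of_nonpos (hb u) (hnl u) (by linarith)
  have hn00 : ∀ u, 0 ≤ n u ^ (-s) := fun u => Real.rpow_nonneg ((hb u).le.trans (hnl u)) _
  have hJx : Measurable fun u => J (x + r • u) := hJ.comp (by fun_prop)
  have hni : Integrable fun u => n u ^ (-s) := (hjap.const_mul ((c / 2) ^ (-s))).mono'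
    (hn.pow_const _).aestronglyMeasurable (.of_forall fun u => by
      rw [Real.norm_of_nonneg (hn00 u)]; exact hnr u)
  have hi1 : Integrable fun u => J (x + r • u) * n u ^ (-s) :=
    hni.bdd_mul (c := MJ) hJx.aestronglyMeasurable (.of_forall fun u => hJM _)
  have hi2 : Integrable fun u => J (x + r • u) * k u :=
    hki.bdd_mul (c := MJ) hJx.aestronglyMeasurable (.of_forall fun u => hJM _)
  set Jr : E → ℝ := fun y => avg bump J y r with hJr
  have hJrm : Measurable Jr := by
    have := (measurable_uncurry_avg bump_isProfile.contDiff.continuous.measurable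
      hJ.stronglyMeasurable).measurable
    exact this.comp (measurable_id.prodMk measurable_const)
  have hJrM : ∀ y, ‖Jr y‖ ≤ MJ := fun y => by
    have := norm_avg_bump_sub_le hJ hJM 0 (δ := MJ) (fun y => by rw [sub_zero]; exact hJM y) y r
    rwa [sub_zero] at this
  have hi3 : Integrable fun u => Jr (x + r • u) * k u :=
    hki.bdd_mul (c := MJ) (hJrm.comp (by fun_prop)).aestronglyMeasurable
      (.of_forall fun u => hJrM _)
  have hsplit : (∫ u, J (x + r • u) * n u ^ (-s)) - avg bump J x r * ∫ u, k u
      = (∫ u, J (x + r • u) * (n u ^ (-s) - k u))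
        + (∫ u, k u * (J (x + r • u) - Jr (x + r • u)))
        + ∫ u, k u * (Jr (x + r • u) - Jr x) := by
    have e1 : ∫ u, J (x + r • u) * (n u ^ (-s) - k u)
        = (∫ u, J (x + r • u) * n u ^ (-s)) - ∫ u, J (x + r • u) * k u := by
      rw [← integral_sub hi1 hi2]; simp only [mul_sub]
    have e2 : ∫ u, k u * (J (x + r • u) - Jr (x + r • u))
        = (∫ u, J (x + r • u) * k u) - ∫ u, Jr (x + r • u) * k u := by
      rw [← integral_sub hi2 hi3]; congr 1; ext u; ring
    have e3 : ∫ u, k u * (Jr (x + r • u) - Jr x)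
        = (∫ u, Jr (x + r • u) * k u) - avg bump J x r * ∫ u, k u := by
      rw [← integral_const_mul, ← integral_sub hi3 (hki.const_mul _)]; congr 1; ext u
      simp only [hJr]; ring
    rw [e1, e2, e3]; ring
  set Y : E → ℝ≥0∞ := fun u => ∑ i, nodeOsc f x r i u with hY
  have hfin : ∀ (D : ℝ), 0 ≤ D →
      ∫⁻ u, ENNReal.ofReal (D * weight α u) * Y u = ENNReal.ofReal D * distOsc α f x r := by
    intro D hD
    rw [distOsc_eq α hf, ← lintegral_const_mul' _ _ ENNReal.ofReal_ne_top]
    refine lintegral_congr fun u => ?_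
    rw [ENNReal.ofReal_mul hD, mul_assoc]
  -- The mean value theorem gains one power of (1 + |u|), exactly what the affine approximation of F
  -- loses.
  have hT1 : ‖∫ u, J (x + r • u) * (n u ^ (-s) - k u)‖ₑ ≤ ENNReal.ofReal C₁ * distOsc α f x r := by
    rw [← hfin C₁ (by positivity)]
    refine (enorm_integral_le_lintegral_enorm _).trans (lintegral_mono fun u => ?_)
    have h1 : ‖J (x + r • u) * (n u ^ (-s) - k u)‖
        ≤ MJ * (s * (c / 2) ^ (-s - 1) * (1 + ‖u‖) ^ (-s - 1)) * r⁻¹ * ‖e u‖ := by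
      have e1 : k u = √(graphSq G h u) ^ (-s) := (sqrt_rpow_neg (graphSq_pos hc G hh u).le s).symm
      have e2 := abs_rpow_neg_sub_le (hb u) hs0 (hnl u) (hn0' u)
      rw [← e1, Real.mul_rpow (by positivity) (by positivity)] at e2
      rw [norm_mul, Real.norm_eq_abs (n u ^ (-s) - k u)]
      calc _ ≤ MJ * (s * ((c / 2) ^ (-s - 1) * (1 + ‖u‖) ^ (-s - 1)) * (r⁻¹ * ‖e u‖)) := by
            gcongr
            · exact hJM _
            · exact e2.trans (by gcongr; exact hna u)
        _ = _ := by ring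
    have h2 := enorm_sub_affine_le_nodeOsc hF hf hDF x hr u
    calc ‖J (x + r • u) * (n u ^ (-s) - k u)‖ₑ
        ≤ ENNReal.ofReal (MJ * (s * (c / 2) ^ (-s - 1) * (1 + ‖u‖) ^ (-s - 1)) * r⁻¹) * ‖e u‖ₑ := by
          rw [← ofReal_norm, ← ofReal_norm, ← ENNReal.ofReal_mul (by positivity)]
          exact ENNReal.ofReal_le_ofReal h1
      _ ≤ ENNReal.ofReal (MJ * (s * (c / 2) ^ (-s - 1) * (1 + ‖u‖) ^ (-s - 1)) * r⁻¹) *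
          (ENNReal.ofReal (r * ((1 + ‖u‖) * logLoss u)) * Y u) := by gcongr
      _ = ENNReal.ofReal (MJ * (s * (c / 2) ^ (-s - 1)) *
          ((1 + ‖u‖) ^ (-s - 1) * (1 + ‖u‖) * logLoss u)) * Y u := by
          rw [← mul_assoc, ← ENNReal.ofReal_mul (by positivity)]
          congr 2
          field_simp
      _ ≤ ENNReal.ofReal (C₁ * weight α u) * Y u := by
          refine mul_le_mul' (ENNReal.ofReal_le_ofReal ?_) le_rfl
          rw [hC₁, mul_assoc _ CL, ← Real.rpow_add_one (by positivity), sub_add_cancel]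
          exact mul_le_mul_of_nonneg_left (rpow_mul_logLoss_le hα u) (by positivity)
  -- J is only bounded and measurable, so it is not pointwise close to its mollification; the
  -- difference is small only when paired with the smooth kernel.
  have hT2 : ‖∫ u, k u * (J (x + r • u) - Jr (x + r • u))‖ₑ
      ≤ ENNReal.ofReal C₂ * distOsc α f x r := by
    have h1 := enorm_integral_mul_sub_avg_le hJx (M := MJ) (fun u => hJM _) hkc hki hkdi
    simp only [avg_comp_affine bump J x, one_mul, osc_comp_affine] at h1
    refine h1.trans ?_
    have hm : Measurable (Function.uncurry fun (σ : ℝ) (u : E) =>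
        ‖fderiv ℝ k u‖ₑ * ENNReal.ofReal (osc J (x + r • u) (σ * r))) := by
      refine Measurable.mul ?_ (ENNReal.measurable_ofReal.comp
        ((measurable_osc hJ).comp (Measurable.prodMk ?_ ?_)))
      · exact ((measurable_fderiv ℝ k).comp measurable_snd).enorm
      · fun_prop
      · fun_prop
    rw [lintegral_lintegral_swap hm.aemeasurable, ← hfin C₂ (by positivity)]
    refine lintegral_mono fun u => ?_
    rw [lintegral_const_mul' _ _ enorm_ne_top]
    have h2 : ∫⁻ σ in Icc (0 : ℝ) 1, ENNReal.ofReal (osc J (x + r • u) (σ * r)) ≤ Y u := by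
      calc _ ≤ nodeOsc f x r 0 u := by
            rw [nodeOsc_zero]; gcongr; exact hJf _ _
        _ ≤ Y u := Finset.single_le_sum (f := fun i => nodeOsc f x r i u)
            (fun i _ => zero_le) (Finset.mem_univ 0)
    refine mul_le_mul' ?_ h2
    rw [← ofReal_norm]
    refine ENNReal.ofReal_le_ofReal ((hkd u).trans ?_)
    rw [hC₂, mul_assoc _ CL]
    gcongr
    exact rpow_le_weight hα u
  have hT3 : ‖∫ u, k u * (Jr (x + r • u) - Jr x)‖ₑ ≤ ENNReal.ofReal C₃ * distOsc α f x r := by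
    rw [← hfin C₃ (by positivity)]
    refine (enorm_integral_le_lintegral_enorm _).trans (lintegral_mono fun u => ?_)
    have h2 := enorm_avg_sub_le_nodeOsc hJ hJM hJf x hr u
    rw [enorm_mul]
    calc _ ≤ ENNReal.ofReal (c ^ (-s) * (1 + ‖u‖) ^ (-s)) * (ENNReal.ofReal (logLoss u) * Y u) := by
          gcongr
          rw [← ofReal_norm, Real.norm_of_nonneg (hk0 u)]
          exact ENNReal.ofReal_le_ofReal (hkle u)
      _ ≤ _ := by
          rw [← mul_assoc, ← ENNReal.ofReal_mul (by positivity)]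
          refine mul_le_mul' (ENNReal.ofReal_le_ofReal ?_) le_rfl
          rw [hC₃, mul_assoc, mul_assoc]
          exact mul_le_mul_of_nonneg_left (rpow_mul_logLoss_le hα u) (by positivity)
  rw [hsplit]
  refine (enorm_add_le _ _).trans ((add_le_add_left (enorm_add_le _ _) _).trans ?_)
  refine (add_le_add (add_le_add hT1 hT2) hT3).trans (le_of_eq ?_)
  rw [ENNReal.ofReal_add (by positivity) (by positivity),
    ENNReal.ofReal_add (by positivity) (by positivity)]
  ring

end RieszKernel

/-! ### The smooth distance at the image of a point. -/

section GraphData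

open Set Metric Filter Topology

/-- A Lipschitz graph, together with the density of the projection of its Hausdorff measure. -/
structure IsGraphData (c₀ : ℝ) (F : EuclideanSpace ℝ (Fin d) → EuclideanSpace ℝ (Fin m)) (K : ℝ≥0)
    (J : EuclideanSpace ℝ (Fin d) → ℝ) : Prop where
  lip : LipschitzWith K F
  meas : Measurable J
  lower : ∀ x, c₀ ≤ J x
  upper : ∀ x, J x ≤ c₀ * (1 + K) ^ d
  density : ∀ g : Amb d m → ℝ, Measurable g →
    ∫ y in graphOf F, g y ∂(Measure.hausdorffMeasure (d : ℝ)) = ∫ y, J y * g (pt y (F y))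

/-- The slope of a graph and the density of its Hausdorff measure. -/
def graphField (F : EuclideanSpace ℝ (Fin d) → EuclideanSpace ℝ (Fin m))
    (J : EuclideanSpace ℝ (Fin d) → ℝ) (y : EuclideanSpace ℝ (Fin d)) : Param d m :=
  (fderiv ℝ F y, J y)

/-- The averaged slope and density. -/
def graphParam (F : EuclideanSpace ℝ (Fin d) → EuclideanSpace ℝ (Fin m))
    (J : EuclideanSpace ℝ (Fin d) → ℝ) (x : EuclideanSpace ℝ (Fin d)) (r : ℝ) : Param d m :=
  avg bump (graphField F J) x r

/-- The change of variables that flattens the graph. -/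
def flattening (B : Param d m → EuclideanSpace ℝ (Fin m) →L[ℝ] Amb d m)
    (F : EuclideanSpace ℝ (Fin d) → EuclideanSpace ℝ (Fin m))
    (J : EuclideanSpace ℝ (Fin d) → ℝ) (z : Amb d m) : Amb d m :=
  pt (baseL z) (avg bump F (baseL z) ‖transv z‖)
    + B (graphParam F J (baseL z) ‖transv z‖) (transv z)

variable {c₀ : ℝ} {F : EuclideanSpace ℝ (Fin d) → EuclideanSpace ℝ (Fin m)} {K : ℝ≥0}
  {J : EuclideanSpace ℝ (Fin d) → ℝ}

lemma IsGraphData.measurable_graphField (hD : IsGraphData c₀ F K J) :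
    Measurable (graphField F J) :=
  (measurable_fderiv ℝ F).prodMk hD.meas

lemma norm_graphField_le {τ : ℝ}
    (hτ : ∀ y, ‖graphField F J y - (0, c₀)‖ ≤ τ) (y : EuclideanSpace ℝ (Fin d)) :
    ‖graphField F J y‖ ≤ τ + |c₀| := by
  have h1 := norm_add_le (graphField F J y - (0, c₀)) ((0, c₀) : Param d m)
  rw [sub_add_cancel] at h1
  refine h1.trans (add_le_add (hτ y) ?_)
  rw [Prod.norm_def]
  simp

lemma IsGraphData.graphParam_fst (hD : IsGraphData c₀ F K J) {τ : ℝ}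
    (hτ : ∀ y, ‖graphField F J y - (0, c₀)‖ ≤ τ) (x : EuclideanSpace ℝ (Fin d)) (r : ℝ) :
    (graphParam F J x r).1 = avg bump (fderiv ℝ F) x r :=
  map_avg bump_isProfile hD.measurable_graphField (norm_graphField_le hτ)
    (ContinuousLinearMap.fst ℝ _ _) x r

lemma IsGraphData.graphParam_snd (hD : IsGraphData c₀ F K J) {τ : ℝ}
    (hτ : ∀ y, ‖graphField F J y - (0, c₀)‖ ≤ τ) (x : EuclideanSpace ℝ (Fin d)) (r : ℝ) :
    (graphParam F J x r).2 = avg bump J x r :=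
  map_avg bump_isProfile hD.measurable_graphField (norm_graphField_le hτ)
    (ContinuousLinearMap.snd ℝ _ _) x r

lemma IsGraphData.osc_fderiv_le (hD : IsGraphData c₀ F K J) {τ : ℝ}
    (hτ : ∀ y, ‖graphField F J y - (0, c₀)‖ ≤ τ) (x : EuclideanSpace ℝ (Fin d)) (r : ℝ) :
    osc (fderiv ℝ F) x r ≤ osc (graphField F J) x r :=
  osc_comp_le hD.measurable_graphField (norm_graphField_le hτ)
    (ContinuousLinearMap.fst ℝ _ _) (ContinuousLinearMap.norm_fst_le ..) x r

lemma IsGraphData.osc_density_le (hD : IsGraphData c₀ F K J) {τ : ℝ}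
    (hτ : ∀ y, ‖graphField F J y - (0, c₀)‖ ≤ τ) (x : EuclideanSpace ℝ (Fin d)) (r : ℝ) :
    osc J x r ≤ osc (graphField F J) x r :=
  osc_comp_le hD.measurable_graphField (norm_graphField_le hτ)
    (ContinuousLinearMap.snd ℝ _ _) (ContinuousLinearMap.norm_snd_le ..) x r

lemma IsGraphData.norm_graphParam_sub_le (hD : IsGraphData c₀ F K J) {τ : ℝ}
    (hτ : ∀ y, ‖graphField F J y - (0, c₀)‖ ≤ τ) (x : EuclideanSpace ℝ (Fin d)) (r : ℝ) :
    ‖graphParam F J x r - (0, c₀)‖ ≤ τ :=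
  norm_avg_bump_sub_le hD.measurable_graphField (norm_graphField_le hτ) _ hτ x r

lemma IsGraphData.osc_graphField_le (hD : IsGraphData c₀ F K J) {τ : ℝ}
    (hτ : ∀ y, ‖graphField F J y - (0, c₀)‖ ≤ τ) (x : EuclideanSpace ℝ (Fin d)) (r : ℝ) :
    osc (graphField F J) x r ≤ profMass (EuclideanSpace ℝ (Fin d)) * τ :=
  osc_le hD.measurable_graphField (norm_graphField_le hτ) _ hτ x r

/-- The density lies between c₀ and c₀(1+K)^d, so a small Lipschitz constant controls slope and
density at once. -/
lemma exists_norm_graphField_sub_le (d m : ℕ) (c₀ : ℝ) {τ : ℝ} (hτ : 0 < τ) :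
    ∃ ε : ℝ, 0 < ε ∧ ∀ (F : EuclideanSpace ℝ (Fin d) → EuclideanSpace ℝ (Fin m)) (K : ℝ≥0)
      (J : EuclideanSpace ℝ (Fin d) → ℝ), IsGraphData c₀ F K J → (K : ℝ) ≤ ε →
      (K : ℝ) ≤ τ ∧ ∀ y, ‖graphField F J y - (0, c₀)‖ ≤ τ := by
  have hc : Continuous fun k : ℝ => c₀ * (1 + k) ^ d - c₀ := by fun_prop
  have h0 : ∀ᶠ k in 𝓝 (0 : ℝ), c₀ * (1 + k) ^ d - c₀ < τ :=
    hc.continuousAt.eventually (gt_mem_nhds (by simpa using hτ))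
  obtain ⟨ε, hε, hball⟩ := Metric.eventually_nhds_iff.1 h0
  refine ⟨min (ε / 2) τ, by positivity, fun F K J hD hK => ?_⟩
  have h1 : (K : ℝ) ≤ τ := hK.trans (min_le_right _ _)
  have h2 : c₀ * (1 + (K : ℝ)) ^ d - c₀ < τ := hball (by
    rw [dist_zero_right, Real.norm_of_nonneg K.coe_nonneg]
    have := hK.trans (min_le_left _ _)
    linarith)
  refine ⟨h1, fun y => ?_⟩
  rw [Prod.norm_def, max_le_iff]
  constructor
  · simp only [graphField, Prod.fst_sub, sub_zero]
    exact (norm_fderiv_le_of_lipschitz ℝ hD.lip).trans h1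
  · simp only [graphField, Prod.snd_sub, Real.norm_eq_abs]
    rw [abs_of_nonneg (sub_nonneg.2 (hD.lower y))]
    linarith [hD.upper y]

/-- Pythagoras: B p t is orthogonal to the model graph and has length h p |t|. This turns the
distance from the image point to the model graph into |t| times the normalised model distance. -/
lemma IsFrame.norm_smul_sub {α δ M : ℝ} {h : Param d m → ℝ}
    {B : Param d m → EuclideanSpace ℝ (Fin m) →L[ℝ] Amb d m} (hB : IsFrame α c₀ δ M h B)
    {p : Param d m} (hp : p ∈ ball (0, c₀) δ) (t : EuclideanSpace ℝ (Fin m))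
    (u : EuclideanSpace ℝ (Fin d)) :
    ‖B p t - ‖t‖ • pt u (p.1 u)‖ = ‖t‖ * √(graphSq p.1 (h p) u) := by
  have h1 : ‖B p t - ‖t‖ • pt u (p.1 u)‖ ^ 2 = ‖t‖ ^ 2 * graphSq p.1 (h p) u := by
    rw [norm_sub_sq_real, inner_smul_right, real_inner_comm, hB.orth p hp, norm_smul, mul_pow,
      norm_pt_sq, ← real_inner_self_eq_norm_sq (B p t), hB.conf p hp, real_inner_self_eq_norm_sq,
      norm_norm]
    unfold graphSq
    ring
  have h2 : 0 ≤ graphSq p.1 (h p) u := by unfold graphSq; positivity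
  rw [← sq_eq_sq₀ (norm_nonneg _) (by positivity), h1, mul_pow, Real.sq_sqrt h2]

/-- Substitution y = x + ru: the powers of r combine to r^(-α), and the exponent -1/α turns this
into the factor r. -/
lemma IsGraphData.smoothDist_eq (hD : IsGraphData c₀ F K J) (hc₀ : 0 < c₀) {α : ℝ} (hα : 0 < α)
    (X : Amb d m)
    (x : EuclideanSpace ℝ (Fin d)) {r : ℝ} (hr : 0 < r) :
    smoothDist α (graphOf F) X = r * (∫ u, J (x + r • u) *
      (r⁻¹ * ‖X - pt (x + r • u) (F (x + r • u))‖) ^ (-(d + α))) ^ (-(1 / α)) := by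
  set I := ∫ u, J (x + r • u) *
      (r⁻¹ * ‖X - pt (x + r • u) (F (x + r • u))‖) ^ (-(d + α)) with hI
  have hI0 : 0 ≤ I := integral_nonneg fun u =>
    mul_nonneg (hc₀.le.trans (hD.lower _)) (Real.rpow_nonneg (by positivity) _)
  set g : EuclideanSpace ℝ (Fin d) → ℝ := fun y =>
    J y * ‖X - pt y (F y)‖ ^ (-(d : ℝ) - α) with hg
  have h1 : ∫ y in graphOf F, ‖X - y‖ ^ (-(d : ℝ) - α) ∂(Measure.hausdorffMeasure (d : ℝ))
      = ∫ y, g y := hD.density (fun y => ‖X - y‖ ^ (-(d : ℝ) - α)) (by fun_prop)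
  have h2 : ∫ y, g y = r ^ d * ∫ u, g (x + r • u) := by
    have e1 := Measure.integral_comp_smul (volume : Measure (EuclideanSpace ℝ (Fin d)))
      (fun y => g (x + y)) r
    rw [e1, integral_add_left_eq_self g, finrank_euclideanSpace_fin, abs_of_pos (by positivity),
      smul_eq_mul]
    field_simp
  have h3 : ∀ u, g (x + r • u) = r ^ (-(d + α)) * (J (x + r • u) *
      (r⁻¹ * ‖X - pt (x + r • u) (F (x + r • u))‖) ^ (-(d + α))) := fun u => by
    rw [Real.mul_rpow (by positivity) (by positivity), Real.inv_rpow hr.le]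
    have : r ^ (-(d + α)) ≠ 0 := (Real.rpow_pos_of_pos hr _).ne'
    simp only [hg]
    rw [show -(d : ℝ) - α = -(d + α) by ring]
    field_simp
  have h4 : ∫ y, g y = r ^ (-α) * I := by
    rw [h2]
    simp only [h3]
    rw [integral_const_mul, ← mul_assoc, ← Real.rpow_natCast, ← Real.rpow_add hr, hI]
    congr 2
    ring
  rw [smoothDist, h1, h4, Real.mul_rpow (by positivity) hI0, ← Real.rpow_mul hr.le,
    show -α * (-1 / α) = 1 by field_simp, Real.rpow_one, neg_div]

lemma abs_le_of_enorm_le {a C W N : ℝ} (hC : 0 ≤ C) (hW : 0 ≤ W) (hN : 0 ≤ N)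
    (h : ‖a‖ₑ ≤ ENNReal.ofReal C * (6 * ENNReal.ofReal W * ENNReal.ofReal N)) :
    |a| ≤ C * (6 * W * N) := by
  rw [← ofReal_norm, show (6 : ℝ≥0∞) = ENNReal.ofReal 6 by simp,
    ← ENNReal.ofReal_mul (by norm_num), ← ENNReal.ofReal_mul (by positivity),
    ← ENNReal.ofReal_mul hC, ENNReal.ofReal_le_ofReal_iff (by positivity),
    Real.norm_eq_abs] at h
  exact h

set_option maxHeartbeats 800000 in
/-- The smooth distance at the image of a point, compared with the distance to the plane. -/
lemma IsFrame.exists_smoothDist_estimate {α δ M : ℝ} {h : Param d m → ℝ}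
    {B : Param d m → EuclideanSpace ℝ (Fin m) →L[ℝ] Amb d m} (hB : IsFrame α c₀ δ M h B)
    (hα : 0 < α) (hc₀ : 0 < c₀) :
    ∃ τ₀ C : ℝ, 0 < τ₀ ∧ 0 ≤ C ∧ ∀ (F : EuclideanSpace ℝ (Fin d) → EuclideanSpace ℝ (Fin m))
      (K : ℝ≥0) (J : EuclideanSpace ℝ (Fin d) → ℝ), IsGraphData c₀ F K J → (K : ℝ) ≤ τ₀ →
      (∀ y, ‖graphField F J y - (0, c₀)‖ ≤ τ₀) → ∀ z ∉ plane d m,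
      |smoothDist α (graphOf F) (flattening B F J z) / ‖transv z‖ - 1| ≤ 1 / 2 ∧
      ‖smoothDist α (graphOf F) (flattening B F J z) / ‖transv z‖ - 1‖ₑ
        ≤ ENNReal.ofReal C * distOsc α (graphField F J) (baseL z) ‖transv z‖ := by
  have hp₀ : ((0, c₀) : Param d m) ∈ ball ((0, c₀) : Param d m) δ := mem_ball_self hB.pos
  set h₀ := h (0, c₀) with hh₀
  have hh₀p : 0 < h₀ := hB.h_pos _ hp₀
  -- Chosen so that 2c ≤ h₀/2, which stays below h p as long as p moves h by at most h₀/2.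
  set c : ℝ := min (1 / 2) (h₀ / 4) with hc
  have hcp : 0 < c := by positivity
  have hc1 : 2 * c ≤ 1 := by linarith [min_le_left (1 / 2 : ℝ) (h₀ / 4)]
  have hc2 : 2 * c ≤ h₀ / 2 := by linarith [min_le_right (1 / 2 : ℝ) (h₀ / 4)]
  obtain ⟨C₁, hC₁, H⟩ := exists_riesz_estimate (E := EuclideanSpace ℝ (Fin d))
    (V := EuclideanSpace ℝ (Fin m)) (W := Param d m) (MJ := 1 + c₀) hα hcp hc1 (by positivity)
  set W : ℝ := (∫⁻ u : EuclideanSpace ℝ (Fin d), ENNReal.ofReal (weight α u)).toReal with hW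
  have hWt : ∫⁻ u : EuclideanSpace ℝ (Fin d), ENNReal.ofReal (weight α u) = ENNReal.ofReal W :=
    (ENNReal.ofReal_toReal (integrable_weight hα).lintegral_lt_top.ne).symm
  have hW0 : 0 ≤ W := ENNReal.toReal_nonneg
  set P := profMass (EuclideanSpace ℝ (Fin d)) with hP
  have hP0 : 0 ≤ P := profMass_nonneg _
  -- Lipschitz constant of y ↦ y^(-1/α) on [1/2, ∞).
  set L : ℝ := 1 / α * (1 / 2) ^ (-(1 / α) - 1) with hL
  have hL0 : 0 < L := by positivity
  set A : ℝ := C₁ * (6 * W * P) with hA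
  have hA0 : 0 ≤ A := by positivity
  set M' := max M 1 with hM'
  have hM'0 : 0 < M' := lt_max_of_lt_right one_pos
  -- In order, the bounds give: J ≤ 1 + c₀; the smallness of K in the Riesz estimate; parameters
  -- inside the frame ball; h p ≥ h₀/2; and an integral so close to 1 that D/|t| is within 1/2 of 1.
  set τ₀ : ℝ := min (min 1 (c / 4)) (min (min (δ / 2) (h₀ / (2 * M')))
    (min (1 / 2) (1 / (2 * L)) / (A + 1))) with hτ₀
  have hδ := hB.pos
  refine ⟨τ₀, L * C₁, by positivity, by positivity, fun F K J hD hK hτ z hz => ?_⟩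
  have t1 : τ₀ ≤ 1 := (min_le_left _ _).trans (min_le_left _ _)
  have t2 : τ₀ ≤ c / 4 := (min_le_left _ _).trans (min_le_right _ _)
  have t3 : τ₀ ≤ δ / 2 := (min_le_right _ _).trans ((min_le_left _ _).trans (min_le_left _ _))
  have t4 : τ₀ ≤ h₀ / (2 * M') :=
    (min_le_right _ _).trans ((min_le_left _ _).trans (min_le_right _ _))
  have t5 : τ₀ ≤ min (1 / 2) (1 / (2 * L)) / (A + 1) := (min_le_right _ _).trans (min_le_right _ _)
  have hτ0 : 0 ≤ τ₀ := (norm_nonneg _).trans (hτ 0)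
  have t6 : A * τ₀ ≤ min (1 / 2) (1 / (2 * L)) := by
    rw [le_div_iff₀ (by positivity)] at t5
    nlinarith
  set x := baseL z with hx
  set t := transv z with ht
  have ht0 : t ≠ 0 := fun h0 => hz ((mem_plane_iff z).2 h0)
  set r := ‖t‖ with hrd
  have hr : 0 < r := norm_pos_iff.2 ht0
  set p := graphParam F J x r with hp
  have hpτ : ‖p - (0, c₀)‖ ≤ τ₀ := hD.norm_graphParam_sub_le hτ x r
  have hpb : p ∈ ball ((0, c₀) : Param d m) δ := by
    rw [mem_ball, dist_eq_norm]; linarith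
  have hhp : 2 * c ≤ h p := by
    have e1 := hB.lip_h p hpb _ hp₀
    have e2 : M * ‖p - (0, c₀)‖ ≤ h₀ / 2 := by
      calc M * ‖p - (0, c₀)‖ ≤ M' * (h₀ / (2 * M')) := by
            gcongr
            · exact le_max_left _ _
            · exact hpτ.trans t4
        _ = h₀ / 2 := by field_simp
    have e3 := (abs_le.1 e1).1
    linarith
  have hpG : p.1 = avg bump (fderiv ℝ F) x r := hD.graphParam_fst hτ x r
  have hpJ : p.2 = avg bump J x r := hD.graphParam_snd hτ x r
  set X := flattening B F J z with hX
  have hXe : X = pt x (avg bump F x r) + B p t := rfl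
  have hJM : ∀ y, ‖J y‖ ≤ 1 + c₀ := fun y => by
    have e1 := (norm_snd_le (graphField F J y)).trans (norm_graphField_le hτ y)
    rw [abs_of_pos hc₀] at e1
    have e2 : ‖J y‖ ≤ τ₀ + c₀ := e1
    linarith
  set n : EuclideanSpace ℝ (Fin d) → ℝ := fun u =>
    r⁻¹ * ‖X - pt (x + r • u) (F (x + r • u))‖ with hn
  have hptc : Continuous fun q : EuclideanSpace ℝ (Fin d) × EuclideanSpace ℝ (Fin m) =>
      (pt q.1 q.2 : Amb d m) := ptL.continuous
  have hnm : Measurable n := by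
    have hFc := hD.lip.continuous
    have : Continuous fun u => (pt (x + r • u) (F (x + r • u)) : Amb d m) :=
      hptc.comp (by fun_prop : Continuous fun u => (x + r • u, F (x + r • u)))
    exact ((continuous_const.sub this).norm.const_mul _).measurable
  have hna : ∀ u, |n u - √(graphSq (avg bump (fderiv ℝ F) x r) (h p) u)|
      ≤ r⁻¹ * ‖F (x + r • u) - avg bump F x r - r • avg bump (fderiv ℝ F) x r u‖ := by
    intro u
    rw [← hpG]
    have e1 := hB.norm_smul_sub hpb t u
    rw [← hrd] at e1
    have e2 : √(graphSq p.1 (h p) u) = r⁻¹ * ‖B p t - r • pt u (p.1 u)‖ := by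
      rw [e1]; field_simp
    -- The base components cancel: relative to the model, only the vertical affine error of F is
    -- left.
    have e3 : X - pt (x + r • u) (F (x + r • u)) - (B p t - r • pt u (p.1 u))
        = -pt 0 (F (x + r • u) - avg bump F x r - r • p.1 u) := by
      rw [hXe, ← pt_smul]
      ext i
      rcases i with i | i
      · simp [pt]
      · simp [pt]; ring
    simp only [hn]
    rw [e2, ← mul_sub, abs_mul, abs_of_pos (inv_pos.2 hr)]
    gcongr
    refine (abs_norm_sub_norm_le _ _).trans (le_of_eq ?_)
    rw [e3, norm_neg, norm_pt_zero_left]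
  have key := H hD.lip (hK.trans t2) hD.meas hJM hD.measurable_graphField
    (hD.osc_fderiv_le hτ) (hD.osc_density_le hτ) x hr hhp hnm hna
  -- The main term is exactly 1 by the choice of h, so the Riesz estimate bounds I - 1 itself.
  have hmass := hB.mass p hpb
  rw [← hpJ, ← hpG, finrank_euclideanSpace_fin] at key
  have hmass' : p.2 * ∫ u, graphSq p.1 (h p) u ^ (-(d + α) / 2) = 1 := hmass
  rw [hmass'] at key
  set I := ∫ u, J (x + r • u) * n u ^ (-(d + α)) with hI
  have hIs : |I - 1| ≤ A * τ₀ := by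
    have e1 := key.trans (mul_le_mul' le_rfl (distOsc_le (hD.osc_graphField_le hτ) x r))
    rw [hWt] at e1
    calc _ ≤ _ := abs_le_of_enorm_le hC₁ hW0 (mul_nonneg hP0 hτ0) e1
      _ = _ := by rw [hA]; ring
  have hI2 : |I - 1| ≤ 1 / 2 := hIs.trans (t6.trans (min_le_left _ _))
  have hI3 : |I - 1| ≤ 1 / (2 * L) := hIs.trans (t6.trans (min_le_right _ _))
  have hId : smoothDist α (graphOf F) X / r = I ^ (-(1 / α)) := by
    rw [hD.smoothDist_eq hc₀ hα X x hr, mul_div_assoc, mul_comm, div_mul_cancel₀ _ hr.ne']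
  have hfin : |I ^ (-(1 / α)) - 1| ≤ L * |I - 1| := by
    have := abs_rpow_neg_sub_le (b := 1 / 2) (s := 1 / α) (y := I) (z := 1) (by norm_num)
      (by positivity) (by linarith [(abs_le.1 hI2).1]) (by norm_num)
    rwa [Real.one_rpow] at this
  rw [hId]
  refine ⟨hfin.trans ?_, ?_⟩
  · calc L * |I - 1| ≤ L * (1 / (2 * L)) := by gcongr
      _ = 1 / 2 := by field_simp
  · rw [ENNReal.ofReal_mul hL0.le, mul_assoc]
    refine le_trans ?_ (mul_le_mul' le_rfl key)
    rw [← ofReal_norm, ← ofReal_norm, ← ENNReal.ofReal_mul hL0.le]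
    exact ENNReal.ofReal_le_ofReal hfin

end GraphData

/-! ### Differentiability and continuity of the flattening map. -/

section Flattening

open Set Metric Filter Topology

/-- The linear map whose columns are the frame of an approximate graph. -/
def frameMap (B : Param d m → EuclideanSpace ℝ (Fin m) →L[ℝ] Amb d m) (p : Param d m) :
    Amb d m →L[ℝ] Amb d m :=
  inclB ∘L baseL + inclT ∘L p.1 ∘L baseL + B p ∘L transvL

variable {α c₀ δ M : ℝ} {h : Param d m → ℝ}
  {B : Param d m → EuclideanSpace ℝ (Fin m) →L[ℝ] Amb d m}
  {F : EuclideanSpace ℝ (Fin d) → EuclideanSpace ℝ (Fin m)} {K : ℝ≥0}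
  {J : EuclideanSpace ℝ (Fin d) → ℝ}

lemma frameMap_apply (p : Param d m) (w : Amb d m) :
    frameMap B p w = pt (baseL w) (p.1 (baseL w)) + B p (transv w) := by
  have : frameMap B p w = pt (baseL w) 0 + pt 0 (p.1 (baseL w)) + B p (transv w) := rfl
  rw [this, ← pt_add, add_zero, zero_add]

lemma flattening_eq (z : Amb d m) : flattening B F J z = inclB (baseL z)
    + inclT (avg bump F (baseL z) ‖transvL z‖)
    + B (avg bump (graphField F J) (baseL z) ‖transvL z‖) (transvL z) := by
  rw [inclB_apply, inclT_apply, ← pt_add, add_zero, zero_add]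
  rfl

lemma norm_transv_pos {z : Amb d m} (hz : z ∉ plane d m) : 0 < ‖transv z‖ :=
  norm_pos_iff.2 fun h0 => hz ((mem_plane_iff z).2 h0)

lemma IsFrame.norm_B_sub_le (hB : IsFrame α c₀ δ M h B) {p : Param d m}
    (hp : p ∈ ball (0, c₀) δ) : ‖B p - B (0, c₀)‖ ≤ |M| * ‖p - (0, c₀)‖ :=
  (hB.lip_B p hp _ (mem_ball_self hB.pos)).trans (by gcongr; exact le_abs_self M)

/-- The position derivative of the averages of F is exactly the averaged slope, already present in
the frame. What remains is their scale derivative, a mean zero average of DF, and the derivative of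
B(p), whose factor 1/r cancels against |t| = r. -/
lemma IsFrame.hasFDerivAt_aux (hB : IsFrame α c₀ δ M h B) (hF : LipschitzWith K F)
    {f : EuclideanSpace ℝ (Fin d) → Param d m} (hf : Measurable f) {N : ℝ} (hN : ∀ y, ‖f y‖ ≤ N)
    {z : Amb d m} (hz : z ∉ plane d m)
    (hpb : avg bump f (baseL z) ‖transv z‖ ∈ ball ((0, c₀) : Param d m) δ)
    (hpG : (avg bump f (baseL z) ‖transv z‖).1 = avg bump (fderiv ℝ F) (baseL z) ‖transv z‖)
    (hosc : osc (fderiv ℝ F) (baseL z) ‖transv z‖ ≤ osc f (baseL z) ‖transv z‖) :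
    ∃ D : Amb d m →L[ℝ] Amb d m, HasFDerivAt (fun z => inclB (baseL z)
    + inclT (avg bump F (baseL z) ‖transvL z‖)
    + B (avg bump f (baseL z) ‖transvL z‖) (transvL z)) D z ∧
      ‖D - frameMap B (avg bump f (baseL z) ‖transv z‖)‖
        ≤ (1 + |M| * (d + 1)) * osc f (baseL z) ‖transv z‖ := by
  set x := baseL z with hx
  set r := ‖transv z‖ with hrd
  have hr : 0 < r := norm_transv_pos hz
  set o := osc f x r with ho
  have ho0 : 0 ≤ o := osc_nonneg _ _ _
  have htn : transvL z ≠ 0 := norm_pos_iff.1 hr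
  -- the norm of the transversal component
  have hν : DifferentiableAt ℝ (fun z : Amb d m => ‖transvL z‖) z :=
    (transvL.differentiableAt).norm ℝ htn
  set ν := fderiv ℝ (fun z : Amb d m => ‖transvL z‖) z with hνd
  have hν1 : ‖ν‖ ≤ 1 := by
    have hl : LipschitzWith 1 fun z : Amb d m => ‖transvL z‖ := LipschitzWith.of_dist_le_mul
      fun a b => by
        rw [Real.dist_eq, dist_eq_norm, NNReal.coe_one, one_mul]
        refine (abs_norm_sub_norm_le _ _).trans ?_
        rw [← map_sub]
        exact norm_transv_le _
    exact norm_fderiv_le_of_lipschitz ℝ hl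
  set ι : Amb d m →L[ℝ] EuclideanSpace ℝ (Fin d) × ℝ := baseL.prod ν with hι
  have hιd : HasFDerivAt (fun z : Amb d m => (baseL z, ‖transvL z‖)) ι z :=
    baseL.hasFDerivAt.prodMk hν.hasFDerivAt
  have hιn : ∀ w, ‖ι w‖ ≤ ‖w‖ := fun w => by
    rw [hι, ContinuousLinearMap.prod_apply, Prod.norm_def]
    exact max_le (norm_baseL_le w) ((ν.le_of_opNorm_le hν1 w).trans (one_mul _).le)
  obtain ⟨L₁, hL₁, hL₁e⟩ := hasFDerivAt_avg_lipschitz hF x hr.ne'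
  obtain ⟨L₂, hL₂, hL₂n⟩ := hasFDerivAt_avg_bump hf hN x hr
  rw [finrank_euclideanSpace_fin] at hL₂n
  set p := avg bump f x r with hp
  have hBd : DifferentiableAt ℝ B p :=
    (hB.contDiffOn_B.contDiffAt (isOpen_ball.mem_nhds hpb)).differentiableAt one_ne_zero
  set B' := fderiv ℝ B p with hB'
  have hB'n : ‖B'‖ ≤ |M| := by
    refine hBd.hasFDerivAt.le_of_lip' (abs_nonneg M) ?_
    filter_upwards [isOpen_ball.mem_nhds hpb] with q hq
    exact (hB.lip_B q hq p hpb).trans (by gcongr; exact le_abs_self M)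
  have d1 : HasFDerivAt (fun z : Amb d m => avg bump F (baseL z) ‖transvL z‖) (L₁ ∘L ι) z := by
    have e := HasFDerivAt.comp z hL₁ hιd
    exact e
  have d2 : HasFDerivAt (fun z : Amb d m => avg bump (f) (baseL z) ‖transvL z‖)
      (L₂ ∘L ι) z := by
    have e := HasFDerivAt.comp z hL₂ hιd
    exact e
  have d3 : HasFDerivAt (fun z : Amb d m => B (avg bump (f) (baseL z) ‖transvL z‖))
      (B' ∘L (L₂ ∘L ι)) z := HasFDerivAt.comp z hBd.hasFDerivAt d2
  have d4 := d3.clm_apply (transvL (d := d) (m := m)).hasFDerivAt (x := z)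
  have d5 := (((inclB (d := d) (m := m) ∘L baseL).hasFDerivAt (x := z)).add
    ((inclT (d := d) (m := m)).hasFDerivAt.comp z d1)).add d4
  refine ⟨_, d5, ?_⟩
  refine ContinuousLinearMap.opNorm_le_bound _ (by positivity) fun w => ?_
  have e1 : ((inclB (d := d) (m := m) ∘L baseL + inclT ∘L (L₁ ∘L ι)
      + ((B (avg bump (f) (baseL z) ‖transvL z‖)) ∘L transvL
        + (B' ∘L (L₂ ∘L ι)).flip (transvL z))) - frameMap B p : Amb d m →L[ℝ] Amb d m) w
      = pt 0 (L₁ (ι w) - p.1 (baseL w)) + (B' (L₂ (ι w))) (transv z) := by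
    have : ∀ y : EuclideanSpace ℝ (Fin m), (pt 0 y : Amb d m) = inclT y := fun y => rfl
    rw [this, map_sub]
    simp only [frameMap, _root_.sub_apply, _root_.add_apply, ContinuousLinearMap.comp_apply,
      ContinuousLinearMap.flip_apply, transvL_apply]
    change _ + _ + (B p _ + _) - (_ + _ + _) = _
    abel
  have e2 : L₁ (ι w) - p.1 (baseL w) = -(ν w • ∑ j, avg (prof (.inl (.inr j))) (fderiv ℝ F) x r
      (stdOrthonormalBasis ℝ (EuclideanSpace ℝ (Fin d)) j)) := by
    have : ι w = (baseL w, ν w) := rfl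
    rw [this, hL₁e, hpG]
    abel
  refine (congrArg norm e1).le.trans ((norm_add_le _ _).trans ?_)
  have e3 : ‖(pt 0 (L₁ (ι w) - p.1 (baseL w)) : Amb d m)‖ ≤ ‖w‖ * o := by
    rw [norm_pt_zero_left, e2, norm_neg, norm_smul]
    gcongr
    · exact (ν.le_of_opNorm_le hν1 w).trans (one_mul _).le
    · exact (norm_sum_avg_le_osc _ _ _).trans hosc
  have e4 : ‖(B' (L₂ (ι w))) (transv z)‖ ≤ |M| * ((d + 1) * (r⁻¹ * o) * ‖w‖) * r := by
    refine (ContinuousLinearMap.le_opNorm _ _).trans ?_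
    gcongr
    refine (B'.le_of_opNorm_le hB'n _).trans ?_
    gcongr
    exact (L₂.le_of_opNorm_le hL₂n _).trans (by gcongr; exact hιn w)
  have e5 : |M| * ((d + 1) * (r⁻¹ * o) * ‖w‖) * r = |M| * (d + 1) * o * ‖w‖ := by
    field_simp
  rw [e5] at e4
  linarith

lemma IsFrame.hasFDerivAt_flattening (hB : IsFrame α c₀ δ M h B) (hD : IsGraphData c₀ F K J)
    {τ : ℝ} (hτ : ∀ y, ‖graphField F J y - (0, c₀)‖ ≤ τ) (hτδ : τ < δ) {z : Amb d m}
    (hz : z ∉ plane d m) :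
    ∃ D : Amb d m →L[ℝ] Amb d m, HasFDerivAt (flattening B F J) D z ∧
      ‖D - frameMap B (graphParam F J (baseL z) ‖transv z‖)‖
        ≤ (1 + |M| * (d + 1)) * osc (graphField F J) (baseL z) ‖transv z‖ := by
  have h1 : graphParam F J (baseL z) ‖transv z‖ ∈ ball ((0, c₀) : Param d m) δ := by
    rw [mem_ball, dist_eq_norm]; exact (hD.norm_graphParam_sub_le hτ _ _).trans_lt hτδ
  obtain ⟨D, hD1, hD2⟩ := hB.hasFDerivAt_aux hD.lip hD.measurable_graphField
    (norm_graphField_le hτ) hz h1 (hD.graphParam_fst hτ _ _) (hD.osc_fderiv_le hτ _ _)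
  have h2 : flattening B F J = _ := funext fun z => flattening_eq z
  rw [h2]
  exact ⟨D, hD1, hD2⟩

lemma contDiffOn_base_norm :
    ContDiffOn ℝ 1 (fun z : Amb d m => (baseL z, ‖transvL z‖)) (plane d m)ᶜ :=
  baseL.contDiff.contDiffOn.prodMk
    (transvL.contDiff.contDiffOn.norm ℝ fun _ hz => norm_pos_iff.1 (norm_transv_pos hz))

lemma IsGraphData.contDiffOn_graphParam (hD : IsGraphData c₀ F K J)
    {τ : ℝ} (hτ : ∀ y, ‖graphField F J y - (0, c₀)‖ ≤ τ) :
    ContDiffOn ℝ 1 (fun z : Amb d m => graphParam F J (baseL z) ‖transv z‖) (plane d m)ᶜ := by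
  have hli : LocallyIntegrable (graphField F J) := by
    rw [locallyIntegrable_iff]
    intro k hk
    exact Measure.integrableOn_of_bounded (M := τ + |c₀|) hk.measure_lt_top.ne
      hD.measurable_graphField.aestronglyMeasurable (.of_forall (norm_graphField_le hτ))
  have h1 := contDiffOn_avg bump_isProfile hli
  have h2 := h1.comp (contDiffOn_base_norm (d := d) (m := m)) fun z hz => norm_transv_pos hz
  exact h2

lemma IsFrame.contDiffOn_flattening (hB : IsFrame α c₀ δ M h B) (hD : IsGraphData c₀ F K J)
    {τ : ℝ} (hτ : ∀ y, ‖graphField F J y - (0, c₀)‖ ≤ τ) (hτδ : τ < δ) :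
    ContDiffOn ℝ 1 (flattening B F J) (plane d m)ᶜ := by
  have h1 := hD.contDiffOn_graphParam hτ
  have h2 : ContDiffOn ℝ 1 (fun z : Amb d m => avg bump F (baseL z) ‖transvL z‖)
      (plane d m)ᶜ := by
    have e := (contDiffOn_avg_lipschitz hD.lip).comp (contDiffOn_base_norm (d := d) (m := m))
      fun z hz => norm_transv_pos hz
    exact e
  have h3 : ContDiffOn ℝ 1 (fun z : Amb d m => B (graphParam F J (baseL z) ‖transv z‖))
      (plane d m)ᶜ := by
    have e := hB.contDiffOn_B.comp h1 fun z _ => by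
      rw [mem_ball, dist_eq_norm]; exact (hD.norm_graphParam_sub_le hτ _ _).trans_lt hτδ
    exact e
  have h4 : ContDiffOn ℝ 1 (fun z : Amb d m =>
      B (graphParam F J (baseL z) ‖transv z‖) (transvL z)) (plane d m)ᶜ :=
    h3.clm_apply transvL.contDiff.contDiffOn
  have h5 : ContDiffOn ℝ 1 (fun z : Amb d m =>
      (inclT (avg bump F (baseL z) ‖transvL z‖) : Amb d m)) (plane d m)ᶜ :=
    inclT.contDiff.comp_contDiffOn h2
  have h6 : ContDiffOn ℝ 1 (fun z : Amb d m => (inclB (baseL z) : Amb d m)) (plane d m)ᶜ :=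
    ((inclB (d := d) (m := m) ∘L baseL).contDiff).contDiffOn
  exact ((h6.add h5).add h4).congr fun z _ => flattening_eq z

lemma flattening_plane (x : EuclideanSpace ℝ (Fin d)) :
    flattening B F J (pt x 0) = pt x (F x) := by
  simp [flattening, avg_bump_zero]

lemma image_flattening_plane :
    flattening B F J '' plane d m = graphOf F := by
  rw [plane, graphOf, ← range_comp]
  exact congrArg range (funext fun x => flattening_plane x)

/-- Off the plane differentiability suffices. On the plane p need not have a limit, but B stays
bounded and is applied to a transversal vector tending to 0. -/
lemma IsFrame.continuous_flattening (hB : IsFrame α c₀ δ M h B) (hD : IsGraphData c₀ F K J)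
    {τ : ℝ} (hτ : ∀ y, ‖graphField F J y - (0, c₀)‖ ≤ τ) (hτδ : τ < δ) :
    Continuous (flattening B F J) := by
  have hS : Continuous fun q : EuclideanSpace ℝ (Fin d) × ℝ => avg bump F q.1 q.2 := by
    have : LipschitzWith (2 * K) fun q : EuclideanSpace ℝ (Fin d) × ℝ => avg bump F q.1 q.2 :=
      LipschitzWith.of_dist_le_mul fun z w => by
        rw [dist_eq_norm, dist_eq_norm]
        refine (lipschitzWith_avg hD.lip z w).trans ?_
        have h1 := norm_fst_le (z - w)
        have h2 := norm_snd_le (z - w)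
        rw [Real.norm_eq_abs] at h2
        have h3 : (0 : ℝ) ≤ K := K.2
        push_cast
        simp only [Prod.fst_sub, Prod.snd_sub] at h1 h2
        nlinarith
    exact this.continuous
  have h1 : Continuous fun z : Amb d m => (pt (baseL z) (avg bump F (baseL z) ‖transv z‖) : Amb d m) := by
    have : Continuous fun z : Amb d m => (baseL z, avg bump F (baseL z) ‖transvL z‖) :=
      baseL.continuous.prodMk (hS.comp (baseL.continuous.prodMk transvL.continuous.norm))
    exact ptL.continuous.comp this
  refine continuous_iff_continuousAt.2 fun z => ?_
  by_cases hz : z ∈ plane d m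
  · refine h1.continuousAt.add ?_
    have hz0 : transv z = 0 := (mem_plane_iff z).1 hz
    rw [ContinuousAt, hz0, map_zero]
    refine squeeze_zero_norm (a := fun z : Amb d m => (‖B (0, c₀)‖ + |M| * τ) * ‖transvL z‖) (fun w => ?_) ?_
    · refine (ContinuousLinearMap.le_opNorm _ _).trans ?_
      rw [transvL_apply]
      gcongr
      have hp := hD.norm_graphParam_sub_le hτ (baseL w) ‖transv w‖
      have h2 := hB.norm_B_sub_le (p := graphParam F J (baseL w) ‖transv w‖)
        (by rw [mem_ball, dist_eq_norm]; exact hp.trans_lt hτδ)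
      have h3 := norm_add_le (B (0, c₀)) (B (graphParam F J (baseL w) ‖transv w‖) - B (0, c₀))
      rw [add_sub_cancel] at h3
      have h4 : |M| * ‖graphParam F J (baseL w) ‖transv w‖ - (0, c₀)‖ ≤ |M| * τ := by gcongr
      linarith
    · have : Continuous fun z : Amb d m => (‖B (0, c₀)‖ + |M| * τ) * ‖transvL z‖ := by fun_prop
      have h2 := this.tendsto z
      rwa [transvL_apply, hz0, norm_zero, mul_zero] at h2
  · obtain ⟨D, hDd, _⟩ := hB.hasFDerivAt_flattening hD hτ hτδ hz
    exact hDd.continuousAt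

end Flattening

/-! ### The flattening map is a bilipschitz bijection. -/

section Bilipschitz

open Set Metric Filter Topology

variable {α c₀ δ M : ℝ} {h : Param d m → ℝ}
  {B : Param d m → EuclideanSpace ℝ (Fin m) →L[ℝ] Amb d m}
  {F : EuclideanSpace ℝ (Fin d) → EuclideanSpace ℝ (Fin m)} {K : ℝ≥0}
  {J : EuclideanSpace ℝ (Fin d) → ℝ}

/-- A function whose derivative is close to a fixed linear map off the plane is close to it in the
Lipschitz sense, because a subspace of codimension at least two can be avoided. -/
lemma norm_image_sub_sub_le_of_off_plane (hm : 2 ≤ m) {g : Amb d m → Amb d m} (hg : Continuous g)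
    (L : Amb d m →L[ℝ] Amb d m) {κ : ℝ}
    (hκ : ∀ z ∉ plane d m, ∃ D, HasFDerivAt g D z ∧ ‖D - L‖ ≤ κ) (z w : Amb d m) :
    ‖g z - g w - L (z - w)‖ ≤ κ * ‖z - w‖ := by
  -- Since m ≥ 2 there is e ≠ 0 orthogonal to the difference of the transversal parts. Shifting both
  -- points by a small multiple of e moves them into one open half space that misses the plane,
  -- where the mean value inequality applies; then the shift tends to 0.
  have hker : LinearMap.ker (innerSL ℝ (transv z - transv w)).toLinearMap ≠ ⊥ :=
    LinearMap.ker_ne_bot_of_finrank_lt (by simp only [Module.finrank_self, finrank_euclideanSpace_fin]; omega)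
  obtain ⟨e₀, he₀, hne₀⟩ := (Submodule.ne_bot_iff _).1 hker
  have he₀' : inner ℝ (transv z) e₀ = inner ℝ (transv w) e₀ := by
    have : inner ℝ (transv z - transv w) e₀ = 0 := he₀
    rw [inner_sub_left] at this
    linarith
  -- The sign of e is adjusted so that both points lie in the closed half space and any positive
  -- shift enters the open one.
  obtain ⟨e, hne, he, hpos⟩ : ∃ e : EuclideanSpace ℝ (Fin m), e ≠ 0 ∧
      inner ℝ (transv z) e = inner ℝ (transv w) e ∧ 0 ≤ inner ℝ (transv w) e := by
    rcases le_total 0 (inner ℝ (transv w) e₀) with h0 | h0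
    · exact ⟨e₀, hne₀, he₀', h0⟩
    · exact ⟨-e₀, neg_ne_zero.2 hne₀, by simp only [inner_neg_right, he₀'], by
        rw [inner_neg_right]; linarith⟩
  set S : Set (Amb d m) := {y | 0 < inner ℝ e (transvL y)} with hS
  have hSc : Convex ℝ S := convex_halfSpace_gt (f := fun y => inner ℝ e (transvL y))
    (((innerSL ℝ e) ∘L transvL).toLinearMap.isLinear) 0
  have hSp : ∀ y ∈ S, y ∉ plane d m := fun y hy hyp => by
    rw [hS, mem_ofPred_eq, transvL_apply, (mem_plane_iff y).1 hyp, inner_zero_right] at hy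
    exact hy.false
  choose! D hD1 hD2 using hκ
  have key : ∀ η : ℝ, 0 < η → ‖g (z + η • inclT e) - g (w + η • inclT e) - L (z - w)‖
      ≤ κ * ‖z - w‖ := fun η hη => by
    have hmem : ∀ y : Amb d m, 0 ≤ inner ℝ (transv y) e → y + η • inclT e ∈ S := fun y hy => by
      have h1 : transvL (y + η • inclT e : Amb d m) = transv y + η • e := by
        rw [map_add, map_smul, inclT_apply, transvL_apply, transvL_apply, transv_pt]
      rw [hS, mem_ofPred_eq, h1, inner_add_right, inner_smul_right, real_inner_comm]
      have := real_inner_self_pos.2 hne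
      positivity
    have := hSc.norm_image_sub_le_of_norm_hasFDerivWithin_le' (f := g) (φ := L)
      (fun x hx => (hD1 x (hSp x hx)).hasFDerivWithinAt) (fun x hx => hD2 x (hSp x hx))
      (hmem w hpos) (hmem z (he ▸ hpos))
    rwa [add_sub_add_right_eq_sub] at this
  have hlim : Tendsto (fun η : ℝ => ‖g (z + η • inclT e) - g (w + η • inclT e) - L (z - w)‖)
      (𝓝[>] 0) (𝓝 ‖g z - g w - L (z - w)‖) := by
    have hc : Continuous fun η : ℝ => ‖g (z + η • inclT e) - g (w + η • inclT e) - L (z - w)‖ := by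
      fun_prop
    have := hc.tendsto 0
    simp only [zero_smul, add_zero] at this
    exact this.mono_left nhdsWithin_le_nhds
  exact le_of_tendsto hlim (eventually_mem_nhdsWithin.mono key)

lemma IsFrame.norm_frameMap_sub_le (hB : IsFrame α c₀ δ M h B) {p : Param d m}
    (hp : p ∈ ball (0, c₀) δ) :
    ‖frameMap B p - frameMap B (0, c₀)‖ ≤ (1 + |M|) * ‖p - (0, c₀)‖ := by
  refine ContinuousLinearMap.opNorm_le_bound _ (by positivity) fun w => ?_
  have e1 : (frameMap B p - frameMap B (0, c₀)) w
      = pt 0 (p.1 (baseL w)) + (B p - B (0, c₀)) (transv w) := by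
    rw [_root_.sub_apply, _root_.sub_apply, frameMap_apply, frameMap_apply, add_sub_add_comm,
      ← pt_sub, sub_self]
    simp
  rw [e1]
  refine (norm_add_le _ _).trans ?_
  have h1 : ‖(pt 0 (p.1 (baseL w)) : Amb d m)‖ ≤ ‖p - (0, c₀)‖ * ‖w‖ := by
    rw [norm_pt_zero_left]
    refine (p.1.le_opNorm _).trans ?_
    have := norm_fst_le (p - (0, c₀))
    rw [Prod.fst_sub, sub_zero] at this
    gcongr
    exact norm_baseL_le w
  have h2 : ‖(B p - B (0, c₀)) (transv w)‖ ≤ |M| * ‖p - (0, c₀)‖ * ‖w‖ := by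
    refine ((B p - B (0, c₀)).le_opNorm _).trans ?_
    gcongr
    · exact hB.norm_B_sub_le hp
    · exact norm_transv_le w
  linarith

lemma IsFrame.frameMap_base_apply (hB : IsFrame α c₀ δ M h B) (w : Amb d m) :
    frameMap B (0, c₀) w = pt (baseL w) (h (0, c₀) • transv w) := by
  rw [frameMap_apply, hB.base, ← pt_add]
  simp

lemma IsFrame.norm_frameMap_base (hB : IsFrame α c₀ δ M h B) (w : Amb d m) :
    min 1 (h (0, c₀)) * ‖w‖ ≤ ‖frameMap B (0, c₀) w‖ ∧
      ‖frameMap B (0, c₀) w‖ ≤ max 1 (h (0, c₀)) * ‖w‖ := by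
  have hh := hB.h_pos _ (mem_ball_self hB.pos)
  set h₀ := h (0, c₀)
  have e1 := norm_pt_sq (baseL w) (h₀ • transv w)
  rw [← hB.frameMap_base_apply, norm_smul, Real.norm_of_nonneg hh.le] at e1
  have e2 := norm_sq_eq_base_transv w
  have h1 : 0 < min 1 h₀ := lt_min one_pos hh
  have h2 : min 1 h₀ ≤ 1 := min_le_left _ _
  have h3 : min 1 h₀ ≤ h₀ := min_le_right _ _
  have h4 : (1 : ℝ) ≤ max 1 h₀ := le_max_left _ _
  have h5 : h₀ ≤ max 1 h₀ := le_max_right _ _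
  constructor
  · refine abs_le_of_sq_le_sq' ?_ (norm_nonneg _) |>.2
    rw [e1, mul_pow, e2, mul_add, ← mul_pow, ← mul_pow]
    gcongr
    nlinarith [norm_nonneg (baseL w)]
  · refine abs_le_of_sq_le_sq' ?_ (by positivity) |>.2
    have h6 : ‖baseL w‖ ≤ max 1 h₀ * ‖baseL w‖ := by nlinarith [norm_nonneg (baseL w)]
    rw [e1, mul_pow _ ‖w‖, e2, mul_add, ← mul_pow, ← mul_pow]
    gcongr

/-- A map close in the Lipschitz sense to an expanding linear map is a bilipschitz bijection. -/
lemma bijective_of_norm_sub_le {E : Type*} [NormedAddCommGroup E] [NormedSpace ℝ E]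
    [FiniteDimensional ℝ E] {g : E → E} {L : E →L[ℝ] E} {a b κ : ℝ} (ha : 0 < a)
    (hL : ∀ w, a * ‖w‖ ≤ ‖L w‖ ∧ ‖L w‖ ≤ b * ‖w‖) (hκ : κ ≤ a / 2)
    (hg : ∀ z w, ‖g z - g w - L (z - w)‖ ≤ κ * ‖z - w‖) :
    Function.Bijective g ∧ ∀ z w, a / 2 * ‖z - w‖ ≤ ‖g z - g w‖ ∧
      ‖g z - g w‖ ≤ (b + a / 2) * ‖z - w‖ := by
  have := FiniteDimensional.complete ℝ E
  have hbil : ∀ z w, a / 2 * ‖z - w‖ ≤ ‖g z - g w‖ ∧ ‖g z - g w‖ ≤ (b + a / 2) * ‖z - w‖ :=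
    fun z w => by
      have h1 := hg z w
      have h2 := hL (z - w)
      have h3 := abs_le.1 ((abs_norm_sub_norm_le (g z - g w) (L (z - w))).trans h1)
      have h4 : κ * ‖z - w‖ ≤ a / 2 * ‖z - w‖ := by gcongr
      constructor <;> nlinarith [h3.1, h3.2]
  have hinj : Function.Injective g := fun z w hzw => by
    have h1 := (hbil z w).1
    rw [hzw, sub_self, norm_zero] at h1
    have h2 := norm_nonneg (z - w)
    have : ‖z - w‖ = 0 := by nlinarith
    exact sub_eq_zero.1 (norm_eq_zero.1 this)
  have hLinj : Function.Injective L.toLinearMap := by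
    rw [injective_iff_map_eq_zero]
    intro w hw
    have h1 := (hL w).1
    have h2 : L w = 0 := hw
    rw [h2, norm_zero] at h1
    have h3 := norm_nonneg w
    exact norm_eq_zero.1 (by nlinarith)
  set Le : E ≃L[ℝ] E := (LinearEquiv.ofInjectiveEndo _ hLinj).toContinuousLinearEquiv with hLe
  have hLee : ∀ w, Le w = L w := fun w => rfl
  have hLe' : (Le : E →L[ℝ] E) = L := ContinuousLinearMap.ext hLee
  refine ⟨⟨hinj, ?_⟩, hbil⟩
  have happ : ApproximatesLinearOn g (Le : E →L[ℝ] E) univ (a / 2).toNNReal := fun z _ w _ => by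
    rw [hLe', Real.coe_toNNReal _ (by positivity)]
    exact (hg z w).trans (by gcongr)
  refine happ.surjective ?_
  rcases Le.subsingleton_or_nnnorm_symm_pos with hs | hs
  · exact .inl hs
  · right
    -- Surjectivity asks for an error constant below 1/‖L⁻¹‖ ≥ a, and the error is only a/2.
    have h1 : ‖(Le.symm : E →L[ℝ] E)‖ ≤ a⁻¹ :=
      ContinuousLinearMap.opNorm_le_bound _ (by positivity) fun w => by
        have h2 := (hL (Le.symm w)).1
        rw [← hLee, Le.apply_symm_apply] at h2
        rw [inv_mul_eq_div, le_div_iff₀ ha, mul_comm]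
        exact h2
    rw [← NNReal.coe_lt_coe, NNReal.coe_inv, Real.coe_toNNReal _ (by positivity)]
    have h3 : (0 : ℝ) < ‖(Le.symm : E →L[ℝ] E)‖ := hs
    have h4 := inv_anti₀ h3 h1
    rw [inv_inv] at h4
    have : a / 2 < a := by linarith
    exact this.trans_le h4

/-- The deviation from the base frame that is produced by parameters within `τ` of the base. -/
def frameDev (d : ℕ) (M τ : ℝ) : ℝ :=
  (1 + |M| * (d + 1)) * (profMass (EuclideanSpace ℝ (Fin d)) * τ) + (1 + |M|) * τ

lemma IsFrame.norm_fderiv_flattening_sub_le (hB : IsFrame α c₀ δ M h B)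
    (hD : IsGraphData c₀ F K J)
    {τ : ℝ} (hτ : ∀ y, ‖graphField F J y - (0, c₀)‖ ≤ τ) (hτδ : τ < δ) {z : Amb d m}
    (hz : z ∉ plane d m) :
    ‖fderiv ℝ (flattening B F J) z - frameMap B (0, c₀)‖ ≤ frameDev d M τ := by
  obtain ⟨D, hD1, hD2⟩ := hB.hasFDerivAt_flattening hD hτ hτδ hz
  rw [hD1.fderiv]
  have hp := hD.norm_graphParam_sub_le hτ (baseL z) ‖transv z‖
  have h1 := hB.norm_frameMap_sub_le (p := graphParam F J (baseL z) ‖transv z‖)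
    (by rw [mem_ball, dist_eq_norm]; exact hp.trans_lt hτδ)
  have h2 := hD.osc_graphField_le hτ (baseL z) ‖transv z‖
  have h3 := norm_sub_le_norm_sub_add_norm_sub D
    (frameMap B (graphParam F J (baseL z) ‖transv z‖)) (frameMap B (0, c₀))
  refine h3.trans (add_le_add (hD2.trans ?_) (h1.trans ?_)) <;> gcongr

/-- The frame at the base parameter is the identity on the plane and h₀ across it, so it expands by
at least min(1, h₀); τ₀ makes the total deviation at most half of that. -/
lemma IsFrame.exists_bilipschitz (hm : 2 ≤ m) (hB : IsFrame α c₀ δ M h B) :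
    ∃ τ₀ C : ℝ, 0 < τ₀ ∧ 1 ≤ C ∧ ∀ F K J, IsGraphData c₀ F K J →
      (∀ y, ‖graphField F J y - (0, c₀)‖ ≤ τ₀) →
      Function.Bijective (flattening B F J) ∧
      ∀ z w, C⁻¹ * ‖z - w‖ ≤ ‖flattening B F J z - flattening B F J w‖ ∧
        ‖flattening B F J z - flattening B F J w‖ ≤ C * ‖z - w‖ := by
  set a := min 1 (h (0, c₀)) with ha
  set b := max 1 (h (0, c₀)) with hb
  have ha0 : 0 < a := lt_min one_pos (hB.h_pos _ (mem_ball_self hB.pos))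
  have hlim : Tendsto (fun τ => frameDev d M τ) (𝓝[>] 0) (𝓝 0) := by
    have hc : Continuous fun τ => frameDev d M τ := by unfold frameDev; fun_prop
    have := hc.tendsto 0
    rw [show frameDev d M 0 = 0 by simp [frameDev]] at this
    exact this.mono_left nhdsWithin_le_nhds
  obtain ⟨τ₀, ⟨h1, h2⟩, h3⟩ := ((hlim.eventually_le_const (half_pos ha0)).and
    ((Ioo_mem_nhdsGT hB.pos))).and self_mem_nhdsWithin |>.exists
  refine ⟨τ₀, max (b + a / 2) (a / 2)⁻¹, h3, ?_, fun F K J hD hτ => ?_⟩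
  · exact le_max_of_le_left (by have := le_max_left 1 (h (0, c₀)); linarith)
  obtain ⟨hbij, hbil⟩ := bijective_of_norm_sub_le ha0 hB.norm_frameMap_base h1
    (norm_image_sub_sub_le_of_off_plane hm (hB.continuous_flattening hD hτ h2.2)
      (frameMap B (0, c₀)) fun z hz => ⟨_, (hB.hasFDerivAt_flattening hD hτ h2.2 hz).elim
        fun D hD' => hD'.1.differentiableAt.hasFDerivAt,
        hB.norm_fderiv_flattening_sub_le hD hτ h2.2 hz⟩)
  refine ⟨hbij, fun z w => ⟨(mul_le_mul_of_nonneg_right ?_ (norm_nonneg _)).trans (hbil z w).1,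
    (hbil z w).2.trans (mul_le_mul_of_nonneg_right (le_max_left _ _) (norm_nonneg _))⟩⟩
  rw [inv_le_comm₀ (lt_max_of_lt_right (by positivity)) (by positivity)]
  exact le_max_right _ _

end Bilipschitz

/-! ### Conjugation by a linear map and by a frame. -/

section ConjugatedMatrix

open Set Metric Filter Topology

variable {α c₀ δ M : ℝ} {h : Param d m → ℝ}
  {B : Param d m → EuclideanSpace ℝ (Fin m) →L[ℝ] Amb d m}

/-- The matrix of a linear map in the standard basis. -/
def matOf (L : Amb d m →L[ℝ] Amb d m) : Mat d m :=
  Matrix.of fun i j => (L (EuclideanSpace.single j 1)) i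

lemma jac_eq_matOf (ρ : Amb d m → Amb d m) (z : Amb d m) : jac ρ z = matOf (fderiv ℝ ρ z) := rfl

lemma matOf_eq_toMatrix (L : Amb d m →L[ℝ] Amb d m) :
    matOf L = LinearMap.toMatrix (EuclideanSpace.basisFun _ ℝ).toBasis
      (EuclideanSpace.basisFun _ ℝ).toBasis L.toLinearMap := by
  ext i j
  simp [matOf, LinearMap.toMatrix_apply]

lemma det_matOf (L : Amb d m →L[ℝ] Amb d m) : (matOf L).det = L.det := by
  rw [matOf_eq_toMatrix, LinearMap.det_toMatrix]

lemma matOf_mulVec (L : Amb d m →L[ℝ] Amb d m) (w : Amb d m) :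
    matOf L *ᵥ w.ofLp = (L w).ofLp := by
  have h1 := LinearMap.toMatrix_mulVec_repr (EuclideanSpace.basisFun (Fin d ⊕ Fin m) ℝ).toBasis
    (EuclideanSpace.basisFun (Fin d ⊕ Fin m) ℝ).toBasis L.toLinearMap w
  rw [← matOf_eq_toMatrix] at h1
  exact h1

lemma dotProduct_eq_inner (v w : Amb d m) : v.ofLp ⬝ᵥ w.ofLp = inner ℝ v w := by
  rw [PiLp.inner_apply]
  simp [dotProduct, mul_comm]

lemma dotProduct_matOf_mul (L : Amb d m →L[ℝ] Amb d m) (i j : Fin d ⊕ Fin m) :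
    ((matOf L)ᵀ * matOf L) i j
      = inner ℝ (L (EuclideanSpace.single i 1)) (L (EuclideanSpace.single j 1)) := by
  rw [← dotProduct_eq_inner]
  rfl

/-- The conjugate of the identity matrix by a linear change of variables. -/
def conjForm (N : Mat d m) : Mat d m := |N.det| • (N⁻¹ * (N⁻¹)ᵀ)

lemma conjMatrix_coeff (α : ℝ) (Γ : Set (Amb d m)) (ρ : Amb d m → Amb d m) (z : Amb d m) :
    conjMatrix ρ (coeff α Γ) z
      = smoothDist α Γ (ρ z) ^ (1 - (m : ℤ)) • conjForm (matOf (fderiv ℝ ρ z)) := by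
  rw [conjMatrix, coeff, conjForm, jac_eq_matOf, Matrix.mul_smul, Matrix.mul_one, Matrix.smul_mul,
    smul_comm]

lemma contDiffAt_matOf_apply (L : Amb d m →L[ℝ] Amb d m) (i j : Fin d ⊕ Fin m) :
    ContDiffAt ℝ 1 (fun L : Amb d m →L[ℝ] Amb d m => matOf L i j) L := by
  have h1 : ContDiff ℝ 1 fun L : Amb d m →L[ℝ] Amb d m => L (EuclideanSpace.single j 1) :=
    contDiff_id.clm_apply contDiff_const
  exact (contDiff_euclidean.1 h1 i).contDiffAt

lemma contDiffAt_det_matOf (L : Amb d m →L[ℝ] Amb d m) :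
    ContDiffAt ℝ 1 (fun L : Amb d m →L[ℝ] Amb d m => (matOf L).det) L :=
  contDiffAt_matrix_det fun i j => contDiffAt_matOf_apply L i j

lemma contDiffAt_abs_det_matOf {L : Amb d m →L[ℝ] Amb d m} (hL : (matOf L).det ≠ 0) :
    ContDiffAt ℝ 1 (fun L : Amb d m →L[ℝ] Amb d m => |(matOf L).det|) L :=
  (contDiffAt_det_matOf L).norm ℝ hL

lemma contDiffAt_inv_matOf {L : Amb d m →L[ℝ] Amb d m} (hL : (matOf L).det ≠ 0)
    (i j : Fin d ⊕ Fin m) :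
    ContDiffAt ℝ 1 (fun L : Amb d m →L[ℝ] Amb d m => (matOf L)⁻¹ i j) L := by
  -- By Cramer's rule each entry of the inverse is a quotient of determinants.
  have h1 : ContDiffAt ℝ 1 (fun L : Amb d m →L[ℝ] Amb d m =>
      ((matOf L).updateRow j (Pi.single i 1)).det) L :=
    contDiffAt_matrix_det fun k l => by
      by_cases hk : k = j
      · subst hk; simpa using contDiffAt_const
      · simpa [Matrix.updateRow_ne hk] using contDiffAt_matOf_apply L k l
  have h2 : (fun L : Amb d m →L[ℝ] Amb d m => (matOf L)⁻¹ i j) = fun L =>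
      ((matOf L).det)⁻¹ * ((matOf L).updateRow j (Pi.single i 1)).det := by
    funext L
    rw [Matrix.inv_def, Ring.inverse_eq_inv', Matrix.smul_apply, Matrix.adjugate_apply, smul_eq_mul]
  rw [h2]
  exact ((contDiffAt_det_matOf L).inv hL).mul h1

lemma contDiffAt_conjForm {L : Amb d m →L[ℝ] Amb d m} (hL : (matOf L).det ≠ 0)
    (i j : Fin d ⊕ Fin m) :
    ContDiffAt ℝ 1 (fun L : Amb d m →L[ℝ] Amb d m => conjForm (matOf L) i j) L := by
  have h1 : ContDiffAt ℝ 1 (fun L : Amb d m →L[ℝ] Amb d m =>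
      |(matOf L).det| * ∑ k, (matOf L)⁻¹ i k * (matOf L)⁻¹ j k) L :=
    (contDiffAt_abs_det_matOf hL).mul (ContDiffAt.sum fun k _ =>
      (contDiffAt_inv_matOf hL i k).mul (contDiffAt_inv_matOf hL j k))
  exact h1

/-- The matrix of conjugation is a locally Lipschitz function of the linear map. -/
lemma exists_conjForm_lipschitz {L₀ : Amb d m →L[ℝ] Amb d m} (hL₀ : (matOf L₀).det ≠ 0) :
    ∃ η N : ℝ, 0 < η ∧ 0 ≤ N ∧ (∀ L ∈ ball L₀ η, (matOf L).det ≠ 0) ∧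
      ∀ L ∈ ball L₀ η, ∀ L' ∈ ball L₀ η, ∀ i j,
        |conjForm (matOf L) i j - conjForm (matOf L') i j| ≤ N * ‖L - L'‖ := by
  have h1 : ContDiffAt ℝ 1 (fun (L : Amb d m →L[ℝ] Amb d m) i j => conjForm (matOf L) i j) L₀ :=
    contDiffAt_pi.2 fun i => contDiffAt_pi.2 fun j => contDiffAt_conjForm hL₀ i j
  obtain ⟨N, t, ht, hN⟩ := h1.exists_lipschitzOnWith
  obtain ⟨η, hη, hsub⟩ := Metric.mem_nhds_iff.1 (inter_mem ht
    ((contDiffAt_det_matOf L₀).continuousAt.eventually_ne hL₀))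
  refine ⟨η, N, hη, N.2, fun L hL => (hsub hL).2, fun L hL L' hL' i j => ?_⟩
  have h2 := hN.dist_le_mul L (hsub hL).1 L' (hsub hL').1
  rw [dist_eq_norm L] at h2
  rw [← Real.dist_eq]
  exact ((dist_le_pi_dist (conjForm (matOf L) i) (conjForm (matOf L') i) j).trans
    (dist_le_pi_dist (fun i j => conjForm (matOf L) i j)
      (fun i j => conjForm (matOf L') i j) i)).trans h2

lemma baseL_single_inl (k : Fin d) :
    baseL (EuclideanSpace.single (Sum.inl k) 1 : Amb d m) = EuclideanSpace.single k 1 := by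
  ext l
  change (EuclideanSpace.single (Sum.inl k) 1 : Amb d m) (Sum.inl l) = _
  simp

lemma baseL_single_inr (k : Fin m) :
    baseL (EuclideanSpace.single (Sum.inr k) 1 : Amb d m) = 0 := by
  ext l
  change (EuclideanSpace.single (Sum.inr k) 1 : Amb d m) (Sum.inl l) = 0
  simp

lemma transv_single_inl (k : Fin d) :
    transv (EuclideanSpace.single (Sum.inl k) 1 : Amb d m) = 0 := by
  ext l
  simp [transv]

lemma transv_single_inr (k : Fin m) :
    transv (EuclideanSpace.single (Sum.inr k) 1 : Amb d m) = EuclideanSpace.single k 1 := by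
  ext l
  simp [transv]

/-- Orthogonality of B to the graph kills the mixed blocks, and conformality makes the transversal
block scalar. This is why the frame is built with these two properties. -/
lemma IsFrame.gram_frameMap (hB : IsFrame α c₀ δ M h B) {p : Param d m}
    (hp : p ∈ ball (0, c₀) δ) :
    (matOf (frameMap B p))ᵀ * matOf (frameMap B p) = Matrix.fromBlocks
      (Matrix.of fun k l => inner ℝ (pt (EuclideanSpace.single k 1) (p.1 (EuclideanSpace.single k 1)))
        (pt (EuclideanSpace.single l 1) (p.1 (EuclideanSpace.single l 1)) : Amb d m)) 0 0
      (h p ^ 2 • (1 : Matrix (Fin m) (Fin m) ℝ)) := by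
  ext i j
  have hl : ∀ k : Fin d, frameMap B p (EuclideanSpace.single (Sum.inl k) 1)
      = pt (EuclideanSpace.single k 1) (p.1 (EuclideanSpace.single k 1)) := fun k => by
    rw [frameMap_apply, baseL_single_inl, transv_single_inl, map_zero, add_zero]
  have hr : ∀ k : Fin m, frameMap B p (EuclideanSpace.single (Sum.inr k) 1)
      = B p (EuclideanSpace.single k 1) := fun k => by
    rw [frameMap_apply, baseL_single_inr, transv_single_inr, map_zero]
    have : (pt 0 0 : Amb d m) = 0 := map_zero ptL
    rw [this, zero_add]
  rw [dotProduct_matOf_mul]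
  rcases i with i | i <;> rcases j with j | j
  · rw [hl, hl]; rfl
  · rw [hl, hr, hB.orth p hp]; rfl
  · rw [hl, hr, real_inner_comm, hB.orth p hp]; rfl
  · rw [hr, hr, hB.conf p hp]
    rcases eq_or_ne i j with rfl | hij
    · simp
    · simp [hij, EuclideanSpace.inner_single_left]

/-- The conjugate of the identity depends only on the Gram matrix and the determinant, as N⁻¹N⁻ᵀ =
(NᵀN)⁻¹; block structure therefore passes from one to the other. -/
lemma conjForm_of_gram {N : Mat d m} (hN : N.det ≠ 0) {S : Matrix (Fin d) (Fin d) ℝ} {c : ℝ}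
    (hS : Nᵀ * N = Matrix.fromBlocks S 0 0 (c • 1)) :
    conjForm N = Matrix.fromBlocks (|N.det| • S⁻¹) 0 0 ((|N.det| * c⁻¹) • 1) := by
  have h1 : N⁻¹ * (N⁻¹)ᵀ = (Nᵀ * N)⁻¹ := by
    rw [Matrix.mul_inv_rev, Matrix.transpose_nonsing_inv]
  have h2 : (Nᵀ * N).det ≠ 0 := by
    rw [Matrix.det_mul, Matrix.det_transpose]; exact mul_ne_zero hN hN
  rw [hS, Matrix.det_fromBlocks_zero₁₂] at h2
  have hSu : IsUnit S := (Matrix.isUnit_iff_isUnit_det _).2 (isUnit_iff_ne_zero.2 (left_ne_zero_of_mul h2))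
  have hcu : IsUnit (c • (1 : Matrix (Fin m) (Fin m) ℝ)) :=
    (Matrix.isUnit_iff_isUnit_det _).2 (isUnit_iff_ne_zero.2 (right_ne_zero_of_mul h2))
  have h3 : (c • (1 : Matrix (Fin m) (Fin m) ℝ))⁻¹ = c⁻¹ • 1 := by
    rcases eq_or_ne c 0 with rfl | hc
    · simp
    · refine Matrix.inv_eq_right_inv ?_
      rw [Matrix.smul_mul, Matrix.mul_smul, Matrix.one_mul, smul_smul, mul_inv_cancel₀ hc, one_smul]
  rw [conjForm, h1, hS, Matrix.inv_fromBlocks_zero₁₂_of_isUnit_iff _ _ _ (by simp [hSu, hcu]), h3]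
  simp [Matrix.fromBlocks_smul, smul_smul]

lemma IsFrame.conjForm_frameMap_base (hB : IsFrame α c₀ δ M h B)
    (hdet : (matOf (frameMap B (0, c₀))).det ≠ 0) :
    conjForm (matOf (frameMap B (0, c₀))) = Matrix.fromBlocks
      (|(matOf (frameMap B (0, c₀))).det| • 1) 0 0
      ((|(matOf (frameMap B (0, c₀))).det| * (h (0, c₀) ^ 2)⁻¹) • 1) := by
  rw [conjForm_of_gram hdet (hB.gram_frameMap (mem_ball_self hB.pos))]
  have h1 : (Matrix.of fun k l : Fin d => (inner ℝ
      (pt (EuclideanSpace.single k 1) ((0 : EuclideanSpace ℝ (Fin d) →L[ℝ] EuclideanSpace ℝ (Fin m))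
        (EuclideanSpace.single k 1)))
      (pt (EuclideanSpace.single l 1) ((0 : EuclideanSpace ℝ (Fin d) →L[ℝ] EuclideanSpace ℝ (Fin m))
        (EuclideanSpace.single l 1)) : Amb d m) : ℝ)) = 1 := by
    ext k l
    rw [Matrix.of_apply, inner_pt]
    rcases eq_or_ne k l with rfl | hij
    · simp
    · simp [hij, EuclideanSpace.inner_single_left]
  rw [h1, inv_one]

lemma IsFrame.det_frameMap_base_ne_zero (hB : IsFrame α c₀ δ M h B) :
    (matOf (frameMap B (0, c₀))).det ≠ 0 := by
  rw [det_matOf]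
  intro h0
  have h1 : LinearMap.det (frameMap B (0, c₀)).toLinearMap = 0 := h0
  have h2 := LinearMap.bot_lt_ker_of_det_eq_zero h1
  obtain ⟨w, hw, hne⟩ := (Submodule.ne_bot_iff _).1 h2.ne'
  have h3 := (hB.norm_frameMap_base w).1
  have h4 : frameMap B (0, c₀) w = 0 := hw
  rw [h4, norm_zero] at h3
  have h5 : 0 < min 1 (h (0, c₀)) := lt_min one_pos (hB.h_pos _ (mem_ball_self hB.pos))
  have h6 := norm_pos_iff.2 hne
  nlinarith

end ConjugatedMatrix

/-! ### Degenerate ellipticity of matrices close to the base one. -/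

section Ellipticity

open Set Metric Filter Topology

variable {α c₀ δ M : ℝ} {h : Param d m → ℝ}
  {B : Param d m → EuclideanSpace ℝ (Fin m) →L[ℝ] Amb d m}
  {F : EuclideanSpace ℝ (Fin d) → EuclideanSpace ℝ (Fin m)} {K : ℝ≥0}
  {J : EuclideanSpace ℝ (Fin d) → ℝ}

lemma infDist_plane (z : Amb d m) : infDist z (plane d m) = ‖transv z‖ := by
  have hne : (plane d m).Nonempty := ⟨_, 0, rfl⟩
  refine le_antisymm ?_ ((le_infDist hne).2 ?_)
  · refine (infDist_le_dist_of_mem (show pt (baseL z) 0 ∈ plane d m from ⟨baseL z, rfl⟩)).trans ?_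
    rw [dist_eq_norm]
    nth_rw 1 [← pt_base_transv z]
    rw [← pt_sub, sub_self, sub_zero, norm_pt_zero_left]
  · rintro _ ⟨x, rfl⟩
    have h1 := norm_transv_le (z - pt x 0)
    rw [dist_eq_norm]
    rwa [← transvL_apply, map_sub, transvL_apply, transvL_apply, transv_pt, sub_zero] at h1

/-- The product is (r/s)^(m-1), and r/s lies between 1/2 and 2. It is the factor by which the
coefficient D^(1-m) differs from |t|^(1-m), and its deviation from 1 is linear in that of s/r. -/
lemma zpow_ratio_bounds {r s : ℝ} (hr : 0 < r) (hq : |s / r - 1| ≤ 1 / 2) {m : ℕ} (hm : 1 ≤ m) :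
    (1 / 2) ^ (m - 1) ≤ r ^ ((m : ℤ) - 1) * s ^ (1 - (m : ℤ)) ∧
      r ^ ((m : ℤ) - 1) * s ^ (1 - (m : ℤ)) ≤ 2 ^ (m - 1) ∧
      |r ^ ((m : ℤ) - 1) * s ^ (1 - (m : ℤ)) - 1| ≤ 2 * (m * 2 ^ m) * |s / r - 1| := by
  obtain ⟨k, rfl⟩ := Nat.exists_eq_add_of_le' hm
  have hq' := abs_le.1 hq
  have hq0 : 1 / 2 ≤ s / r := by linarith
  have hs : 0 < s := by
    have := (le_div_iff₀ hr).1 hq0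
    linarith
  have h1 : r ^ (((k + 1 : ℕ) : ℤ) - 1) * s ^ (1 - ((k + 1 : ℕ) : ℤ)) = (r / s) ^ k := by
    rw [show ((k + 1 : ℕ) : ℤ) - 1 = k by push_cast; ring,
      show 1 - ((k + 1 : ℕ) : ℤ) = -k by push_cast; ring, _root_.zpow_neg, zpow_natCast, zpow_natCast,
      div_pow, div_eq_mul_inv]
  have h2 : r / s ≤ 2 := by
    rw [div_le_iff₀ hs]
    have := (le_div_iff₀ hr).1 hq0
    linarith
  have h3 : 1 / 2 ≤ r / s := by
    rw [le_div_iff₀ hs]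
    have : s / r ≤ 2 := by linarith
    have := (div_le_iff₀ hr).1 this
    linarith
  have h4 : |r / s - 1| ≤ 2 * |s / r - 1| := by
    have : r / s - 1 = -((s / r - 1) * (r / s)) := by field_simp; ring
    rw [this, abs_neg, abs_mul, abs_of_pos (by linarith : 0 < r / s), mul_comm]
    gcongr
  rw [h1]
  rw [Nat.add_sub_cancel]
  refine ⟨pow_le_pow_left₀ (by norm_num) h3 _, pow_le_pow_left₀ (by linarith) h2 _, ?_⟩
  have h5 := abs_pow_sub_pow_le (r / s) 1 k
  rw [one_pow, abs_one, abs_of_pos (by linarith : 0 < r / s)] at h5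
  refine h5.trans ?_
  have h6 : max (r / s) 1 ^ (k - 1) ≤ 2 ^ (k + 1) :=
    (pow_le_pow_left₀ (by positivity) (max_le h2 one_le_two) _).trans
      (pow_le_pow_right₀ one_le_two (by omega))
  have h7 : (k : ℝ) ≤ (k + 1 : ℕ) := by push_cast; linarith
  calc |r / s - 1| * k * max (r / s) 1 ^ (k - 1)
      ≤ (2 * |s / r - 1|) * (k + 1 : ℕ) * 2 ^ (k + 1) := by gcongr
    _ = _ := by ring

lemma abs_dotProduct_mulVec_le {P : Mat d m} {b : ℝ} (hP : ∀ i j, |P i j| ≤ b) (ξ ζ : Amb d m) :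
    |(P *ᵥ ξ.ofLp) ⬝ᵥ ζ.ofLp| ≤ (d + m) ^ 2 * b * (‖ξ‖ * ‖ζ‖) := by
  have hc : ∀ (ξ : Amb d m) i, |ξ.ofLp i| ≤ ‖ξ‖ := fun ξ i => by
    simpa using PiLp.norm_apply_le ξ i
  have h1 : ∀ i j, |P i j * ξ.ofLp j * ζ.ofLp i| ≤ b * (‖ξ‖ * ‖ζ‖) := fun i j => by
    have hb : 0 ≤ b := (abs_nonneg _).trans (hP i j)
    rw [abs_mul, abs_mul, mul_assoc]
    exact mul_le_mul (hP i j) (mul_le_mul (hc ξ j) (hc ζ i) (abs_nonneg _) (norm_nonneg _))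
      (by positivity) hb
  have h2 : (P *ᵥ ξ.ofLp) ⬝ᵥ ζ.ofLp = ∑ i, ∑ j, P i j * ξ.ofLp j * ζ.ofLp i := by
    simp only [dotProduct, Matrix.mulVec, Finset.sum_mul]
  rw [h2]
  refine (Finset.abs_sum_le_sum_abs _ _).trans ?_
  refine (Finset.sum_le_sum fun i _ => (Finset.abs_sum_le_sum_abs _ _).trans
    (Finset.sum_le_sum fun j _ => h1 i j)).trans ?_
  simp only [Finset.sum_const, Finset.card_univ, Fintype.card_sum, Fintype.card_fin, nsmul_eq_mul]
  push_cast
  exact le_of_eq (by ring)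

lemma matNorm_le {P : Mat d m} {b : ℝ} (hb : 0 ≤ b) (hP : ∀ i j, |P i j| ≤ b) :
    matNorm P ≤ (d + m) * b := by
  rw [matNorm, Real.sqrt_le_left (by positivity)]
  refine (Finset.sum_le_sum fun i _ => Finset.sum_le_sum fun j _ =>
    sq_le_sq.2 ((hP i j).trans (le_abs_self b))).trans ?_
  simp only [Finset.sum_const, Finset.card_univ, Fintype.card_sum, Fintype.card_fin, nsmul_eq_mul]
  push_cast
  exact le_of_eq (by ring)

lemma dotProduct_fromBlocks_mulVec (a b : ℝ) (ξ : Amb d m) :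
    (Matrix.fromBlocks (a • (1 : Matrix (Fin d) (Fin d) ℝ)) 0 0 (b • 1) *ᵥ ξ.ofLp) ⬝ᵥ ξ.ofLp
      = a * ‖baseL ξ‖ ^ 2 + b * ‖transv ξ‖ ^ 2 := by
  rw [EuclideanSpace.norm_sq_eq, EuclideanSpace.norm_sq_eq, Matrix.fromBlocks_mulVec]
  simp only [dotProduct, Fintype.sum_sum_type, Sum.elim_inl, Sum.elim_inr, Matrix.zero_mulVec,
    add_zero, zero_add, Matrix.smul_mulVec, Matrix.one_mulVec, Pi.smul_apply, Function.comp_apply,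
    smul_eq_mul, Finset.mul_sum, Real.norm_eq_abs, sq_abs]
  congr 1
  · exact Finset.sum_congr rfl fun i _ => by
      change _ = a * ξ.ofLp (Sum.inl i) ^ 2; ring
  · exact Finset.sum_congr rfl fun i _ => by
      change _ = b * ξ.ofLp (Sum.inr i) ^ 2; ring

/-- Matrices close to the base conjugate matrix, up to a bounded factor, are elliptic. -/
lemma IsFrame.exists_isDegElliptic (hB : IsFrame α c₀ δ M h B) :
    ∃ θ C : ℝ, 0 < θ ∧ 1 ≤ C ∧ ∀ A : Amb d m → Mat d m, (∀ z ∉ plane d m, ∃ (Θ : ℝ) (P : Mat d m),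
      (1 / 2) ^ (m - 1) ≤ Θ ∧ Θ ≤ 2 ^ (m - 1) ∧
      (∀ i j, |P i j - conjForm (matOf (frameMap B (0, c₀))) i j| ≤ θ) ∧
      ‖transv z‖ ^ ((m : ℤ) - 1) • A z = Θ • P) →
      ∀ C', C ≤ C' → IsDegElliptic C' (plane d m) A := by
  have hdet := hB.det_frameMap_base_ne_zero
  set Ψ := conjForm (matOf (frameMap B (0, c₀))) with hΨ
  set D := |(matOf (frameMap B (0, c₀))).det| with hDdef
  have hD : 0 < D := abs_pos.2 hdet
  have hh := hB.h_pos _ (mem_ball_self hB.pos)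
  set b := (h (0, c₀) ^ 2)⁻¹ with hb
  have hb0 : 0 < b := by positivity
  -- The base matrix is D times the block diagonal matrix with blocks 1 and h₀^(-2), so l bounds its
  -- quadratic form from below.
  set l := D * min 1 b with hl
  have hl0 : 0 < l := mul_pos hD (lt_min one_pos hb0)
  have hlow : ∀ ξ : Amb d m, l * ‖ξ‖ ^ 2 ≤ (Ψ *ᵥ ξ.ofLp) ⬝ᵥ ξ.ofLp := fun ξ => by
    rw [hΨ, hB.conjForm_frameMap_base hdet, dotProduct_fromBlocks_mulVec, norm_sq_eq_base_transv,
      mul_add, hl]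
    gcongr
    · nlinarith [min_le_left 1 b]
    · exact min_le_right _ _
  obtain ⟨Λ, hΛ⟩ : ∃ Λ, ∀ i j, |Ψ i j| ≤ Λ :=
    ⟨∑ i, ∑ j, |Ψ i j|, fun i j =>
      (Finset.single_le_sum (f := fun j => |Ψ i j|) (fun _ _ => abs_nonneg _)
        (Finset.mem_univ j)).trans (Finset.single_le_sum (f := fun i => ∑ j, |Ψ i j|)
        (fun _ _ => Finset.sum_nonneg fun _ _ => abs_nonneg _) (Finset.mem_univ i))⟩
  set n : ℝ := (d + m) ^ 2 with hn
  have hn0 : 0 ≤ n := by positivity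
  -- A perturbation with entries at most θ changes the quadratic form by at most nθ|ξ|², hence costs
  -- at most half of l.
  set θ := l / 2 / (n + 1) with hθ
  have hθ0 : 0 < θ := by positivity
  have hnθ : n * θ ≤ l / 2 := by
    rw [hθ, mul_div_assoc', div_le_iff₀ (by positivity)]
    nlinarith
  set c₁ : ℝ := (1 / 2) ^ (m - 1) with hc₁
  set c₂ : ℝ := 2 ^ (m - 1) with hc₂
  have hc₁0 : 0 < c₁ := by positivity
  have hc₂0 : 0 < c₂ := by positivity
  set lo := c₁ * (l / 2) with hlo
  set hi := c₂ * (n * (|Λ| + θ)) with hhi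
  have hlo0 : 0 < lo := by positivity
  refine ⟨θ, max 1 (max lo⁻¹ hi), hθ0, le_max_left _ _, fun A hA C' hC' z hz => ?_⟩
  obtain ⟨Θ, P, h1, h2, h3, h4⟩ := hA z hz
  have hC1 : lo⁻¹ ≤ C' := ((le_max_left _ _).trans (le_max_right _ _)).trans hC'
  have hC2 : hi ≤ C' := ((le_max_right _ _).trans (le_max_right _ _)).trans hC'
  have hC0 : 0 < C' := one_pos.trans_le ((le_max_left _ _).trans hC')
  have hC3 : C'⁻¹ ≤ lo := by rwa [inv_le_comm₀ hC0 hlo0]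
  have hΘ0 : 0 < Θ := hc₁0.trans_le h1
  have h5 : ∀ ξ ζ : Amb d m, infDist z (plane d m) ^ ((m : ℤ) - 1) * ((A z *ᵥ ξ.ofLp) ⬝ᵥ ζ.ofLp)
      = Θ * ((P *ᵥ ξ.ofLp) ⬝ᵥ ζ.ofLp) := fun ξ ζ => by
    rw [infDist_plane, ← smul_eq_mul, ← smul_dotProduct, ← Matrix.smul_mulVec, h4,
      Matrix.smul_mulVec, smul_dotProduct, smul_eq_mul]
  refine ⟨fun ξ ζ => ?_, fun ξ => ?_⟩
  · rw [h5]
    have h6 : ∀ i j, |P i j| ≤ |Λ| + θ := fun i j => by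
      have e1 := h3 i j
      have e2 := hΛ i j
      have e3 := abs_sub_abs_le_abs_sub (P i j) (Ψ i j)
      have e4 := le_abs_self Λ
      linarith
    have h7 := (le_abs_self _).trans (abs_dotProduct_mulVec_le h6 ξ ζ)
    calc Θ * ((P *ᵥ ξ.ofLp) ⬝ᵥ ζ.ofLp) ≤ Θ * (n * (|Λ| + θ) * (‖ξ‖ * ‖ζ‖)) := by gcongr
      _ ≤ c₂ * (n * (|Λ| + θ) * (‖ξ‖ * ‖ζ‖)) := by gcongr
      _ = hi * (‖ξ‖ * ‖ζ‖) := by rw [hhi]; ring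
      _ ≤ C' * (‖ξ‖ * ‖ζ‖) := by gcongr
      _ = _ := by ring
  · rw [h5]
    have h7 := neg_abs_le _ |>.trans' (neg_le_neg
      (abs_dotProduct_mulVec_le (P := P - Ψ) (fun i j => h3 i j) ξ ξ))
    rw [Matrix.sub_mulVec, sub_dotProduct] at h7
    have h8 : l / 2 * ‖ξ‖ ^ 2 ≤ (P *ᵥ ξ.ofLp) ⬝ᵥ ξ.ofLp := by
      have e1 := hlow ξ
      have e2 : n * θ * (‖ξ‖ * ‖ξ‖) ≤ l / 2 * (‖ξ‖ * ‖ξ‖) := by gcongr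
      have e3 : ‖ξ‖ ^ 2 = ‖ξ‖ * ‖ξ‖ := sq _
      rw [e3] at e1 ⊢
      linarith
    calc C'⁻¹ * ‖ξ‖ ^ 2 ≤ lo * ‖ξ‖ ^ 2 := by gcongr
      _ = c₁ * (l / 2 * ‖ξ‖ ^ 2) := by rw [hlo]; ring
      _ ≤ Θ * ((P *ᵥ ξ.ofLp) ⬝ᵥ ξ.ofLp) := by gcongr

lemma tendsto_frameDev (d : ℕ) (M : ℝ) : Tendsto (fun τ => frameDev d M τ) (𝓝[>] 0) (𝓝 0) := by
  have hc : Continuous fun τ => frameDev d M τ := by unfold frameDev; fun_prop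
  have := hc.tendsto 0
  rw [show frameDev d M 0 = 0 by simp [frameDev]] at this
  exact this.mono_left nhdsWithin_le_nhds

/-- The conjugate matrix of the flattening is close to that of the frame. -/
lemma IsFrame.exists_conjForm_estimate (hB : IsFrame α c₀ δ M h B) {θ : ℝ} (hθ : 0 < θ) :
    ∃ τ₀ N : ℝ, 0 < τ₀ ∧ τ₀ < δ ∧ 0 ≤ N ∧ ∀ F K J, IsGraphData c₀ F K J →
      (∀ y, ‖graphField F J y - (0, c₀)‖ ≤ τ₀) → ∀ z ∉ plane d m,
      (matOf (fderiv ℝ (flattening B F J) z)).det ≠ 0 ∧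
      (matOf (frameMap B (graphParam F J (baseL z) ‖transv z‖))).det ≠ 0 ∧
      (∀ i j, |conjForm (matOf (fderiv ℝ (flattening B F J) z)) i j
        - conjForm (matOf (frameMap B (0, c₀))) i j| ≤ θ) ∧
      (∀ i j, |conjForm (matOf (frameMap B (graphParam F J (baseL z) ‖transv z‖))) i j
        - conjForm (matOf (frameMap B (0, c₀))) i j| ≤ θ) ∧
      ∀ i j, |conjForm (matOf (fderiv ℝ (flattening B F J) z)) i j
        - conjForm (matOf (frameMap B (graphParam F J (baseL z) ‖transv z‖))) i j|
          ≤ N * osc (graphField F J) (baseL z) ‖transv z‖ := by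
  obtain ⟨η, N, hη, hN, hdet, hlip⟩ := exists_conjForm_lipschitz hB.det_frameMap_base_ne_zero
  -- η keeps both linear maps where conjugation is Lipschitz; θ/(N+1) makes the resulting deviation
  -- at most θ, also when N = 0.
  have hη' : 0 < min η (θ / (N + 1)) := lt_min hη (by positivity)
  obtain ⟨τ₀, ⟨h1, h2⟩, h3⟩ := (((tendsto_frameDev d M).eventually_lt_const hη').and
    (Ioo_mem_nhdsGT hB.pos)).and self_mem_nhdsWithin |>.exists
  refine ⟨τ₀, N * (1 + |M| * (d + 1)), h3, h2.2, by positivity, fun F K J hD hτ z hz => ?_⟩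
  have hτ0 : 0 < τ₀ := h3
  have hP0 := profMass_nonneg (EuclideanSpace ℝ (Fin d))
  set p := graphParam F J (baseL z) ‖transv z‖ with hp
  have hpτ : ‖p - (0, c₀)‖ ≤ τ₀ := hD.norm_graphParam_sub_le hτ _ _
  have e1 := hB.norm_fderiv_flattening_sub_le hD hτ h2.2 hz
  have e2 : ‖frameMap B p - frameMap B (0, c₀)‖ ≤ frameDev d M τ₀ := by
    refine (hB.norm_frameMap_sub_le (by
      rw [mem_ball, dist_eq_norm]; exact hpτ.trans_lt h2.2)).trans ?_
    unfold frameDev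
    have : (1 + |M|) * ‖p - (0, c₀)‖ ≤ (1 + |M|) * τ₀ := by gcongr
    have : 0 ≤ (1 + |M| * (d + 1)) * (profMass (EuclideanSpace ℝ (Fin d)) * τ₀) := by positivity
    linarith
  have hNθ : N * frameDev d M τ₀ ≤ θ := by
    have e3 : frameDev d M τ₀ ≤ θ / (N + 1) := (h1.trans_le (min_le_right _ _)).le
    have e4 : N * (θ / (N + 1)) ≤ θ := by
      rw [mul_div_assoc', div_le_iff₀ (by positivity)]; nlinarith
    exact (mul_le_mul_of_nonneg_left e3 hN).trans e4
  have m1 : fderiv ℝ (flattening B F J) z ∈ ball (frameMap B (0, c₀)) η := by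
    rw [mem_ball, dist_eq_norm]; exact e1.trans_lt (h1.trans_le (min_le_left _ _))
  have m2 : frameMap B p ∈ ball (frameMap B (0, c₀)) η := by
    rw [mem_ball, dist_eq_norm]; exact e2.trans_lt (h1.trans_le (min_le_left _ _))
  have m0 := mem_ball_self (x := frameMap B (0, c₀)) hη
  refine ⟨hdet _ m1, hdet _ m2,
    fun i j => (hlip _ m1 _ m0 i j).trans ((mul_le_mul_of_nonneg_left e1 hN).trans hNθ),
    fun i j => (hlip _ m2 _ m0 i j).trans ((mul_le_mul_of_nonneg_left e2 hN).trans hNθ),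
    fun i j => (hlip _ m1 _ m2 i j).trans ?_⟩
  obtain ⟨D, hD1, hD2⟩ := hB.hasFDerivAt_flattening hD hτ h2.2 hz
  rw [hD1.fderiv, mul_assoc]
  exact mul_le_mul_of_nonneg_left hD2 hN

end Ellipticity

/-! ### The principal part, its scalar coefficient, and measurability. -/

section Splitting

open Set Metric Filter Topology

variable {α c₀ δ M : ℝ} {h : Param d m → ℝ}
  {B : Param d m → EuclideanSpace ℝ (Fin m) →L[ℝ] Amb d m}
  {F : EuclideanSpace ℝ (Fin d) → EuclideanSpace ℝ (Fin m)} {K : ℝ≥0}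
  {J : EuclideanSpace ℝ (Fin d) → ℝ}

/-- Rewriting the Hausdorff integral with the density J turns it into a parametrised Lebesgue
integral of a jointly measurable function. -/
lemma IsGraphData.measurable_smoothDist (hD : IsGraphData c₀ F K J) (α : ℝ) :
    Measurable (smoothDist α (graphOf F)) := by
  have h1 : smoothDist α (graphOf F) = fun X => (∫ y, J y * ‖X - pt y (F y)‖ ^ (-(d : ℝ) - α))
      ^ (-1 / α) := by
    funext X
    rw [smoothDist, hD.density (fun y => ‖X - y‖ ^ (-(d : ℝ) - α)) (by fun_prop)]
  rw [h1]
  have h2 : Measurable fun y : EuclideanSpace ℝ (Fin d) => (pt y (F y) : Amb d m) :=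
    (ptL.continuous.comp (continuous_id.prodMk hD.lip.continuous)).measurable
  have h3 : Measurable (Function.uncurry fun (X : Amb d m) (y : EuclideanSpace ℝ (Fin d)) =>
      J y * ‖X - pt y (F y)‖ ^ (-(d : ℝ) - α)) :=
    (hD.meas.comp measurable_snd).mul
      (((measurable_fst.sub (h2.comp measurable_snd)).norm).pow_const _)
  exact (h3.stronglyMeasurable.integral_prod_right).measurable.pow_const _

lemma IsGraphData.hasFDerivAt_graphParam (hD : IsGraphData c₀ F K J)
    {τ : ℝ} (hτ : ∀ y, ‖graphField F J y - (0, c₀)‖ ≤ τ) {z : Amb d m} (hz : z ∉ plane d m) :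
    ∃ L : Amb d m →L[ℝ] Param d m, HasFDerivAt (fun z : Amb d m => graphParam F J (baseL z) ‖transvL z‖) L z ∧
      ‖L‖ ≤ (d + 1) * (‖transv z‖⁻¹ * osc (graphField F J) (baseL z) ‖transv z‖) := by
  have hr : 0 < ‖transv z‖ := norm_transv_pos hz
  have hν : DifferentiableAt ℝ (fun z : Amb d m => ‖transvL z‖) z :=
    (transvL.differentiableAt).norm ℝ (norm_pos_iff.1 hr)
  set ν := fderiv ℝ (fun z : Amb d m => ‖transvL z‖) z with hνd
  have hν1 : ‖ν‖ ≤ 1 := by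
    have hl : LipschitzWith 1 fun z : Amb d m => ‖transvL z‖ := LipschitzWith.of_dist_le_mul
      fun a b => by
        rw [Real.dist_eq, dist_eq_norm, NNReal.coe_one, one_mul]
        refine (abs_norm_sub_norm_le _ _).trans ?_
        rw [← map_sub]
        exact norm_transv_le _
    exact norm_fderiv_le_of_lipschitz ℝ hl
  have hιd : HasFDerivAt (fun z : Amb d m => (baseL z, ‖transvL z‖)) (baseL.prod ν) z :=
    baseL.hasFDerivAt.prodMk hν.hasFDerivAt
  obtain ⟨L, hL, hLn⟩ := hasFDerivAt_avg_bump hD.measurable_graphField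
    (norm_graphField_le hτ) (baseL z) hr
  rw [finrank_euclideanSpace_fin] at hLn
  refine ⟨L ∘L baseL.prod ν, ?_, ?_⟩
  · have e := HasFDerivAt.comp z hL hιd
    exact e
  · have h0 := osc_nonneg (graphField F J) (baseL z) ‖transv z‖
    refine ContinuousLinearMap.opNorm_le_bound _ (by positivity) fun w => ?_
    refine (L.le_of_opNorm_le hLn _).trans ?_
    gcongr
    change ‖(baseL w, ν w)‖ ≤ _
    rw [Prod.norm_def]
    exact max_le (norm_baseL_le w) ((ν.le_of_opNorm_le hν1 w).trans (one_mul _).le)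

lemma IsFrame.contDiffOn_frameMap (hB : IsFrame α c₀ δ M h B) :
    ContDiffOn ℝ 1 (frameMap B) (ball (0, c₀) δ) := by
  have h1 : ContDiff ℝ 1 fun p : Param d m => (inclB ∘L baseL : Amb d m →L[ℝ] Amb d m)
      + inclT ∘L p.1 ∘L baseL :=
    contDiff_const.add (contDiff_const.clm_comp (contDiff_fst.clm_comp contDiff_const))
  exact h1.contDiffOn.add (hB.contDiffOn_B.clm_comp contDiffOn_const)

/-- The scalar transversal coefficient of the conjugated operator at a frame, up to homogeneity. -/
def frameCoeff (h : Param d m → ℝ) (B : Param d m → EuclideanSpace ℝ (Fin m) →L[ℝ] Amb d m)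
    (p : Param d m) : ℝ :=
  |(matOf (frameMap B p)).det| * (h p ^ 2)⁻¹

lemma IsFrame.contDiffAt_frameCoeff (hB : IsFrame α c₀ δ M h B) {p : Param d m}
    (hp : p ∈ ball (0, c₀) δ) (hdet : (matOf (frameMap B p)).det ≠ 0) :
    ContDiffAt ℝ 1 (frameCoeff h B) p := by
  have hn := isOpen_ball.mem_nhds hp
  have h1 : ContDiffAt ℝ 1 (fun p => |(matOf (frameMap B p)).det|) p := by
    have e := (contDiffAt_abs_det_matOf hdet).comp p (hB.contDiffOn_frameMap.contDiffAt hn)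
    exact e
  exact h1.mul (((hB.contDiffOn_h.contDiffAt hn).pow 2).inv (pow_pos (hB.h_pos p hp) 2).ne')

/-- The scalar transversal coefficient of the conjugated operator. -/
def transvCoeff (h : Param d m → ℝ) (B : Param d m → EuclideanSpace ℝ (Fin m) →L[ℝ] Amb d m)
    (F : EuclideanSpace ℝ (Fin d) → EuclideanSpace ℝ (Fin m))
    (J : EuclideanSpace ℝ (Fin d) → ℝ) (z : Amb d m) : ℝ :=
  ‖transv z‖ ^ (1 - (m : ℤ)) * frameCoeff h B (graphParam F J (baseL z) ‖transv z‖)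

/-- The principal part of the conjugated matrix. -/
def principalMatrix (B : Param d m → EuclideanSpace ℝ (Fin m) →L[ℝ] Amb d m)
    (F : EuclideanSpace ℝ (Fin d) → EuclideanSpace ℝ (Fin m))
    (J : EuclideanSpace ℝ (Fin d) → ℝ) : Amb d m → Mat d m :=
  -- The value 0 on the plane makes the matrix Borel on the whole space by continuity on the open
  -- complement alone.
  (plane d m)ᶜ.indicator fun z => ‖transv z‖ ^ (1 - (m : ℤ)) •
    conjForm (matOf (frameMap B (graphParam F J (baseL z) ‖transv z‖)))

lemma zpow_norm_transv_mul {z : Amb d m} (hz : z ∉ plane d m) :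
    ‖transv z‖ ^ ((m : ℤ) - 1) * ‖transv z‖ ^ (1 - (m : ℤ)) = 1 := by
  rw [← zpow_add₀ (norm_transv_pos hz).ne']
  simp

/-- The factor |t|^(m-1) leaves a C¹ function of p(x,|t|). Its gradient is O(osc/|t|), since
derivatives of averages are, and the prefactor |t| removes the singularity. -/
lemma IsFrame.exists_transvCoeff_estimate (hB : IsFrame α c₀ δ M h B) :
    ∃ τ₀ N : ℝ, 0 < τ₀ ∧ 0 ≤ N ∧ ∀ F K J, IsGraphData c₀ F K J →
      (∀ y, ‖graphField F J y - (0, c₀)‖ ≤ τ₀) →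
      ContDiffOn ℝ 1 (transvCoeff h B F J) (plane d m)ᶜ ∧ ∀ z ∉ plane d m,
      ‖transv z‖ * ‖gradient (fun w => ‖transv w‖ ^ ((m : ℤ) - 1) * transvCoeff h B F J w) z‖
        ≤ N * osc (graphField F J) (baseL z) ‖transv z‖ := by
  have hp₀ := mem_ball_self (x := ((0, c₀) : Param d m)) hB.pos
  have hc := hB.contDiffAt_frameCoeff hp₀ hB.det_frameMap_base_ne_zero
  obtain ⟨N, t, ht, hN⟩ := hc.exists_lipschitzOnWith
  obtain ⟨τ₁, hτ₁, hsub⟩ := Metric.mem_nhds_iff.1 (inter_mem ht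
    (hc.eventually (by simp)))
  refine ⟨τ₁ / 2, N * (d + 1), by positivity, by positivity, fun F K J hD hτ => ?_⟩
  have hmem : ∀ z : Amb d m, graphParam F J (baseL z) ‖transv z‖ ∈ ball ((0, c₀) : Param d m) τ₁ :=
    fun z => by
      rw [mem_ball, dist_eq_norm]
      exact (hD.norm_graphParam_sub_le hτ _ _).trans_lt (by linarith)
  have hcd : ContDiffOn ℝ 1 (frameCoeff h B) (ball (0, c₀) τ₁) :=
    fun p hp => ContDiffAt.contDiffWithinAt (show ContDiffAt ℝ 1 (frameCoeff h B) p from (hsub hp).2)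
  have hopen : IsOpen (plane d m)ᶜ := isClosed_plane.isOpen_compl
  refine ⟨?_, fun z hz => ?_⟩
  · have h1 : ContDiffOn ℝ 1 (fun z : Amb d m =>
        frameCoeff h B (graphParam F J (baseL z) ‖transv z‖)) (plane d m)ᶜ := by
      have e := hcd.comp (hD.contDiffOn_graphParam hτ) fun z _ => hmem z
      exact e
    have h2 : ContDiffOn ℝ 1 (fun z : Amb d m => ‖transvL z‖ ^ (1 - (m : ℤ))) (plane d m)ᶜ :=
      fun z hz => ContDiffAt.contDiffWithinAt (by
        have hn : ContDiffAt ℝ 1 (fun z : Amb d m => ‖transvL z‖) z :=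
          transvL.contDiff.contDiffAt.norm ℝ (norm_pos_iff.1 (norm_transv_pos hz))
        have hz' : ContDiffAt ℝ 1 (fun x : ℝ => x ^ (1 - (m : ℤ))) ‖transvL z‖ :=
          (analyticAt_id.zpow (norm_transv_pos hz).ne').contDiffAt
        exact hz'.comp z hn)
    exact h2.mul h1
  · obtain ⟨L, hL, hLn⟩ := hD.hasFDerivAt_graphParam hτ hz
    have hr := norm_transv_pos hz
    have hev : (fun w => ‖transv w‖ ^ ((m : ℤ) - 1) * transvCoeff h B F J w)
        =ᶠ[𝓝 z] fun w => frameCoeff h B (graphParam F J (baseL w) ‖transvL w‖) := by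
      filter_upwards [hopen.mem_nhds hz] with w hw
      rw [transvCoeff, ← mul_assoc, zpow_norm_transv_mul hw, one_mul, transvL_apply]
    have hdf := (show ContDiffAt ℝ 1 (frameCoeff h B) _ from (hsub (hmem z)).2).differentiableAt
      one_ne_zero
    have hfd : ‖fderiv ℝ (frameCoeff h B) (graphParam F J (baseL z) ‖transv z‖)‖ ≤ N := by
      refine hdf.hasFDerivAt.le_of_lip' N.2 ?_
      filter_upwards [isOpen_ball.mem_nhds (hmem z)] with q hq
      have := hN.dist_le_mul q (hsub hq).1 _ (hsub (hmem z)).1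
      rwa [dist_eq_norm, dist_eq_norm] at this
    have hcomp : HasFDerivAt (fun w : Amb d m =>
        frameCoeff h B (graphParam F J (baseL w) ‖transvL w‖))
        ((fderiv ℝ (frameCoeff h B) (graphParam F J (baseL z) ‖transv z‖)) ∘L L) z := by
      have e := HasFDerivAt.comp z (f := fun w : Amb d m => graphParam F J (baseL w) ‖transvL w‖)
        (g := frameCoeff h B) hdf.hasFDerivAt hL
      exact e
    rw [gradient, LinearIsometryEquiv.norm_map, (hcomp.congr_of_eventuallyEq hev).fderiv]
    have h3 : ‖(fderiv ℝ (frameCoeff h B) (graphParam F J (baseL z) ‖transv z‖)) ∘L L‖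
        ≤ N * ((d + 1) * (‖transv z‖⁻¹ * osc (graphField F J) (baseL z) ‖transv z‖)) :=
      (ContinuousLinearMap.opNorm_comp_le _ _).trans
        (mul_le_mul hfd hLn (norm_nonneg _) N.2)
    refine (mul_le_mul_of_nonneg_left h3 hr.le).trans (le_of_eq ?_)
    field_simp

lemma measurable_indicator_of_continuousOn {X : Type*} [TopologicalSpace X] [MeasurableSpace X]
    [OpensMeasurableSpace X] {f : X → ℝ} {s : Set X} (hs : IsOpen s) (hf : ContinuousOn f s) :
    Measurable (s.indicator f) := by
  classical
  rw [← piecewise_eq_indicator]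
  exact hf.measurable_piecewise continuousOn_const hs.measurableSet

lemma measurable_indicator_conjForm {f : Amb d m → Amb d m →L[ℝ] Amb d m}
    (hf : ContinuousOn f (plane d m)ᶜ) (hdet : ∀ z ∉ plane d m, (matOf (f z)).det ≠ 0)
    (i j : Fin d ⊕ Fin m) :
    Measurable ((plane d m)ᶜ.indicator fun z => conjForm (matOf (f z)) i j) :=
  measurable_indicator_of_continuousOn isClosed_plane.isOpen_compl fun z hz => by
    have h1 := (contDiffAt_conjForm (hdet z hz) i j).continuousAt
    exact ContinuousAt.comp_continuousWithinAt (f := f)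
      (g := fun L => conjForm (matOf L) i j) h1 (hf z hz)

lemma measurable_transv : Measurable (transv : Amb d m → EuclideanSpace ℝ (Fin m)) :=
  transvL.continuous.measurable

lemma measurable_principalMatrix (hB : IsFrame α c₀ δ M h B) (hD : IsGraphData c₀ F K J)
    {τ : ℝ} (hτ : ∀ y, ‖graphField F J y - (0, c₀)‖ ≤ τ) (hτδ : τ < δ)
    (hdet : ∀ z ∉ plane d m, (matOf (frameMap B (graphParam F J (baseL z) ‖transv z‖))).det ≠ 0)
    (i j : Fin d ⊕ Fin m) : Measurable fun z => principalMatrix B F J z i j := by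
  have h1 : ContinuousOn (fun z : Amb d m => frameMap B (graphParam F J (baseL z) ‖transv z‖))
      (plane d m)ᶜ :=
    hB.contDiffOn_frameMap.continuousOn.comp (hD.contDiffOn_graphParam hτ).continuousOn
      fun z _ => by
        rw [mem_ball, dist_eq_norm]; exact (hD.norm_graphParam_sub_le hτ _ _).trans_lt hτδ
  have h2 := ((measurable_transv (d := d) (m := m)).norm.pow_const (1 - (m : ℤ))).mul
    (measurable_indicator_conjForm h1 hdet i j)
  convert h2 using 1
  funext z
  by_cases hz : z ∈ (plane d m)ᶜ
  · simp [principalMatrix, hz]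
  · simp [principalMatrix, hz]

lemma measurable_conjMatrix (hB : IsFrame α c₀ δ M h B) (hD : IsGraphData c₀ F K J)
    {τ : ℝ} (hτ : ∀ y, ‖graphField F J y - (0, c₀)‖ ≤ τ) (hτδ : τ < δ)
    (hdet : ∀ z ∉ plane d m, (matOf (fderiv ℝ (flattening B F J) z)).det ≠ 0)
    (i j : Fin d ⊕ Fin m) : Measurable fun z => (plane d m)ᶜ.indicator
      (conjMatrix (flattening B F J) (coeff α (graphOf F))) z i j := by
  have h1 : ContinuousOn (fderiv ℝ (flattening B F J)) (plane d m)ᶜ :=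
    (hB.contDiffOn_flattening hD hτ hτδ).continuousOn_fderiv_of_isOpen
      isClosed_plane.isOpen_compl le_rfl
  have h2 := (((hD.measurable_smoothDist α).comp
    (hB.continuous_flattening hD hτ hτδ).measurable).pow_const (1 - (m : ℤ))).mul
    (measurable_indicator_conjForm h1 hdet i j)
  convert h2 using 1
  funext z
  by_cases hz : z ∈ (plane d m)ᶜ
  · simp [conjMatrix_coeff, hz]
  · simp [hz]

end Splitting

/-! ### From the half space to the ambient space. -/

section Transfer

open Set Metric Filter Topology

variable {α c₀ δ M : ℝ} {h : Param d m → ℝ}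
  {B : Param d m → EuclideanSpace ℝ (Fin m) →L[ℝ] Amb d m}
  {F : EuclideanSpace ℝ (Fin d) → EuclideanSpace ℝ (Fin m)} {K : ℝ≥0}
  {J : EuclideanSpace ℝ (Fin d) → ℝ}

/-- Carleson measures on the half space give Carleson measures on `ℝⁿ`. -/
lemma sqMeasure_ball_le (hm : 1 ≤ m) {q : EuclideanSpace ℝ (Fin d) → ℝ → ℝ≥0∞}
    (hq : Measurable (Function.uncurry q)) {C : ℝ≥0∞} (hC : HalfCarleson C q) {f : Amb d m → ℝ}
    (hf : ∀ z ∉ plane d m, ‖f z‖ₑ ^ 2 ≤ q (baseL z) ‖transv z‖)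
    (x : EuclideanSpace ℝ (Fin d)) {r : ℝ} (hr : 0 < r) :
    sqMeasure f (ball (pt x 0) r)
      ≤ (volume : Measure (EuclideanSpace ℝ (Fin m))).toSphere univ * C * ENNReal.ofReal r ^ d := by
  have : Nontrivial (EuclideanSpace ℝ (Fin m)) :=
    Module.nontrivial_of_finrank_pos (R := ℝ) (by rw [finrank_euclideanSpace_fin]; omega)
  set g : ℝ → ℝ≥0∞ := (Iio r).indicator fun s => ∫⁻ y in ball x r, q y s with hg
  have hgm : Measurable g :=
    (Measurable.lintegral_prod_right' (hq.comp measurable_swap)).indicator measurableSet_Iio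
  set G : EuclideanSpace ℝ (Fin d) × EuclideanSpace ℝ (Fin m) → ℝ≥0∞ := fun p =>
    ENNReal.ofReal ((‖p.2‖ ^ m)⁻¹) * (ball x r ×ˢ ball 0 r).indicator
      (fun p => q p.1 ‖p.2‖) p with hG
  have hqm : Measurable fun p : EuclideanSpace ℝ (Fin d) × EuclideanSpace ℝ (Fin m) =>
      q p.1 ‖p.2‖ := hq.comp (measurable_fst.prodMk measurable_snd.norm)
  have hGm : Measurable G := by
    refine Measurable.mul (by fun_prop) (hqm.indicator ?_)
    exact measurableSet_ball.prod measurableSet_ball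
  have hpl : (ptL : _ ≃L[ℝ] Amb d m).symm = fun z : Amb d m => (baseL z, transvL z) := by
    funext z
    rw [ContinuousLinearEquiv.symm_apply_eq, ptL_apply]
    exact (pt_base_transv z).symm
  have h1 : sqMeasure f (ball (pt x 0) r) ≤ ∫⁻ z : Amb d m, G (baseL z, transvL z) := by
    rw [sqMeasure, withDensity_apply _ measurableSet_ball, ← lintegral_indicator measurableSet_ball]
    refine lintegral_mono fun z => ?_
    by_cases hz : z ∈ ball (pt x 0 : Amb d m) r
    · rw [indicator_of_mem hz]
      by_cases hzp : z ∈ plane d m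
      -- On the plane the density is 0: the denominator is 0^m = 0 because m ≥ 1, and division by
      -- zero gives zero.
      · rw [(mem_plane_iff z).1 hzp]
        simp [show m ≠ 0 by omega]
      · have hmem : (baseL z, transvL z) ∈ ball x r ×ˢ ball (0 : EuclideanSpace ℝ (Fin m)) r := by
          rw [mem_ball, dist_eq_norm] at hz
          refine ⟨?_, ?_⟩
          · rw [mem_ball, dist_eq_norm]
            refine lt_of_le_of_lt ?_ hz
            have := norm_baseL_le (z - pt x 0)
            rwa [map_sub, baseL_pt] at this
          · rw [mem_ball, dist_zero_right]
            refine lt_of_le_of_lt ?_ hz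
            have := norm_transv_le (z - pt x 0)
            rwa [← transvL_apply, map_sub, transvL_apply _ , transvL_apply (pt x 0), transv_pt,
              sub_zero] at this
        simp only [hG]
        rw [indicator_of_mem hmem, div_eq_inv_mul, ENNReal.ofReal_mul (by positivity)]
        refine mul_le_mul' le_rfl ?_
        have := hf z hzp
        rwa [← ofReal_norm, ← ENNReal.ofReal_pow (norm_nonneg _), Real.norm_eq_abs] at this
    · rw [indicator_of_notMem hz]
      exact zero_le
  have h2 : ∫⁻ z : Amb d m, G (baseL z, transvL z) = ∫⁻ p, G p ∂(volume.prod volume) := by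
    have hme := measurePreserving_ptL (d := d) (m := m)
    have hm2 : Measurable fun z : Amb d m => G (baseL z, transvL z) :=
      hGm.comp (baseL.continuous.measurable.prodMk transvL.continuous.measurable)
    rw [← hme.lintegral_comp hm2]
    refine lintegral_congr fun p => ?_
    rw [ptL_apply, baseL_pt, transvL_apply, transv_pt]
  have h3 : ∫⁻ p, G p ∂(volume.prod volume)
      = ∫⁻ t : EuclideanSpace ℝ (Fin m),
        ENNReal.ofReal ((‖t‖ ^ Module.finrank ℝ (EuclideanSpace ℝ (Fin m)))⁻¹) * g ‖t‖ := by
    rw [lintegral_prod_symm' _ hGm]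
    refine lintegral_congr fun t => ?_
    simp only [hG]
    rw [lintegral_const_mul _ (by
      exact (hqm.indicator (measurableSet_ball.prod measurableSet_ball)).comp
        (measurable_id.prodMk measurable_const)), finrank_euclideanSpace_fin]
    congr 1
    by_cases ht : ‖t‖ < r
    · rw [hg, indicator_of_mem (show ‖t‖ ∈ Iio r from ht), ← lintegral_indicator measurableSet_ball]
      refine lintegral_congr fun y => ?_
      by_cases hy : y ∈ ball x r
      · rw [indicator_of_mem hy, indicator_of_mem (show (y, t) ∈ ball x r ×ˢ ball 0 r from
          ⟨hy, by simpa using ht⟩)]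
      · rw [indicator_of_notMem hy, indicator_of_notMem fun hh => hy hh.1]
    · rw [hg, indicator_of_notMem (show ‖t‖ ∉ Iio r from ht)]
      refine (lintegral_congr fun y => indicator_of_notMem (fun hh => ht ?_) _).trans lintegral_zero
      simpa using hh.2
  have h4 : ∫⁻ s, g s ∂logMeasure ≤ C * ENNReal.ofReal r ^ d := by
    have := hC x r hr
    rw [finrank_euclideanSpace_fin] at this
    refine le_trans ?_ this
    rw [← lintegral_indicator measurableSet_Ioo]
    refine lintegral_mono_ae ?_
    filter_upwards [ae_logMeasure_pos] with s hs
    rw [hg]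
    by_cases hsr : s < r
    · rw [indicator_of_mem (show s ∈ Iio r from hsr), indicator_of_mem (show s ∈ Ioo 0 r from ⟨hs, hsr⟩)]
    · rw [indicator_of_notMem (show s ∉ Iio r from hsr)]; exact zero_le
  rw [h2, h3, lintegral_norm_div_pow hgm] at h1
  refine h1.trans ?_
  rw [mul_assoc]
  exact mul_le_mul' le_rfl h4

/-- The scaled difference is Θ(P - Q) + (Θ - 1)Q. The first term measures how far the Jacobian is
from the frame, the second how far D is from |t|. -/
lemma mul_matNorm_sub_le {k Θ T Λ p e : ℝ} (hk : 0 ≤ k) {A A' P Q : Mat d m}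
    (hA : k • A = Θ • P) (hA' : k • A' = Q) (hΘ0 : 0 ≤ Θ) (hΘ : Θ ≤ T)
    (hPQ : ∀ i j, |P i j - Q i j| ≤ p) (hQ : ∀ i j, |Q i j| ≤ Λ) (he : |Θ - 1| ≤ e) (hp : 0 ≤ p)
    (hΛ : 0 ≤ Λ) : k * matNorm (A - A') ≤ (d + m) * (T * p + Λ * e) := by
  have hent : ∀ i j, |(k • (A - A')) i j| ≤ T * p + Λ * e := fun i j => by
    have e1 : (Θ • P - Q) i j = Θ * (P i j - Q i j) + Q i j * (Θ - 1) := by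
      rw [Matrix.sub_apply, Matrix.smul_apply, smul_eq_mul]; ring
    rw [smul_sub, hA, hA', e1]
    refine (abs_add_le _ _).trans (add_le_add ?_ ?_)
    · rw [abs_mul, abs_of_nonneg hΘ0]
      exact mul_le_mul hΘ (hPQ i j) (abs_nonneg _) (hΘ0.trans hΘ)
    · rw [abs_mul]
      exact mul_le_mul (hQ i j) he (abs_nonneg _) hΛ
  have h0 : 0 ≤ T * p + Λ * e :=
    add_nonneg (mul_nonneg (hΘ0.trans hΘ) hp) (mul_nonneg hΛ ((abs_nonneg _).trans he))
  refine le_trans (le_of_eq ?_) (matNorm_le h0 hent)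
  rw [matNorm, matNorm]
  simp only [Matrix.smul_apply, smul_eq_mul, mul_pow, ← Finset.mul_sum]
  rw [Real.sqrt_mul (by positivity), Real.sqrt_sq hk]

lemma ofReal_linear_le {n T Λ x y N : ℝ} (hn : 0 ≤ n) (hT : 0 ≤ T) (hΛ : 0 ≤ Λ) (hx : 0 ≤ x)
    {a : ℝ≥0∞} (hy : ‖y‖ₑ ≤ ENNReal.ofReal N * a) :
    ENNReal.ofReal (n * (T * x + Λ * |y|))
      ≤ ENNReal.ofReal (n * max T (Λ * N)) * (ENNReal.ofReal x + a) := by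
  rw [ENNReal.ofReal_mul hn, ENNReal.ofReal_mul hn, mul_assoc]
  refine mul_le_mul' le_rfl ?_
  rw [ENNReal.ofReal_add (mul_nonneg hT hx) (mul_nonneg hΛ (abs_nonneg y)), mul_add]
  refine add_le_add ?_ ?_
  · rw [ENNReal.ofReal_mul hT]
    exact mul_le_mul' (ENNReal.ofReal_le_ofReal (le_max_left _ _)) le_rfl
  · rw [ENNReal.ofReal_mul hΛ, ← Real.norm_eq_abs, ofReal_norm]
    refine (mul_le_mul' le_rfl hy).trans ?_
    rw [← mul_assoc, ← ENNReal.ofReal_mul hΛ]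
    exact mul_le_mul' (ENNReal.ofReal_le_ofReal (le_max_right _ _)) le_rfl

lemma ennreal_add_sq_le (a b : ℝ≥0∞) : (a + b) ^ 2 ≤ 4 * (a ^ 2 + b ^ 2) := by
  have h : ∀ a b : ℝ≥0∞, a ≤ b → (a + b) ^ 2 ≤ 4 * (a ^ 2 + b ^ 2) := fun a b hab => by
    calc (a + b) ^ 2 ≤ (b + b) ^ 2 := by gcongr
      _ = 4 * b ^ 2 := by ring
      _ ≤ 4 * (a ^ 2 + b ^ 2) := by gcongr; exact le_add_self
  rcases le_total a b with hab | hab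
  · exact h a b hab
  · rw [add_comm a b, add_comm (a ^ 2)]; exact h b a hab

/-- Functions controlled by the oscillation of the graph are square Carleson densities. -/
lemma exists_isCarleson (d : ℕ) (hm : 1 ≤ m) {α : ℝ} (hα : 0 < α) (c₀ N τ : ℝ) :
    ∃ C : ℝ, ∀ (F : EuclideanSpace ℝ (Fin d) → EuclideanSpace ℝ (Fin m))
      (K : ℝ≥0) (J : EuclideanSpace ℝ (Fin d) → ℝ), IsGraphData c₀ F K J →
      (∀ y, ‖graphField F J y - (0, c₀)‖ ≤ τ) → ∀ f : Amb d m → ℝ,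
      (∀ z ∉ plane d m, ‖f z‖ₑ ≤ ENNReal.ofReal N *
        (ENNReal.ofReal (osc (graphField F J) (baseL z) ‖transv z‖)
          + distOsc α (graphField F J) (baseL z) ‖transv z‖)) →
      ∀ C', C ≤ C' → IsCarleson C' (sqMeasure f) := by
  obtain ⟨C₁, hC₁, H₁⟩ := halfCarleson_osc (E := EuclideanSpace ℝ (Fin d)) (V := Param d m)
  obtain ⟨C₂, hC₂, H₂⟩ := halfCarleson_distOsc (E := EuclideanSpace ℝ (Fin d)) (V := Param d m) hα
    (τ + |c₀|)
  set S := (volume : Measure (EuclideanSpace ℝ (Fin m))).toSphere univ with hS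
  -- The 4 comes from (a + b)² ≤ 4(a² + b²), which separates the two oscillations.
  set n : ℝ≥0∞ := ENNReal.ofReal N ^ 2 * 4 with hn
  set C₀ : ℝ≥0∞ := n * (C₁ * ENNReal.ofReal (τ + |c₀|) ^ 2 + C₂) with hC₀
  have hS' : S ≠ ⊤ := measure_ne_top _ _
  have hC₀' : C₀ ≠ ⊤ := ENNReal.mul_ne_top (ENNReal.mul_ne_top (by simp) (by simp))
    (ENNReal.add_ne_top.2 ⟨ENNReal.mul_ne_top hC₁ (by simp), hC₂⟩)
  refine ⟨(S * C₀).toReal, fun F K J hD hτ f hf C' hC' x r hr => ?_⟩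
  have hfm := hD.measurable_graphField
  have hfb := norm_graphField_le hτ
  have q1 := H₁ (graphField F J) (ENNReal.ofReal (τ + |c₀|)) ENNReal.ofReal_ne_top hfm
    fun y => by rw [← ofReal_norm]; exact ENNReal.ofReal_le_ofReal (hfb y)
  have q2 := H₂ (graphField F J) hfm hfb
  have m1 : Measurable (Function.uncurry fun x r =>
      ENNReal.ofReal (osc (graphField F J) x r) ^ 2) :=
    (ENNReal.measurable_ofReal.comp (measurable_osc hfm)).pow_const 2
  have m2 : Measurable (Function.uncurry fun x r => distOsc α (graphField F J) x r ^ 2) :=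
    (measurable_distOsc α hfm).pow_const 2
  have m3 : Measurable (Function.uncurry fun x r => ENNReal.ofReal (osc (graphField F J) x r) ^ 2
      + distOsc α (graphField F J) x r ^ 2) := m1.add m2
  have q3 := (q1.add q2 m1).const_mul m3 n
  have key := sqMeasure_ball_le (f := f) hm (m3.const_mul n) q3 (fun z hz => by
    refine (pow_le_pow_left' (hf z hz) 2).trans ?_
    rw [mul_pow, hn, mul_assoc]
    exact mul_le_mul' le_rfl (ennreal_add_sq_le _ _)) x hr
  refine key.trans ?_
  rw [ENNReal.ofReal_mul' (by positivity), ENNReal.ofReal_pow hr.le]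
  refine mul_le_mul' ?_ le_rfl
  exact (ENNReal.ofReal_toReal (ENNReal.mul_ne_top hS' hC₀')).symm.le.trans
    (ENNReal.ofReal_le_ofReal hC')

end Transfer

/-! ### Change of variables in the weak form. -/

section WeakForm

lemma matOf_transpose_mulVec_gradient {ρ : Amb d m → Amb d m} {v : Amb d m → ℝ} {z : Amb d m}
    (hρ : DifferentiableAt ℝ ρ z) (hv : DifferentiableAt ℝ v (ρ z)) :
    (gradient (v ∘ ρ) z).ofLp
      = (matOf (fderiv ℝ ρ z))ᵀ *ᵥ (gradient v (ρ z)).ofLp := by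
  have h1 : ∀ w : Amb d m, inner ℝ (gradient (v ∘ ρ) z) w
      = ((matOf (fderiv ℝ ρ z))ᵀ *ᵥ (gradient v (ρ z)).ofLp) ⬝ᵥ w.ofLp := fun w => by
    rw [gradient, InnerProductSpace.toDual_symm_apply, fderiv_comp z hv hρ,
      ContinuousLinearMap.comp_apply, Matrix.mulVec_transpose, ← Matrix.dotProduct_mulVec,
      matOf_mulVec, dotProduct_eq_inner, gradient, InnerProductSpace.toDual_symm_apply]
  funext i
  have h2 := h1 (EuclideanSpace.single i 1)
  rw [← dotProduct_eq_inner] at h2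
  simpa using h2

/-- The weak form of a conjugated operator. -/
lemma weakForm_eq_weakForm_conjMatrix {ρ : Amb d m → Amb d m} {U V : Set (Amb d m)}
    (hU : IsOpen U) (hV : IsOpen V) (hinj : Function.Injective ρ) (himg : ρ '' U = V)
    (hρ : ∀ z ∈ U, DifferentiableAt ℝ ρ z) (hdet : ∀ z ∈ U, (matOf (fderiv ℝ ρ z)).det ≠ 0)
    (A : Amb d m → Mat d m) {u φ : Amb d m → ℝ} (hu : DifferentiableOn ℝ u V)
    (hφ : DifferentiableOn ℝ φ V) :
    weakForm V A u φ = weakForm U (conjMatrix ρ A) (u ∘ ρ) (φ ∘ ρ) := by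
  rw [weakForm, weakForm, ← himg, integral_image_eq_integral_abs_det_fderiv_smul volume
    hU.measurableSet (fun z hz => (hρ z hz).hasFDerivAt.hasFDerivWithinAt) hinj.injOn]
  refine setIntegral_congr_fun hU.measurableSet fun z hz => ?_
  have hz' : ρ z ∈ V := himg ▸ Set.mem_image_of_mem ρ hz
  have hn := hV.mem_nhds hz'
  have hd : IsUnit (matOf (fderiv ℝ ρ z)).det := isUnit_iff_ne_zero.2 (hdet z hz)
  simp only
  rw [matOf_transpose_mulVec_gradient (hρ z hz) ((hu _ hz').differentiableAt hn),
    matOf_transpose_mulVec_gradient (hρ z hz) ((hφ _ hz').differentiableAt hn),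
    conjMatrix, jac_eq_matOf, det_matOf]
  set P := matOf (fderiv ℝ ρ z) with hP
  have h1 : P * P⁻¹ = 1 := Matrix.mul_nonsing_inv _ hd
  have h2 : (P⁻¹)ᵀ * Pᵀ = 1 := by rw [← Matrix.transpose_mul, h1, Matrix.transpose_one]
  -- The gradients pull back by Pᵀ, so P⁻¹AP⁻ᵀ tested on Pᵀ∇u and Pᵀ∇φ returns A∇u · ∇φ; the
  -- identity is pointwise and therefore needs no integrability.
  rw [Matrix.smul_mulVec, smul_dotProduct, Matrix.mulVec_mulVec, Matrix.mul_assoc, h2,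
    Matrix.mul_one, Matrix.mulVec_transpose,
    dotProduct_comm ((P⁻¹ * A (ρ z)) *ᵥ (gradient u (ρ z)).ofLp), ← Matrix.dotProduct_mulVec,
    Matrix.mulVec_mulVec, ← Matrix.mul_assoc, h1, Matrix.one_mul, dotProduct_comm]

end WeakForm

end HighCodim

end

/-! ### Assembly of the main theorem. -/

theorem mainTheorem10 (d m : ℕ) (hm : 2 ≤ m) (α : ℝ) (hα : 0 < α) :
    ∃ ε : ℝ, 0 < ε ∧ ∃ C : ℝ, 1 ≤ C ∧
      ∀ (F : EuclideanSpace ℝ (Fin d) → EuclideanSpace ℝ (Fin m)) (K : NNReal),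
        LipschitzWith K F → (K : ℝ) ≤ ε →
        ∃ ρ : Amb d m → Amb d m,
          -- `ρ` is a bilipschitz bijection that maps the plane onto the graph
          Function.Bijective ρ ∧
          (∀ z w, C⁻¹ * ‖z - w‖ ≤ ‖ρ z - ρ w‖ ∧ ‖ρ z - ρ w‖ ≤ C * ‖z - w‖) ∧
          ρ '' plane d m = graphOf F ∧
          ContDiffOn ℝ 1 ρ (plane d m)ᶜ ∧
          -- `|D(ρ(x,t))/|t| - 1|² dx dt / |t|^(n-d)` is a Carleson measure
          IsCarleson C
            (sqMeasure fun z => smoothDist α (graphOf F) (ρ z) / ‖transv z‖ - 1) ∧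
          -- the conjugate of `div A ∇` is the operator with the conjugated matrix
          (∀ u φ : Amb d m → ℝ, ContDiffOn ℝ 1 u (graphOf F)ᶜ →
            ContDiff ℝ 1 φ → HasCompactSupport φ → tsupport φ ⊆ (graphOf F)ᶜ →
            weakForm (graphOf F)ᶜ (coeff α (graphOf F)) u φ =
              weakForm (plane d m)ᶜ (conjMatrix ρ (coeff α (graphOf F))) (u ∘ ρ) (φ ∘ ρ)) ∧
          -- the conjugated matrix is elliptic relative to the plane, and splits
          IsDegElliptic C (plane d m) (conjMatrix ρ (coeff α (graphOf F))) ∧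
          ∃ A₁ A₂ : Amb d m → Mat d m,
            (∀ i j, Measurable fun z => A₁ z i j) ∧
            (∀ i j, Measurable fun z => A₂ z i j) ∧
            (∀ z ∉ plane d m, conjMatrix ρ (coeff α (graphOf F)) z = A₁ z + A₂ z) ∧
            IsDegElliptic C (plane d m) A₁ ∧
            (∃ (A' : Amb d m → Matrix (Fin d) (Fin d) ℝ) (a : Amb d m → ℝ),
              (∀ z ∉ plane d m,
                A₁ z = Matrix.fromBlocks (A' z) 0 0 (a z • (1 : Matrix (Fin m) (Fin m) ℝ))) ∧
              ContDiffOn ℝ 1 a (plane d m)ᶜ ∧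
              IsCarleson C (sqMeasure fun z =>
                ‖transv z‖ * ‖gradient (fun w => ‖transv w‖ ^ ((m : ℤ) - 1) * a w) z‖)) ∧
            IsCarleson C (sqMeasure fun z => ‖transv z‖ ^ ((m : ℤ) - 1) * matNorm (A₂ z)) := by
  obtain ⟨c₀, hc₀, hgraph⟩ := exists_graph_density d m
  obtain ⟨δ, M, h, B, hB⟩ := exists_isFrame d m hα hc₀
  have hm1 : 1 ≤ m := by omega
  obtain ⟨τ₁, C₁, hτ₁, hC₁, H₁⟩ := hB.exists_bilipschitz hm
  obtain ⟨τ₂, N₂, hτ₂, hN₂, H₂⟩ := hB.exists_smoothDist_estimate hα hc₀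
  obtain ⟨θ, C₃, hθ, hC₃, H₃⟩ := hB.exists_isDegElliptic
  obtain ⟨τ₄, N₄, hτ₄, hτ₄δ, hN₄, H₄⟩ := hB.exists_conjForm_estimate hθ
  obtain ⟨τ₅, N₅, hτ₅, hN₅, H₅⟩ := hB.exists_transvCoeff_estimate
  -- All thresholds concern only the distance of the field from (0, c₀) and the size of K, so one
  -- smallness parameter, fixed before F, serves every estimate.
  set τ := min (min τ₁ τ₂) (min τ₄ τ₅) with hτdef
  have hτ0 : 0 < τ := lt_min (lt_min hτ₁ hτ₂) (lt_min hτ₄ hτ₅)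
  have l₁ : τ ≤ τ₁ := (min_le_left _ _).trans (min_le_left _ _)
  have l₂ : τ ≤ τ₂ := (min_le_left _ _).trans (min_le_right _ _)
  have l₄ : τ ≤ τ₄ := (min_le_right _ _).trans (min_le_left _ _)
  have l₅ : τ ≤ τ₅ := (min_le_right _ _).trans (min_le_right _ _)
  obtain ⟨ε, hε, H₀⟩ := exists_norm_graphField_sub_le d m c₀ hτ0
  -- bounds for the base matrix
  set Ψ := conjForm (matOf (frameMap B (0, c₀))) with hΨ
  -- Bounds the entries of every matrix within θ of the base one, in particular of the principal
  -- part.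
  set Λ := (∑ i, ∑ j, |Ψ i j|) + θ with hΛ
  have hΛ0 : 0 ≤ Λ :=
    add_nonneg (Finset.sum_nonneg fun _ _ => Finset.sum_nonneg fun _ _ => abs_nonneg _) hθ.le
  have hΨΛ : ∀ i j, |Ψ i j| + θ ≤ Λ := fun i j => add_le_add
    ((Finset.single_le_sum (f := fun j => |Ψ i j|) (fun _ _ => abs_nonneg _)
      (Finset.mem_univ j)).trans (Finset.single_le_sum (f := fun i => ∑ j, |Ψ i j|)
      (fun _ _ => Finset.sum_nonneg fun _ _ => abs_nonneg _) (Finset.mem_univ i))) le_rfl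
  -- The first entry weighs the Jacobian error, with 2^(m-1) bounding Θ; the second weighs the error
  -- in D/|t|, transferred to Θ by `zpow_ratio_bounds`.
  set N₆ : ℝ := max (2 ^ (m - 1) * N₄) (Λ * (2 * (m * 2 ^ m)) * N₂) with hN₆
  have hN₆0 : 0 ≤ N₆ := le_max_of_le_left (by positivity)
  obtain ⟨D₁, G₁⟩ := exists_isCarleson d hm1 hα c₀ N₂ τ
  obtain ⟨D₂, G₂⟩ := exists_isCarleson d hm1 hα c₀ N₅ τ
  obtain ⟨D₃, G₃⟩ := exists_isCarleson d hm1 hα c₀ ((d + m) * N₆) τ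
  set C := max (max C₁ C₃) (max D₁ (max D₂ D₃)) with hC
  have k₁ : C₁ ≤ C := (le_max_left _ _).trans (le_max_left _ _)
  have k₃ : C₃ ≤ C := (le_max_right _ _).trans (le_max_left _ _)
  have k₄ : D₁ ≤ C := (le_max_left _ _).trans (le_max_right _ _)
  have k₅ : D₂ ≤ C := ((le_max_left _ _).trans (le_max_right _ _)).trans (le_max_right _ _)
  have k₆ : D₃ ≤ C := ((le_max_right _ _).trans (le_max_right _ _)).trans (le_max_right _ _)
  have hC1 : 1 ≤ C := hC₁.trans k₁
  refine ⟨ε, hε, C, hC1, fun F K hF hK => ?_⟩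
  obtain ⟨J, hJm, hJl, hJu, hJd⟩ := hgraph F K hF
  have hD : IsGraphData c₀ F K J := ⟨hF, hJm, hJl, hJu, hJd⟩
  obtain ⟨hKτ, hτ⟩ := H₀ F K J hD hK
  have t : ∀ {σ : ℝ}, τ ≤ σ → ∀ y, ‖graphField F J y - (0, c₀)‖ ≤ σ := fun hσ y => (hτ y).trans hσ
  have hτδ : τ < δ := l₄.trans_lt hτ₄δ
  set ρ := flattening B F J with hρ
  obtain ⟨hbij, hbil⟩ := H₁ F K J hD (t l₁)
  have hdist := H₂ F K J hD (hKτ.trans l₂) (t l₂)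
  have hmat := H₄ F K J hD (t l₄)
  obtain ⟨haC, hagrad⟩ := H₅ F K J hD (t l₅)
  have hcd := hB.contDiffOn_flattening hD hτ hτδ
  have hopen : IsOpen (plane d m)ᶜ := isClosed_plane.isOpen_compl
  have hgopen : IsOpen (graphOf F)ᶜ := (isClosed_graphOf hF.continuous).isOpen_compl
  have himg : ρ '' (plane d m)ᶜ = (graphOf F)ᶜ := by
    rw [Set.image_compl_eq hbij, image_flattening_plane]
  -- the factor relating the two matrices
  set Θ : Amb d m → ℝ := fun z =>
    ‖transv z‖ ^ ((m : ℤ) - 1) * smoothDist α (graphOf F) (ρ z) ^ (1 - (m : ℤ)) with hΘ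
  have hΘb := fun z (hz : z ∉ plane d m) =>
    zpow_ratio_bounds (norm_transv_pos hz) (hdist z hz).1 hm1
  have hconj : ∀ z, ‖transv z‖ ^ ((m : ℤ) - 1) • conjMatrix ρ (coeff α (graphOf F)) z
      = Θ z • conjForm (matOf (fderiv ℝ ρ z)) := fun z => by
    rw [conjMatrix_coeff, smul_smul]
  have hprinc : ∀ z ∉ plane d m, ‖transv z‖ ^ ((m : ℤ) - 1) • principalMatrix B F J z
      = conjForm (matOf (frameMap B (graphParam F J (baseL z) ‖transv z‖))) := fun z hz => by
    rw [principalMatrix, Set.indicator_of_mem (Set.mem_compl hz), smul_smul,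
      zpow_norm_transv_mul hz, one_smul]
  refine ⟨ρ, hbij, fun z w => ⟨?_, (hbil z w).2.trans (by gcongr)⟩, image_flattening_plane, hcd,
    ?_, ?_, ?_, principalMatrix B F J,
    fun z => (plane d m)ᶜ.indicator (conjMatrix ρ (coeff α (graphOf F))) z
      - principalMatrix B F J z, ?_, ?_, ?_, ?_,
    ⟨fun z => (principalMatrix B F J z).toBlocks₁₁, transvCoeff h B F J, ?_, haC, ?_⟩, ?_⟩
  · refine le_trans ?_ (hbil z w).1
    have : C⁻¹ ≤ C₁⁻¹ := inv_anti₀ (one_pos.trans_le hC₁) k₁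
    gcongr
  · exact G₁ F K J hD hτ _ (fun z hz => (hdist z hz).2.trans
      (mul_le_mul' le_rfl le_add_self)) C k₄
  · intro u φ hu hφ _ _
    exact weakForm_eq_weakForm_conjMatrix hopen hgopen hbij.1 himg
      (fun z hz => (hcd.contDiffAt (hopen.mem_nhds hz)).differentiableAt one_ne_zero)
      (fun z hz => (hmat z hz).1) _ (hu.differentiableOn one_ne_zero)
      (hφ.differentiable one_ne_zero).differentiableOn
  · exact H₃ _ (fun z hz => ⟨Θ z, _, (hΘb z hz).1, (hΘb z hz).2.1, (hmat z hz).2.2.1, hconj z⟩)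
      C k₃
  · exact measurable_principalMatrix hB hD hτ hτδ fun z hz => (hmat z hz).2.1
  · intro i j
    exact (measurable_conjMatrix hB hD hτ hτδ (fun z hz => (hmat z hz).1) i j).sub
      (measurable_principalMatrix hB hD hτ hτδ (fun z hz => (hmat z hz).2.1) i j)
  · intro z hz
    simp only [Set.indicator_of_mem (Set.mem_compl hz), add_sub_cancel]
  · refine H₃ _ (fun z hz => ⟨1, _, pow_le_one₀ (by norm_num) (by norm_num),
      one_le_pow₀ one_le_two, (hmat z hz).2.2.2.1, ?_⟩) C k₃
    rw [hprinc z hz, one_smul]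
  · intro z hz
    have hp : graphParam F J (baseL z) ‖transv z‖ ∈ Metric.ball ((0, c₀) : Param d m) δ := by
      rw [Metric.mem_ball, dist_eq_norm]
      exact (hD.norm_graphParam_sub_le hτ _ _).trans_lt hτδ
    simp only [principalMatrix, Set.indicator_of_mem (Set.mem_compl hz)]
    rw [conjForm_of_gram (hmat z hz).2.1 (hB.gram_frameMap hp), Matrix.fromBlocks_smul,
      Matrix.toBlocks_fromBlocks₁₁, smul_zero, smul_zero, smul_smul, smul_smul]
    rfl
  · refine G₂ F K J hD hτ _ (fun z hz => ?_) C k₅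
    have h1 := hagrad z hz
    have h2 := ENNReal.ofReal_le_ofReal h1
    rw [ENNReal.ofReal_mul hN₅, ← abs_of_nonneg (a := ‖transv z‖ * _) (by positivity),
      ← Real.norm_eq_abs, ofReal_norm] at h2
    exact h2.trans (mul_le_mul' le_rfl le_self_add)
  · refine G₃ F K J hD hτ _ (fun z hz => ?_) C k₆
    have ho0 := osc_nonneg (graphField F J) (baseL z) ‖transv z‖
    obtain ⟨b1, b2, b3⟩ := hΘb z hz
    have hk0 : 0 ≤ ‖transv z‖ ^ ((m : ℤ) - 1) := zpow_nonneg (norm_nonneg _) _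
    have hQ : ∀ i j, |conjForm (matOf (frameMap B (graphParam F J (baseL z) ‖transv z‖))) i j|
        ≤ Λ := fun i j => by
      have h3 := (hmat z hz).2.2.2.1 i j
      have h4 := abs_sub_abs_le_abs_sub
        (conjForm (matOf (frameMap B (graphParam F J (baseL z) ‖transv z‖))) i j) (Ψ i j)
      linarith [hΨΛ i j]
    -- After scaling by |t|^(m-1) the two matrices are Θ times the conjugate by the true Jacobian
    -- and the conjugate by the frame. Their difference is bounded by `osc` plus |D/|t| - 1|, and
    -- the latter by `distOsc`.
    have hle := mul_matNorm_sub_le hk0 (hconj z) (hprinc z hz) (le_trans (by positivity) b1) b2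
      (hmat z hz).2.2.2.2 hQ b3 (mul_nonneg hN₄ ho0) hΛ0
    rw [← mul_assoc, ← mul_assoc Λ] at hle
    beta_reduce
    rw [Set.indicator_of_mem (Set.mem_compl hz), ← ofReal_norm,
      Real.norm_of_nonneg
      (mul_nonneg hk0 (show 0 ≤ matNorm _ from Real.sqrt_nonneg _))]
    exact (ENNReal.ofReal_le_ofReal hle).trans (ofReal_linear_le (by positivity)
      (by positivity) (by positivity) ho0 (hdist z hz).2)
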